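/- Let $Y$ be a closed smooth manifold (compact, without boundary) with a smooth positive density $dy$ (for instance a Riemannian volume), and let $E\to Y$ be a smooth Hermitian vector bundle, presented as a subbundle of some trivial bundle $Y\times\mathbb C^N$, i.e. as the range of a smooth field $P$ of orthogonal projections. Let $B$ be the space of smooth translation invariant kernels $\ell(s,y,z)\in\mathrm{Hom}(E_z,E_y)\subset \mathrm{End}(\mathbb C^N)$, $s\in\mathbb R$, $y,z\in Y$, with $\sup e^{m|s|}\|\ell(s,y,z)\|<\infty$ for every $m\in\mathbb N$ (this includes all kernels of compact support in $s$). Such an $\ell$ acts on $L^2(\mathbb R\times Y)$ by $(\ell f)(s,y)=\int \ell(s-t,y,z)f(t,z)\,dt\,dz$. For $\mu\in\mathbb R$ let $\hat\ell(\mu)$ be the integral operator on $L^2(Y)$ with kernel $\int_{\mathbb R} e^{-i\mu s}\ell(s,y,z)\,ds$, and let $\chi^0$ be multiplication by the characteristic function of $(-\infty,0]\times Y$. Let $\ell\ell'$ denote the convolution product, i.e. composition of kernels. (1) For all $\ell,\ell'\in B$ these integral operators are well defined and bounded, $\ell[\chi^0,\ell']$ is trace class, $\mu\mapsto\hat\ell(\mu)$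 is differentiable in operator norm, $\partial_\mu\hat\ell(\mu)\circ\hat\ell'(\mu)$ is trace class for every $\mu$ and its trace is integrable in $\mu$, and Roe's and Melrose's 1-cocycles coincide: $$\sigma_1(\ell,\ell'):=\mathrm{Tr}\big(\ell[\chi^0,\ell']\big)=\frac{i}{2\pi}\int_{\mathbb R}\mathrm{Tr}_Y\big(\partial_\mu\hat\ell(\mu)\circ\hat\ell'(\mu)\big)\,d\mu .$$ (2) $(\tau_0^r,\sigma_1)$ satisfies the relative cyclic cocycle condition, as follows. First, $\sigma_1(\ell,\ell')=-\sigma_1(\ell',\ell)$ and $\sigma_1(\ell_0\ell_1,\ell_2)-\sigma_1(\ell_0,\ell_1\ell_2)+\sigma_1(\ell_2\ell_0,\ell_1)=0$ on $B$. Next, let $X$ be a manifold with cylindrical end over $Y$: a smooth manifold with smooth positive density and an open smooth embedding of $(-\infty,\varepsilon)\times Y$, $\varepsilon>0$, onto whose image the density restricts as $dt\,dy$, such that the complement of $(-\infty,0)\times Y$ is compact; let $X$ carry a Hermitian bundle (again the range of a smooth field of orthogonal projections on $\mathbb C^N$) equal to $E$ along the end. Let $r(x)=t$ on $(-\infty,0)\times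 Y$ and $r=0$ elsewhere, and let $A$ be the space of smooth kernels $k$ on $X\times X$, with values in the homomorphisms of this bundle, such that $k(x,x')=O(e^{-m|r(x)-r(x')|})$ for every $m$ and such that for some $\ell\in B$, for every $m$ and uniformly for $t,t'<0$, $k((t,y),(t',z))-\ell(t-t',y,z)=O(e^{\max(t,t')}e^{-m|t-t'|})$. Put $I(k)(s,y,z)=\lim_{t\to-\infty}k((t+s,y),(t,z))$ (which then equals $\ell$) and, with $X_\lambda$ the complement of $(-\infty,-\lambda)\times Y$, $$\tau_0^r(k)=\lim_{\lambda\to+\infty}\Big(\int_{X_\lambda}\mathrm{tr}\,k(x,x)\,dx-\lambda\int_Y \mathrm{tr}\,I(k)(0,y,y)\,dy\Big).$$ Then for $k,k'\in A$ one has $I(k)\in B$, the limits defining $\tau^r_0(k)$ and $\tau_0^r(kk')$ exist, $I(kk')=I(k)I(k')$, and $$\tau_0^r(kk')-\tau_0^r(k'k)=\sigma_1\big(I(k),I(k')\big),$$ that is, $b\tau_0^r=I^*\sigma_1$ and $b\sigma_1=0$. -/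

import Mathlib

open MeasureTheory Filter Topology Set
open scoped Manifold ContDiff ENNReal

noncomputable section

namespace RoeMelrose

/-! ### Fibres, densities, Hermitian bundles -/

/-- The ambient fibre `ℂ^N` with its standard Hermitian inner product. -/
abbrev Fib (N : ℕ) : Type := EuclideanSpace ℂ (Fin N)

/-- Endomorphisms of the fibre `ℂ^N`. -/
abbrev EndFib (N : ℕ) : Type := Fib N →L[ℂ] Fib N

/-- The trace of an endomorphism of `ℂ^N`. -/
def fibTr {N : ℕ} (A : EndFib N) : ℂ :=
  LinearMap.trace ℂ (Fib N) (A : Fib N →ₗ[ℂ] Fib N)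

/-- `μ` is a smooth positive density on the manifold `M` (for instance the volume measure of a
Riemannian metric): in every chart it has a smooth positive density with respect to Lebesgue
measure. -/
def IsSmoothDensity (m : ℕ) {M : Type*} [TopologicalSpace M] [MeasurableSpace M]
    [ChartedSpace (EuclideanSpace ℝ (Fin m)) M] (μ : Measure M) : Prop :=
  ∀ e ∈ atlas (EuclideanSpace ℝ (Fin m)) M, ∃ ρ : EuclideanSpace ℝ (Fin m) → ℝ,
    ContDiffOn ℝ ∞ ρ e.target ∧ (∀ u ∈ e.target, 0 < ρ u) ∧
    (μ.restrict e.source).map e =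
      (volume.restrict e.target).withDensity (fun u => ENNReal.ofReal (ρ u))

/-- A smooth Hermitian vector bundle over `M`, presented as a subbundle of the trivial Hermitian
bundle `M × ℂ^N`: a smooth field of orthogonal projections, the fibre of the bundle at `x` being
the range of `P x`. The choice `P = 1` is the trivial bundle. -/
structure IsHermitianBundle (m N : ℕ) {M : Type*} [TopologicalSpace M]
    [ChartedSpace (EuclideanSpace ℝ (Fin m)) M] (P : M → EndFib N) : Prop where
  smooth : ContMDiff (𝓡 m) 𝓘(ℝ, EndFib N) ∞ P
  proj : ∀ x, IsStarProjection (P x)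

/-! ### Trace class operators and integral operators -/

section Trace

variable {H : Type*} [NormedAddCommGroup H] [InnerProductSpace ℂ H]

/-- Trace class operators on a Hilbert space: the operators `∑ₙ ⟨yₙ, ·⟩ xₙ` with
`∑ₙ ‖xₙ‖ ‖yₙ‖ < ∞`. -/
def IsTraceClass (T : H →L[ℂ] H) : Prop :=
  ∃ x y : ℕ → H, Summable (fun n => ‖x n‖ * ‖y n‖) ∧
    ∀ v, HasSum (fun n => inner ℂ (y n) v • x n) (T v)

/-- The trace `∑ᵢ ⟨bᵢ, T bᵢ⟩` over a Hilbert basis of `H` (for a trace class operator the sum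
converges absolutely and does not depend on the basis). -/
def opTrace [CompleteSpace H] (T : H →L[ℂ] H) : ℂ :=
  let b := (exists_hilbertBasis ℂ H).choose_spec.choose
  ∑' i, inner ℂ (b i) (T (b i))

end Trace

section Operators

variable {α : Type*} [MeasurableSpace α] {N : ℕ}

/-- `T` is the integral operator on `L²(α, μ; ℂ^N)` with kernel `K`. -/
def IsIntegralOperator (μ : Measure α) (K : α → α → EndFib N)
    (T : Lp (Fib N) 2 μ →L[ℂ] Lp (Fib N) 2 μ) : Prop :=
  ∀ f : Lp (Fib N) 2 μ, ∀ᵐ x ∂μ,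
    Integrable (fun y => K x y (f y)) μ ∧ T f x = ∫ y, K x y (f y) ∂μ

open scoped Classical in
/-- The bounded integral operator on `L²(α, μ; ℂ^N)` with kernel `K` (it is unique if it exists;
by convention it is `0` if there is none). -/
def integralOperator (μ : Measure α) (K : α → α → EndFib N) :
    Lp (Fib N) 2 μ →L[ℂ] Lp (Fib N) 2 μ :=
  if h : ∃ T, IsIntegralOperator μ K T then h.choose else 0

/-- Multiplication by the characteristic function of the measurable set `S` on `L²(α, μ; ℂ^N)`. -/
def mulIndicator (N : ℕ) (μ : Measure α) {S : Set α} (hS : MeasurableSet S) :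
    Lp (Fib N) 2 μ →L[ℂ] Lp (Fib N) 2 μ :=
  LinearMap.mkContinuous
    { toFun := fun f => ((Lp.memLp f).indicator hS).toLp (S.indicator f)
      map_add' := by
        intro f g
        rw [← MemLp.toLp_add]
        apply MemLp.toLp_congr
        filter_upwards [Lp.coeFn_add f g] with x hx
        by_cases hxS : x ∈ S
        · simp only [Pi.add_apply, indicator_of_mem hxS]
          exact hx
        · simp [hxS]
      map_smul' := by
        intro c f
        rw [RingHom.id_apply, ← MemLp.toLp_const_smul]
        apply MemLp.toLp_congr
        filter_upwards [Lp.coeFn_smul c f] with x hx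
        by_cases hxS : x ∈ S <;> simp [hxS, hx] }
    1 (by
      intro f
      rw [one_mul]
      apply Lp.norm_le_norm_of_ae_le
      filter_upwards [((Lp.memLp f).indicator hS).coeFn_toLp] with x hx
      simp only [LinearMap.coe_mk, AddHom.coe_mk]
      rw [hx]
      exact norm_indicator_le_norm_self _ _)

end Operators

/-! ### The cylinder `ℝ × Y` -/

section Cylinder

variable {Y : Type*} {N : ℕ}

/-- Translation invariant smoothing kernels on the cylinder `ℝ × Y`, acting on sections of the
bundle `P`. The kernel between the points `(s, y)` and `(t, z)` is `ℓ (s - t) y z`; it is smooth and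
decays faster than every exponential in `s - t`. Kernels of compact support in `s - t` qualify, and
so do the translation invariant smoothing operators of the small `b`-calculus. -/
structure IsInvariantKernel (n : ℕ) [TopologicalSpace Y]
    [ChartedSpace (EuclideanSpace ℝ (Fin n)) Y]
    (P : Y → EndFib N) (ℓ : ℝ → Y → Y → EndFib N) : Prop where
  smooth : ContMDiff (𝓘(ℝ, ℝ).prod ((𝓡 n).prod (𝓡 n))) 𝓘(ℝ, EndFib N) ∞
    (fun q : ℝ × Y × Y => ℓ q.1 q.2.1 q.2.2)
  section_left : ∀ s y z, P y * ℓ s y z = ℓ s y z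
  section_right : ∀ s y z, ℓ s y z * P z = ℓ s y z
  decay : ∀ m : ℕ, ∃ C : ℝ, ∀ s y z, ‖ℓ s y z‖ ≤ C * Real.exp (-(m * |s|))

variable [MeasurableSpace Y]

/-- The convolution product of translation invariant kernels, i.e. composition of operators. -/
def conv (ν : Measure Y) (ℓ ℓ' : ℝ → Y → Y → EndFib N) : ℝ → Y → Y → EndFib N :=
  fun s y z => ∫ q : ℝ × Y, ℓ (s - q.1) y q.2 * ℓ' q.1 q.2 z ∂((volume : Measure ℝ).prod ν)

/-- The Schwartz kernel on the cylinder of the translation invariant kernel `ℓ`. -/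
def cylKernel (ℓ : ℝ → Y → Y → EndFib N) : ℝ × Y → ℝ × Y → EndFib N :=
  fun p q => ℓ (p.1 - q.1) p.2 q.2

/-- The translation invariant operator on `L²(ℝ × Y)` defined by `ℓ`. -/
def cylOperator (ν : Measure Y) (ℓ : ℝ → Y → Y → EndFib N) :
    Lp (Fib N) 2 ((volume : Measure ℝ).prod ν) →L[ℂ] Lp (Fib N) 2 ((volume : Measure ℝ).prod ν) :=
  integralOperator ((volume : Measure ℝ).prod ν) (cylKernel ℓ)

/-- Multiplication by `χ⁰`, the characteristic function of `(-∞, 0] × Y`. -/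
def chiZero (N : ℕ) (ν : Measure Y) :
    Lp (Fib N) 2 ((volume : Measure ℝ).prod ν) →L[ℂ] Lp (Fib N) 2 ((volume : Measure ℝ).prod ν) :=
  mulIndicator N ((volume : Measure ℝ).prod ν)
    (S := Iic (0 : ℝ) ×ˢ (univ : Set Y)) (measurableSet_Iic.prod MeasurableSet.univ)

/-- The operator `ℓ [χ⁰, ℓ']` on `L²(ℝ × Y)`. -/
def roeOperator (ν : Measure Y) (ℓ ℓ' : ℝ → Y → Y → EndFib N) :
    Lp (Fib N) 2 ((volume : Measure ℝ).prod ν) →L[ℂ] Lp (Fib N) 2 ((volume : Measure ℝ).prod ν) :=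
  cylOperator ν ℓ * (chiZero N ν * cylOperator ν ℓ' - cylOperator ν ℓ' * chiZero N ν)

/-- Roe's 1-cocycle `σ₁(ℓ, ℓ') = Tr (ℓ [χ⁰, ℓ'])`. -/
def roeCocycle (ν : Measure Y) (ℓ ℓ' : ℝ → Y → Y → EndFib N) : ℂ :=
  opTrace (roeOperator ν ℓ ℓ')

/-- The kernel `∫ e^{-iμs} ℓ(s, y, z) ds` on `Y` of the Fourier transform of `ℓ` at `μ`. -/
def fourierKernel (ℓ : ℝ → Y → Y → EndFib N) (μ : ℝ) : Y → Y → EndFib N :=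
  fun y z => ∫ s : ℝ, Complex.exp (-(Complex.I * μ * s)) • ℓ s y z

/-- The indicial family: the operator `ℓ̂(μ)` on `L²(Y)`. -/
def indicialFamily (ν : Measure Y) (ℓ : ℝ → Y → Y → EndFib N) (μ : ℝ) :
    Lp (Fib N) 2 ν →L[ℂ] Lp (Fib N) 2 ν :=
  integralOperator ν (fourierKernel ℓ μ)

/-- The operator `∂_μ ℓ̂(μ) ∘ ℓ̂'(μ)` on `L²(Y)`. -/
def melroseOperator (ν : Measure Y) (ℓ ℓ' : ℝ → Y → Y → EndFib N) (μ : ℝ) :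
    Lp (Fib N) 2 ν →L[ℂ] Lp (Fib N) 2 ν :=
  deriv (indicialFamily ν ℓ) μ * indicialFamily ν ℓ' μ

/-- Melrose's 1-cocycle `(i/2π) ∫ Tr_Y (∂_μ ℓ̂(μ) ∘ ℓ̂'(μ)) dμ`. -/
def melroseCocycle (ν : Measure Y) (ℓ ℓ' : ℝ → Y → Y → EndFib N) : ℂ :=
  Complex.I / (2 * Real.pi) * ∫ μ : ℝ, opTrace (melroseOperator ν ℓ ℓ' μ)

end Cylinder

/-! ### Manifolds with a cylindrical end -/

/-- The structure of a manifold with cylindrical end `(-∞, 0] × Y` on `X`: the cylinder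
`(-∞, ε) × Y` is an open submanifold of `X`, the complement of `(-∞, 0) × Y` is compact, and
the density of `X` is the product density on the cylinder. -/
structure CylindricalEnd (n : ℕ) {Y X : Type*} [TopologicalSpace Y] [TopologicalSpace X]
    [ChartedSpace (EuclideanSpace ℝ (Fin n)) Y]
    [ChartedSpace (EuclideanSpace ℝ (Fin (n + 1))) X]
    [MeasurableSpace Y] [MeasurableSpace X] (ν : Measure Y) (μ : Measure X) where
  /-- the inclusion of the cylinder -/
  incl : OpenPartialHomeomorph (ℝ × Y) X
  /-- the width `ε` of the collar -/
  width : ℝ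
  width_pos : 0 < width
  source_eq : incl.source = Iio width ×ˢ univ
  smooth : ContMDiffOn (𝓘(ℝ, ℝ).prod (𝓡 n)) (𝓡 (n + 1)) ∞ incl incl.source
  smooth_symm : ContMDiffOn (𝓡 (n + 1)) (𝓘(ℝ, ℝ).prod (𝓡 n)) ∞ incl.symm incl.target
  isCompact_core : IsCompact (incl '' (Iio 0 ×ˢ univ))ᶜ
  density_eq : μ.restrict incl.target =
    (((volume : Measure ℝ).prod ν).restrict incl.source).map incl

/-- Composition of kernels on `X`. -/
def comp {X : Type*} [MeasurableSpace X] {N : ℕ} (μ : Measure X)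
    (k k' : X → X → EndFib N) : X → X → EndFib N :=
  fun x z => ∫ w, k x w * k' w z ∂μ

namespace CylindricalEnd

variable {n N : ℕ} {Y X : Type*} [TopologicalSpace Y] [TopologicalSpace X]
  [ChartedSpace (EuclideanSpace ℝ (Fin n)) Y]
  [ChartedSpace (EuclideanSpace ℝ (Fin (n + 1))) X]
  [MeasurableSpace Y] [MeasurableSpace X] {ν : Measure Y} {μ : Measure X}

open scoped Classical in
/-- The function on `X` equal to the coordinate `t` on `(-∞, 0) × Y` and to `0` elsewhere. -/
def endCoord (C : CylindricalEnd n ν μ) (x : X) : ℝ :=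
  if x ∈ C.incl '' (Iio 0 ×ˢ univ) then (C.incl.symm x).1 else 0

/-- The compact part `X_λ = X₀ ∪ [-λ, 0] × Y`, for `λ ≥ 0`. -/
def truncation (C : CylindricalEnd n ν μ) (r : ℝ) : Set X :=
  (C.incl '' (Iio (-r) ×ˢ univ))ᶜ

/-- Smoothing kernels on `X`, acting on sections of the bundle `Q`, that are asymptotically
translation invariant: they are smooth, decay faster than every exponential in the distance
along the end, and on the end they differ from an invariant kernel `ℓ` on `ℝ × Y` by an
exponentially small error, of size `e^{max(t, t')}` up to factors decaying in `|t - t'|`. The kernels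
that outside a compact set coincide with an invariant kernel of compact support on the end
qualify, and so do the smoothing operators of the small `b`-calculus (with boundary defining
function `e^t`). -/
structure IsSmoothingKernel (C : CylindricalEnd n ν μ) (P : Y → EndFib N) (Q : X → EndFib N)
    (k : X → X → EndFib N) : Prop where
  smooth : ContMDiff ((𝓡 (n + 1)).prod (𝓡 (n + 1))) 𝓘(ℝ, EndFib N) ∞
    (fun q : X × X => k q.1 q.2)
  section_left : ∀ x x', Q x * k x x' = k x x'
  section_right : ∀ x x', k x x' * Q x' = k x x'
  decay : ∀ m : ℕ, ∃ c : ℝ, ∀ x x',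
    ‖k x x'‖ ≤ c * Real.exp (-(m * |C.endCoord x - C.endCoord x'|))
  asymptotic : ∃ ℓ : ℝ → Y → Y → EndFib N, IsInvariantKernel n P ℓ ∧
    ∀ m : ℕ, ∃ c : ℝ, ∀ t < 0, ∀ t' < 0, ∀ y z,
      ‖k (C.incl (t, y)) (C.incl (t', z)) - ℓ (t - t') y z‖
        ≤ c * Real.exp (max t t') * Real.exp (-(m * |t - t'|))

/-- The indicial operator `I(k)`, the limit of `k` along the end under translation. -/
def indicialKernel (C : CylindricalEnd n ν μ) (k : X → X → EndFib N) :
    ℝ → Y → Y → EndFib N :=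
  fun s y z => limUnder atBot (fun t : ℝ => k (C.incl (t + s, y)) (C.incl (t, z)))

/-- `∫_{X_λ} tr k(x, x) - λ ∫_Y tr I(k)(0, y, y)`. -/
def regularizedIntegral (C : CylindricalEnd n ν μ) (k : X → X → EndFib N) (r : ℝ) : ℂ :=
  (∫ x in C.truncation r, fibTr (k x x) ∂μ) - r * ∫ y, fibTr (C.indicialKernel k 0 y y) ∂ν

/-- The regularized trace (`b`-trace) `τ₀ʳ(k)`, the limit of the regularized integrals. -/
def regularizedTrace (C : CylindricalEnd n ν μ) (k : X → X → EndFib N) : ℂ :=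
  limUnder atTop (C.regularizedIntegral k)

end CylindricalEnd

end RoeMelrose

end

open RoeMelrose

/-! Both cocycles, and the defect of the regularized trace, are equal to one explicit number: the
moment pairing `∫ s ∫∫ tr (ℓ(s,y,z) ℓ'(-s,z,y)) dy dz ds` (`momentPairing`).

Roe's side. The kernel `(χ(u) - χ(v)) ℓ'(u - v)` of `[χ⁰, ℓ']` is supported where `u` and `v` lie on
opposite sides of `0`. There `|u - v| = |u| + |v|`, so decay away from the diagonal is decay in both
variables. Moving a weight `e^{2|t|}` across the product exhibits `ℓ [χ⁰, ℓ']` as a product of two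
Hilbert-Schmidt operators (`roeOperator_eq_mul`), whose trace is a double integral of kernels
(`opTrace_mul`). The identity `∫ (χ(u) - χ(u + v)) du = v` then produces the factor `s`.

Melrose's side. The derivative of `ℓ̂` is the Fourier transform of `-i s ℓ`. Plancherel in `s`,
applied for fixed `y, z` to the matrix entries, turns the integral over `μ` into the same pairing
(`melroseCocycle_eq_momentPairing`).

Cocycle identities. The substitution `s ↦ -s` and cyclicity of the fibre trace give antisymmetry.
With `T(a, b)` the integral over `Y³` of `tr (ℓ₀(a) ℓ₁(b) ℓ₂(-a-b))`, the three terms of `b σ₁` are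
up to a common sign the integrals of `T` against the weights `a`, `b`, `-a-b`, which add up to zero
(`momentPairing_cocycle`).

Regularized trace. Along the end `kk'` differs from the convolution of the indicial kernels by
`O(e^{max(t,t')})` (`IsEndKernel.norm_comp_sub_conv_le`), so that `I` is multiplicative and the
limits exist. In the commutator the counterterms agree, and the antisymmetric function `tr (k(x,w)
k'(w,x)) - tr (k(w,x) k'(x,w))` integrates to zero over `X_λ × X_λ`; only `X_λ × X_λᶜ` is left
(`IsEndKernel.regularizedIntegral_sub`). Points `x` in the core contribute `O(e^{-λ})`. The rest,
translated by `λ`, converges dominatedly to the integral of the invariant kernels over the quadrant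
`p ≥ 0 > q`, which is the moment pairing once more. -/

noncomputable section

namespace RoeMelrose

open scoped NNReal InnerProductSpace

/-! ### The Schur test and bounded integral operators -/

section Schur

variable {α : Type*} [MeasurableSpace α] {N : ℕ} {μ : Measure α}

/-- The Schur test for nonnegative kernels. -/
theorem lintegral_sq_lintegral_mul_le [SFinite μ] {k : α → α → ℝ≥0∞} {f : α → ℝ≥0∞} {C : ℝ≥0∞}
    (hk : Measurable (Function.uncurry k)) (hf : Measurable f)
    (hrow : ∀ x, ∫⁻ y, k x y ∂μ ≤ C) (hcol : ∀ y, ∫⁻ x, k x y ∂μ ≤ C) :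
    ∫⁻ x, (∫⁻ y, k x y * f y ∂μ) ^ 2 ∂μ ≤ C ^ 2 * ∫⁻ y, f y ^ 2 ∂μ := by
  have hkx : ∀ x, Measurable (k x) := fun x => hk.comp measurable_prodMk_left
  -- Cauchy-Schwarz for the splitting `k f = k^{1/2} · (k^{1/2} f)`; the row bound controls the
  -- first factor. The column bound enters after Tonelli.
  have key : ∀ x, (∫⁻ y, k x y * f y ∂μ) ^ 2 ≤ C * ∫⁻ y, k x y * f y ^ 2 ∂μ := by
    intro x
    have h := ENNReal.lintegral_mul_le_Lp_mul_Lq μ Real.HolderConjugate.two_two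
      (f := fun y => k x y ^ (1 / 2 : ℝ)) (g := fun y => k x y ^ (1 / 2 : ℝ) * f y)
      ((hkx x).pow_const _).aemeasurable (((hkx x).pow_const _).mul hf).aemeasurable
    have e1 : ∀ y, (k x y ^ (1 / 2 : ℝ)) * (k x y ^ (1 / 2 : ℝ) * f y) = k x y * f y := by
      intro y
      rw [← mul_assoc, ← ENNReal.rpow_add_of_nonneg _ _ (by norm_num) (by norm_num)]
      norm_num
    have e2 : ∀ y, (k x y ^ (1 / 2 : ℝ)) ^ (2 : ℝ) = k x y := by
      intro y; rw [← ENNReal.rpow_mul]; norm_num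
    have e3 : ∀ y, (k x y ^ (1 / 2 : ℝ) * f y) ^ (2 : ℝ) = k x y * f y ^ 2 := by
      intro y
      rw [ENNReal.mul_rpow_of_nonneg _ _ (by norm_num), e2]
      norm_num
    simp only [Pi.mul_apply, e1, e2, e3] at h
    calc (∫⁻ y, k x y * f y ∂μ) ^ 2
        ≤ ((∫⁻ y, k x y ∂μ) ^ (1 / 2 : ℝ) * (∫⁻ y, k x y * f y ^ 2 ∂μ) ^ (1 / 2 : ℝ)) ^ 2 := by
          gcongr
      _ = (∫⁻ y, k x y ∂μ) * ∫⁻ y, k x y * f y ^ 2 ∂μ := by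
          rw [mul_pow, ← ENNReal.rpow_natCast, ← ENNReal.rpow_mul, ← ENNReal.rpow_natCast,
            ← ENNReal.rpow_mul]
          norm_num
      _ ≤ _ := by gcongr; exact hrow x
  have hm : Measurable (Function.uncurry fun x y => k x y * f y ^ 2) :=
    hk.mul ((hf.comp measurable_snd).pow_const 2)
  calc ∫⁻ x, (∫⁻ y, k x y * f y ∂μ) ^ 2 ∂μ ≤ ∫⁻ x, C * ∫⁻ y, k x y * f y ^ 2 ∂μ ∂μ :=
        lintegral_mono key
    _ = C * ∫⁻ y, ∫⁻ x, k x y * f y ^ 2 ∂μ ∂μ := by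
        rw [lintegral_const_mul _ hm.lintegral_prod_right, lintegral_lintegral_swap hm.aemeasurable]
    _ = C * ∫⁻ y, (∫⁻ x, k x y ∂μ) * f y ^ 2 ∂μ := by
        congr 1; apply lintegral_congr; intro y
        exact lintegral_mul_const _ (hk.comp measurable_prodMk_right)
    _ ≤ C * ∫⁻ y, C * f y ^ 2 ∂μ := by
        gcongr with y; exact hcol y
    _ = _ := by rw [lintegral_const_mul _ (hf.pow_const 2)]; ring

/-- Kernels to which the Schur test applies, with the constant `C`. -/
structure IsSchurKernel (μ : Measure α) (C : ℝ≥0) (K : α → α → EndFib N) : Prop where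
  stronglyMeasurable : StronglyMeasurable (Function.uncurry K)
  row : ∀ x, ∫⁻ y, ‖K x y‖ₑ ∂μ ≤ C
  col : ∀ y, ∫⁻ x, ‖K x y‖ₑ ∂μ ≤ C

theorem eLpNorm_two_sq {E : Type*} [NormedAddCommGroup E] (f : α → E) :
    eLpNorm f 2 μ ^ 2 = ∫⁻ x, ‖f x‖ₑ ^ 2 ∂μ := by
  have := eLpNorm_nnreal_pow_eq_lintegral (μ := μ) (f := f) (p := 2) (by norm_num)
  simpa using this

theorem memLp_two_of_lintegral_sq_lt_top {E : Type*} [NormedAddCommGroup E] {f : α → E}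
    (hf : AEStronglyMeasurable f μ) (h : ∫⁻ x, ‖f x‖ₑ ^ 2 ∂μ < ⊤) : MemLp f 2 μ := by
  refine ⟨hf, ?_⟩
  rw [← eLpNorm_two_sq] at h
  by_contra h'
  simp only [not_lt, top_le_iff] at h'
  simp [h'] at h

theorem lintegral_sq_lt_top_of_memLp {E : Type*} [NormedAddCommGroup E] {f : α → E}
    (hf : MemLp f 2 μ) : ∫⁻ x, ‖f x‖ₑ ^ 2 ∂μ < ⊤ := by
  rw [← eLpNorm_two_sq]
  exact ENNReal.pow_lt_top hf.2

theorem stronglyMeasurable_apply {β : Type*} [MeasurableSpace β] {A : β → EndFib N} {f : β → Fib N}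
    (hA : StronglyMeasurable A) (hf : StronglyMeasurable f) :
    StronglyMeasurable (fun x => A x (f x)) :=
  (isBoundedBilinearMap_apply (𝕜 := ℂ) (E := Fib N) (F := Fib N)).continuous.comp_stronglyMeasurable
    (hA.prodMk hf)

namespace IsSchurKernel

variable {C : ℝ≥0} {K : α → α → EndFib N}

theorem lintegral_sq_le [SFinite μ] (h : IsSchurKernel μ C K) (f : Lp (Fib N) 2 μ) :
    ∫⁻ x, (∫⁻ y, ‖K x y‖ₑ * ‖f y‖ₑ ∂μ) ^ 2 ∂μ ≤ (C * ‖f‖ₑ) ^ 2 := by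
  have := lintegral_sq_lintegral_mul_le (μ := μ) (k := fun x y => ‖K x y‖ₑ)
    (f := fun y => ‖f y‖ₑ) h.stronglyMeasurable.enorm (Lp.stronglyMeasurable f).enorm h.row h.col
  rwa [← eLpNorm_two_sq, ← Lp.enorm_def, ← mul_pow] at this

theorem measurable_lintegral [SFinite μ] (h : IsSchurKernel μ C K) (f : Lp (Fib N) 2 μ) :
    Measurable fun x => ∫⁻ y, ‖K x y‖ₑ * ‖f y‖ₑ ∂μ :=
  Measurable.lintegral_prod_right
    (f := fun x y => ‖K x y‖ₑ * ‖f y‖ₑ) (h.stronglyMeasurable.enorm.mul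
      ((Lp.stronglyMeasurable f).enorm.comp measurable_snd))

theorem stronglyMeasurable_kernel_apply (h : IsSchurKernel μ C K) (f : Lp (Fib N) 2 μ) :
    StronglyMeasurable fun p : α × α => K p.1 p.2 (f p.2) :=
  stronglyMeasurable_apply h.stronglyMeasurable
    ((Lp.stronglyMeasurable f).comp_measurable measurable_snd)

/-- By the Schur test the integral of the norms is square integrable in `x`, hence finite for almost
every `x`. -/
theorem ae_integrable [SFinite μ] (h : IsSchurKernel μ C K) (f : Lp (Fib N) 2 μ) :
    ∀ᵐ x ∂μ, Integrable (fun y => K x y (f y)) μ := by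
  have h1 : ∀ᵐ x ∂μ, (∫⁻ y, ‖K x y‖ₑ * ‖f y‖ₑ ∂μ) ^ 2 < ⊤ :=
    ae_lt_top ((h.measurable_lintegral f).pow_const 2) (((h.lintegral_sq_le f).trans_lt
      (ENNReal.pow_lt_top (ENNReal.mul_lt_top ENNReal.coe_lt_top enorm_lt_top))).ne)
  filter_upwards [h1] with x hx
  refine ⟨((h.stronglyMeasurable_kernel_apply f).comp_measurable
    measurable_prodMk_left).aestronglyMeasurable, ?_⟩
  refine lt_of_le_of_lt (lintegral_mono fun y => ContinuousLinearMap.le_opENorm _ _) ?_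
  exact (ENNReal.pow_lt_top_iff.1 hx).resolve_right two_ne_zero

theorem memLp [SFinite μ] (h : IsSchurKernel μ C K) (f : Lp (Fib N) 2 μ) :
    MemLp (fun x => ∫ y, K x y (f y) ∂μ) 2 μ ∧
      eLpNorm (fun x => ∫ y, K x y (f y) ∂μ) 2 μ ≤ C * ‖f‖ₑ := by
  have hle : ∫⁻ x, ‖∫ y, K x y (f y) ∂μ‖ₑ ^ 2 ∂μ ≤ (C * ‖f‖ₑ) ^ 2 := by
    refine le_trans (lintegral_mono fun x => ?_) (h.lintegral_sq_le f)
    gcongr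
    exact (enorm_integral_le_lintegral_enorm _).trans
      (lintegral_mono fun y => ContinuousLinearMap.le_opENorm _ _)
  constructor
  · exact memLp_two_of_lintegral_sq_lt_top
      ((h.stronglyMeasurable_kernel_apply f).integral_prod_right').aestronglyMeasurable
      (hle.trans_lt (ENNReal.pow_lt_top (ENNReal.mul_lt_top ENNReal.coe_lt_top enorm_lt_top)))
  · rw [← eLpNorm_two_sq] at hle
    exact (ENNReal.pow_le_pow_left_iff two_ne_zero).1 hle

/-- The integral operator of a Schur kernel is well defined and bounded. -/
theorem exists_isIntegralOperator [SFinite μ] (h : IsSchurKernel μ C K) :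
    ∃ T, IsIntegralOperator μ K T ∧ ‖T‖ ≤ C := by
  let T : Lp (Fib N) 2 μ →ₗ[ℂ] Lp (Fib N) 2 μ :=
    { toFun := fun f => (h.memLp f).1.toLp _
      map_add' := by
        intro f g
        rw [← MemLp.toLp_add]
        apply MemLp.toLp_congr
        filter_upwards [h.ae_integrable f, h.ae_integrable g] with x hf hg
        rw [Pi.add_apply, ← integral_add hf hg]
        apply integral_congr_ae
        filter_upwards [Lp.coeFn_add f g] with y hy
        rw [hy, Pi.add_apply, map_add]
      map_smul' := by
        intro c f
        rw [RingHom.id_apply, ← MemLp.toLp_const_smul]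
        apply MemLp.toLp_congr
        refine Eventually.of_forall fun x => ?_
        simp only [Pi.smul_apply]
        rw [← integral_smul]
        apply integral_congr_ae
        filter_upwards [Lp.coeFn_smul c f] with y hy
        rw [hy, Pi.smul_apply, map_smul] }
  have hT : ∀ f, ‖T f‖ ≤ C * ‖f‖ := by
    intro f
    have h1 : ‖T f‖ₑ ≤ C * ‖f‖ₑ := by
      rw [Lp.enorm_def]
      exact (eLpNorm_congr_ae (h.memLp f).1.coeFn_toLp).le.trans (h.memLp f).2
    have h2 := ENNReal.toReal_mono (ENNReal.mul_ne_top ENNReal.coe_ne_top enorm_ne_top) h1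
    simpa using h2
  refine ⟨T.mkContinuous C hT, fun f => ?_, LinearMap.mkContinuous_norm_le _ C.2 _⟩
  filter_upwards [h.ae_integrable f, (h.memLp f).1.coeFn_toLp] with x h1 h2
  exact ⟨h1, h2⟩

end IsSchurKernel

theorem IsIntegralOperator.unique {K : α → α → EndFib N} {T T' : Lp (Fib N) 2 μ →L[ℂ] Lp (Fib N) 2 μ}
    (h : IsIntegralOperator μ K T) (h' : IsIntegralOperator μ K T') : T = T' := by
  ext1 f
  apply Lp.ext
  filter_upwards [h f, h' f] with x h1 h2
  rw [h1.2, h2.2]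

theorem isIntegralOperator_integralOperator {K : α → α → EndFib N}
    (h : ∃ T, IsIntegralOperator μ K T) : IsIntegralOperator μ K (integralOperator μ K) := by
  unfold integralOperator
  rw [dif_pos h]
  exact h.choose_spec

theorem IsIntegralOperator.integralOperator_eq {K : α → α → EndFib N}
    {T : Lp (Fib N) 2 μ →L[ℂ] Lp (Fib N) 2 μ} (h : IsIntegralOperator μ K T) :
    integralOperator μ K = T :=
  (isIntegralOperator_integralOperator ⟨T, h⟩).unique h

theorem IsSchurKernel.isIntegralOperator [SFinite μ] {C : ℝ≥0} {K : α → α → EndFib N}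
    (h : IsSchurKernel μ C K) : IsIntegralOperator μ K (integralOperator μ K) :=
  isIntegralOperator_integralOperator ⟨_, h.exists_isIntegralOperator.choose_spec.1⟩

theorem IsSchurKernel.norm_integralOperator_le [SFinite μ] {C : ℝ≥0} {K : α → α → EndFib N}
    (h : IsSchurKernel μ C K) : ‖integralOperator μ K‖ ≤ C := by
  obtain ⟨T, hT, hC⟩ := h.exists_isIntegralOperator
  rwa [hT.integralOperator_eq]

end Schur

/-! ### Fibre trace and the Hilbert-Schmidt inner product -/

section Trace

variable {α : Type*} [MeasurableSpace α] {N : ℕ} {μ : Measure α}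

theorem fibTr_eq_sum_inner (A : EndFib N) :
    fibTr A = ∑ a, ⟪EuclideanSpace.basisFun (Fin N) ℂ a, A (EuclideanSpace.basisFun (Fin N) ℂ a)⟫_ℂ :=
  LinearMap.trace_eq_sum_inner _ _

/-- The trace on the fibre as a continuous linear functional. -/
def fibTrCLM (N : ℕ) : EndFib N →L[ℂ] ℂ :=
  ∑ a, (innerSL ℂ (EuclideanSpace.basisFun (Fin N) ℂ a)).comp
    (ContinuousLinearMap.apply ℂ (Fib N) (EuclideanSpace.basisFun (Fin N) ℂ a))

theorem fibTrCLM_apply (A : EndFib N) : fibTrCLM N A = fibTr A := by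
  rw [fibTr_eq_sum_inner, fibTrCLM]
  simp

theorem norm_fibTr_le (A : EndFib N) : ‖fibTr A‖ ≤ ‖fibTrCLM N‖ * ‖A‖ := by
  rw [← fibTrCLM_apply]
  exact (fibTrCLM N).le_opNorm A

theorem norm_fibTr_mul_le (A B : EndFib N) : ‖fibTr (A * B)‖ ≤ ‖fibTrCLM N‖ * (‖A‖ * ‖B‖) :=
  (norm_fibTr_le _).trans (by gcongr; exact norm_mul_le _ _)

theorem fibTr_mul_comm (A B : EndFib N) : fibTr (A * B) = fibTr (B * A) := by
  unfold fibTr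
  exact LinearMap.trace_mul_comm ℂ (A : Fib N →ₗ[ℂ] Fib N) (B : Fib N →ₗ[ℂ] Fib N)

theorem integral_fibTr {β : Type*} [MeasurableSpace β] {m : Measure β} {A : β → EndFib N}
    (hA : Integrable A m) : ∫ x, fibTr (A x) ∂m = fibTr (∫ x, A x ∂m) := by
  simp only [← fibTrCLM_apply]
  exact (fibTrCLM N).integral_comp_comm hA

theorem integrable_fibTr {β : Type*} [MeasurableSpace β] {m : Measure β} {A : β → EndFib N}
    (hA : Integrable A m) : Integrable (fun x => fibTr (A x)) m := by
  simp only [← fibTrCLM_apply]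
  exact (fibTrCLM N).integrable_comp hA

theorem stronglyMeasurable_fibTr {β : Type*} [MeasurableSpace β] {A : β → EndFib N}
    (hA : StronglyMeasurable A) : StronglyMeasurable (fun x => fibTr (A x)) := by
  simp only [← fibTrCLM_apply]
  exact (fibTrCLM N).continuous.comp_stronglyMeasurable hA

theorem integrable_mul_of_memLp_two {β : Type*} [MeasurableSpace β] {m : Measure β}
    {A B : β → EndFib N} (hA : MemLp A 2 m) (hB : MemLp B 2 m) :
    Integrable (fun x => A x * B x) m := by
  have h := ((memLp_two_iff_integrable_sq_norm hA.1).1 hA).add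
    ((memLp_two_iff_integrable_sq_norm hB.1).1 hB)
  refine h.mono (hA.1.mul hB.1) (Eventually.of_forall fun x => ?_)
  rw [Pi.add_apply, Real.norm_of_nonneg (by positivity)]
  refine (norm_mul_le _ _).trans ?_
  nlinarith [sq_nonneg (‖A x‖ - ‖B x‖), sq_nonneg (‖A x‖ + ‖B x‖), norm_nonneg (A x)]

/-- The adjoint of an endomorphism of the fibre. -/
def adj (A : EndFib N) : EndFib N := ContinuousLinearMap.adjoint A

theorem norm_adj (A : EndFib N) : ‖adj A‖ = ‖A‖ :=
  LinearIsometryEquiv.norm_map ContinuousLinearMap.adjoint A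

theorem adj_adj (A : EndFib N) : adj (adj A) = A :=
  ContinuousLinearMap.adjoint_adjoint A

theorem continuous_adj : Continuous (adj : EndFib N → EndFib N) :=
  LinearIsometryEquiv.continuous ContinuousLinearMap.adjoint

theorem memLp_adj {β : Type*} [MeasurableSpace β] {m : Measure β}
    {A : β → EndFib N} (hA : MemLp A 2 m) : MemLp (fun x => adj (A x)) 2 m :=
  hA.of_le (continuous_adj.comp_aestronglyMeasurable hA.1)
    (Eventually.of_forall fun _ => (norm_adj _).le)

theorem inner_adj_apply (A : EndFib N) (u v : Fib N) : ⟪adj A u, v⟫_ℂ = ⟪u, A v⟫_ℂ := by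
  rw [adj, ContinuousLinearMap.adjoint_inner_left]

theorem memLp_apply_const {A : α → EndFib N} (hA : MemLp A 2 μ) (v : Fib N) :
    MemLp (fun y => A y v) 2 μ := by
  exact (ContinuousLinearMap.apply ℂ (Fib N) v).comp_memLp' hA

theorem integrable_apply_of_memLp_two {A : α → EndFib N} (hA : MemLp A 2 μ)
    (f : Lp (Fib N) 2 μ) : Integrable (fun y => A y (f y)) μ := by
  have hf := Lp.memLp f
  have h := ((memLp_two_iff_integrable_sq_norm hA.1).1 hA).add
    ((memLp_two_iff_integrable_sq_norm hf.1).1 hf)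
  refine h.mono ((isBoundedBilinearMap_apply (𝕜 := ℂ) (E := Fib N) (F := Fib
    N)).continuous.comp_aestronglyMeasurable (hA.1.prodMk hf.1)) (Eventually.of_forall fun x => ?_)
  rw [Pi.add_apply, Real.norm_of_nonneg (by positivity)]
  refine ((A x).le_opNorm _).trans ?_
  nlinarith [sq_nonneg (‖A x‖ - ‖f x‖), sq_nonneg (‖A x‖ + ‖f x‖), norm_nonneg (A x)]

/-- Parseval at a fixed point `x`, with `k` and `c` playing the rows of two kernels. The `a`-th
component of `∫ k bᵢ` is the inner product of `bᵢ` with the `L²` section `k* e_a`, so for each of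
the finitely many `a` the sum over `i` is an inner product in `L²`. -/
theorem hasSum_inner_integral_apply {ι : Type*} (b : HilbertBasis ι ℂ (Lp (Fib N) 2 μ))
    {k c : α → EndFib N} (hk : MemLp k 2 μ) (hc : MemLp c 2 μ) :
    HasSum (fun i => ⟪∫ y, c y (b i y) ∂μ, ∫ y, k y (b i y) ∂μ⟫_ℂ)
      (∫ y, fibTr (k y * adj (c y)) ∂μ) := by
  let e := EuclideanSpace.basisFun (Fin N) ℂ
  have key : ∀ {A : α → EndFib N} (hA : MemLp A 2 μ) (a : Fin N) (f : Lp (Fib N) 2 μ),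
      ⟪e a, ∫ y, A y (f y) ∂μ⟫_ℂ = ⟪(memLp_apply_const (memLp_adj hA) (e a)).toLp _, f⟫_ℂ := by
    intro A hA a f
    rw [← integral_inner (integrable_apply_of_memLp_two hA f), L2.inner_def]
    apply integral_congr_ae
    filter_upwards [(memLp_apply_const (memLp_adj hA) (e a)).coeFn_toLp] with y hy
    rw [hy, inner_adj_apply]
  have e1 : ∀ i, ⟪∫ y, c y (b i y) ∂μ, ∫ y, k y (b i y) ∂μ⟫_ℂ =
      ∑ a, ⟪(memLp_apply_const (memLp_adj hk) (e a)).toLp _, b i⟫_ℂ *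
        ⟪b i, (memLp_apply_const (memLp_adj hc) (e a)).toLp _⟫_ℂ := by
    intro i
    rw [← e.sum_inner_mul_inner]
    refine Finset.sum_congr rfl fun a _ => ?_
    rw [key hk, ← inner_conj_symm, key hc, inner_conj_symm, mul_comm]
  have e2 : ∫ y, fibTr (k y * adj (c y)) ∂μ =
      ∑ a, ⟪(memLp_apply_const (memLp_adj hk) (e a)).toLp _,
        (memLp_apply_const (memLp_adj hc) (e a)).toLp _⟫_ℂ := by
    have e3 : ∀ a, ⟪(memLp_apply_const (memLp_adj hk) (e a)).toLp _,
        (memLp_apply_const (memLp_adj hc) (e a)).toLp _⟫_ℂ =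
        ∫ y, ⟪e a, (k y * adj (c y)) (e a)⟫_ℂ ∂μ := by
      intro a
      rw [L2.inner_def]
      apply integral_congr_ae
      filter_upwards [(memLp_apply_const (memLp_adj hk) (e a)).coeFn_toLp,
        (memLp_apply_const (memLp_adj hc) (e a)).coeFn_toLp] with y h1 h2
      rw [h1, h2, inner_adj_apply]
      rfl
    simp only [e3]
    rw [← integral_finsetSum]
    · exact integral_congr_ae (Eventually.of_forall fun y => fibTr_eq_sum_inner _)
    · intro a _
      let Λ : EndFib N →L[ℂ] ℂ := (innerSL ℂ (e a)).comp (ContinuousLinearMap.apply ℂ (Fib N) (e a))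
      have hΛ : ∀ A : EndFib N, ⟪e a, A (e a)⟫_ℂ = Λ A := fun _ => rfl
      simp only [hΛ]
      exact Λ.integrable_comp (integrable_mul_of_memLp_two hk (memLp_adj hc))
  simp only [e1, e2]
  exact hasSum_sum fun a _ => b.hasSum_inner_mul_inner _ _

theorem ae_memLp_two_section [SFinite μ] {K : α → α → EndFib N}
    (hK : StronglyMeasurable (Function.uncurry K)) (h2 : MemLp (Function.uncurry K) 2 (μ.prod μ)) :
    ∀ᵐ x ∂μ, MemLp (K x) 2 μ := by
  have h := lintegral_sq_lt_top_of_memLp h2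
  rw [lintegral_prod _ (hK.enorm.pow_const 2).aemeasurable] at h
  have hm : Measurable fun x => ∫⁻ y, ‖K x y‖ₑ ^ 2 ∂μ :=
    (hK.enorm.pow_const 2).lintegral_prod_right'
  filter_upwards [ae_lt_top hm h.ne] with x hx
  exact memLp_two_of_lintegral_sq_lt_top
    (hK.comp_measurable measurable_prodMk_left).aestronglyMeasurable hx

/-- The Hilbert-Schmidt inner product of two integral operators. -/
theorem hasSum_inner_integralOperator [SFinite μ] {ι : Type*} [Countable ι]
    (b : HilbertBasis ι ℂ (Lp (Fib N) 2 μ)) {K L : α → α → EndFib N}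
    {S T : Lp (Fib N) 2 μ →L[ℂ] Lp (Fib N) 2 μ}
    (hS : IsIntegralOperator μ K S) (hT : IsIntegralOperator μ L T)
    (hK : StronglyMeasurable (Function.uncurry K)) (hL : StronglyMeasurable (Function.uncurry L))
    (hK2 : MemLp (Function.uncurry K) 2 (μ.prod μ))
    (hL2 : MemLp (Function.uncurry L) 2 (μ.prod μ)) :
    HasSum (fun i => ⟪T (b i), S (b i)⟫_ℂ) (∫ x, ∫ y, fibTr (K x y * adj (L x y)) ∂μ ∂μ) := by
  simp only [L2.inner_def]
  have hpt : ∀ {K L : α → α → EndFib N} {S T : Lp (Fib N) 2 μ →L[ℂ] Lp (Fib N) 2 μ}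
      (_ : IsIntegralOperator μ K S) (_ : IsIntegralOperator μ L T)
      (_ : StronglyMeasurable (Function.uncurry K)) (_ : StronglyMeasurable (Function.uncurry L))
      (_ : MemLp (Function.uncurry K) 2 (μ.prod μ)) (_ : MemLp (Function.uncurry L) 2 (μ.prod μ)),
      ∀ᵐ x ∂μ, HasSum (fun i => ⟪T (b i) x, S (b i) x⟫_ℂ)
        (∫ y, fibTr (K x y * adj (L x y)) ∂μ) := by
    intro K L S T hS hT hK hL hK2 hL2
    filter_upwards [ae_memLp_two_section hK hK2, ae_memLp_two_section hL hL2,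
      ae_all_iff.2 fun i => hS (b i), ae_all_iff.2 fun i => hT (b i)] with x h1 h2 h3 h4
    simp only [fun i => (h3 i).2, fun i => (h4 i).2]
    exact hasSum_inner_integral_apply b h1 h2
  -- The diagonal case has nonnegative terms and supplies the dominating series.
  have hre : ∀ {K : α → α → EndFib N} {S : Lp (Fib N) 2 μ →L[ℂ] Lp (Fib N) 2 μ}
      (_ : IsIntegralOperator μ K S) (_ : StronglyMeasurable (Function.uncurry K))
      (_ : MemLp (Function.uncurry K) 2 (μ.prod μ)),
      ∀ᵐ x ∂μ, HasSum (fun i => ‖S (b i) x‖ ^ 2)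
        (∫ y, fibTr (K x y * adj (K x y)) ∂μ).re := by
    intro K S hS hK hK2
    filter_upwards [hpt hS hS hK hK hK2 hK2] with x hx
    have := Complex.hasSum_re hx
    simpa only [inner_self_eq_norm_sq_to_K, ← Complex.ofReal_pow, Complex.coe_algebraMap,
      Complex.ofReal_re] using this
  have hint : ∀ {K : α → α → EndFib N} (_ : MemLp (Function.uncurry K) 2 (μ.prod μ)),
      Integrable (fun x => (∫ y, fibTr (K x y * adj (K x y)) ∂μ).re) μ := by
    intro K hK2
    exact (integrable_fibTr
      (integrable_mul_of_memLp_two hK2 (memLp_adj hK2))).integral_prod_left.re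
  -- The pointwise identity is summed under the integral over `x`; the dominating terms sum to the
  -- row integrals of `tr (K K*)` and `tr (L L*)`, integrable because the kernels are square
  -- integrable.
  refine hasSum_integral_of_dominated_convergence
    (fun i x => ‖S (b i) x‖ ^ 2 + ‖T (b i) x‖ ^ 2) (fun i => ?_) (fun i => ?_) ?_ ?_
    (hpt hS hT hK hL hK2 hL2)
  · exact (Lp.aestronglyMeasurable _).inner (Lp.aestronglyMeasurable _)
  · refine Eventually.of_forall fun x => (norm_inner_le_norm _ _).trans ?_
    nlinarith [sq_nonneg (‖S (b i) x‖ - ‖T (b i) x‖), sq_nonneg (‖S (b i) x‖ + ‖T (b i) x‖)]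
  · filter_upwards [hre hS hK hK2, hre hT hL hL2] with x h1 h2
    exact h1.summable.add h2.summable
  · refine ((hint hK2).add (hint hL2)).congr ?_
    filter_upwards [hre hS hK hK2, hre hT hL hL2] with x h1 h2
    exact (h1.add h2).tsum_eq.symm

end Trace

/-! ### Adjoints, and the trace of a product of Hilbert-Schmidt operators -/

section TraceFormula

variable {α : Type*} [MeasurableSpace α] {N : ℕ} {μ : Measure α}

theorem IsSchurKernel.adj {C : ℝ≥0} {K : α → α → EndFib N} (h : IsSchurKernel μ C K) :
    IsSchurKernel μ C (fun x y => adj (K y x)) where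
  stronglyMeasurable := continuous_adj.comp_stronglyMeasurable
    (h.stronglyMeasurable.comp_measurable measurable_swap)
  row x := by
    simpa only [← ofReal_norm, norm_adj] using h.col x
  col y := by
    simpa only [← ofReal_norm, norm_adj] using h.row y

/-- The Schur test puts `∫ ‖K‖ ‖g‖` in `L²`, and its product with `‖f‖` is integrable. This licenses
the Fubini argument that identifies the adjoint. -/
theorem IsSchurKernel.integrable_inner [SFinite μ] {C : ℝ≥0} {K : α → α → EndFib N}
    (h : IsSchurKernel μ C K) (f g : Lp (Fib N) 2 μ) :
    Integrable (fun p : α × α => ⟪f p.1, K p.1 p.2 (g p.2)⟫_ℂ) (μ.prod μ) := by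
  have hm : StronglyMeasurable (fun p : α × α => ⟪f p.1, K p.1 p.2 (g p.2)⟫_ℂ) :=
    ((Lp.stronglyMeasurable f).comp_measurable measurable_fst).inner
      (h.stronglyMeasurable_kernel_apply g)
  refine ⟨hm.aestronglyMeasurable, ?_⟩
  rw [hasFiniteIntegral_iff_enorm, lintegral_prod _ hm.enorm.aemeasurable]
  have hf := lintegral_sq_lt_top_of_memLp (Lp.memLp f)
  have hg := (h.lintegral_sq_le g).trans_lt
    (ENNReal.pow_lt_top (ENNReal.mul_lt_top ENNReal.coe_lt_top enorm_lt_top))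
  have key : ∀ a b : ℝ≥0∞, a * b ≤ a ^ 2 + b ^ 2 := by
    intro a b
    rcases le_total a b with hab | hab
    · exact (mul_le_mul_left hab b).trans (by rw [← sq]; exact le_add_self)
    · exact (mul_le_mul_right hab a).trans (by rw [← sq]; exact le_self_add)
  calc ∫⁻ x, ∫⁻ y, ‖⟪f x, K x y (g y)⟫_ℂ‖ₑ ∂μ ∂μ
      ≤ ∫⁻ x, ∫⁻ y, ‖f x‖ₑ * (‖K x y‖ₑ * ‖g y‖ₑ) ∂μ ∂μ := by
        gcongr with x y
        refine le_trans ?_ (mul_le_mul_right (ContinuousLinearMap.le_opENorm _ _) _)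
        rw [← ofReal_norm, ← ofReal_norm, ← ofReal_norm,
          ← ENNReal.ofReal_mul (norm_nonneg _)]
        exact ENNReal.ofReal_le_ofReal (norm_inner_le_norm _ _)
    _ = ∫⁻ x, ‖f x‖ₑ * ∫⁻ y, ‖K x y‖ₑ * ‖g y‖ₑ ∂μ ∂μ := by
        apply lintegral_congr; intro x
        exact lintegral_const_mul _
          ((h.stronglyMeasurable.comp_measurable measurable_prodMk_left).enorm.mul
            (Lp.stronglyMeasurable g).enorm)
    _ ≤ ∫⁻ x, (‖f x‖ₑ ^ 2 + (∫⁻ y, ‖K x y‖ₑ * ‖g y‖ₑ ∂μ) ^ 2) ∂μ :=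
        lintegral_mono fun x => key _ _
    _ < ⊤ := by
        rw [lintegral_add_left ((Lp.stronglyMeasurable f).enorm.pow_const 2)]
        exact ENNReal.add_lt_top.2 ⟨hf, hg⟩

/-- The adjoint of an integral operator. -/
theorem IsSchurKernel.isIntegralOperator_adjoint [SFinite μ] {C : ℝ≥0} {K : α → α → EndFib N}
    (h : IsSchurKernel μ C K) {T : Lp (Fib N) 2 μ →L[ℂ] Lp (Fib N) 2 μ}
    (hT : IsIntegralOperator μ K T) :
    IsIntegralOperator μ (fun x y => RoeMelrose.adj (K y x)) (ContinuousLinearMap.adjoint T) := by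
  have hS := h.adj.isIntegralOperator
  convert hS using 1
  symm
  rw [ContinuousLinearMap.eq_adjoint_iff]
  intro f g
  have e1 : ⟪f, T g⟫_ℂ = ∫ x, ∫ y, ⟪f x, K x y (g y)⟫_ℂ ∂μ ∂μ := by
    rw [L2.inner_def]
    apply integral_congr_ae
    filter_upwards [hT g] with x hx
    rw [hx.2, integral_inner hx.1]
  have e2 : ⟪integralOperator μ (fun x y => RoeMelrose.adj (K y x)) f, g⟫_ℂ
      = ∫ y, ∫ x, ⟪f x, K x y (g y)⟫_ℂ ∂μ ∂μ := by
    rw [L2.inner_def]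
    apply integral_congr_ae
    filter_upwards [hS f] with y hy
    rw [hy.2, ← inner_conj_symm, ← integral_inner hy.1, ← integral_conj]
    apply integral_congr_ae
    refine Eventually.of_forall fun x => ?_
    simp only [inner_conj_symm, inner_adj_apply]
  rw [e1, e2]
  exact (integral_integral_swap (h.integrable_inner f g)).symm

/-- Distinct basis vectors are `√2` apart, so the balls of radius `1/2` around them are disjoint.
Countability is what dominated convergence needs for the abstractly chosen basis in `opTrace`. -/
theorem countable_hilbertBasis {H ι : Type*} [NormedAddCommGroup H] [InnerProductSpace ℂ H]
    [TopologicalSpace.SeparableSpace H] (b : HilbertBasis ι ℂ H) : Countable ι := by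
  apply Pairwise.countable_of_isOpen_disjoint (s := fun i => Metric.ball (b i) (1 / 2))
  · intro i j hij
    apply Metric.ball_disjoint_ball
    have h1 : ‖b i - b j‖ ^ 2 = 2 := by
      rw [@norm_sub_sq ℂ, b.orthonormal.1, b.orthonormal.1, b.orthonormal.2 hij]
      norm_num
    rw [dist_eq_norm]
    nlinarith [norm_nonneg (b i - b j)]
  · exact fun i => Metric.isOpen_ball
  · exact fun i => ⟨b i, Metric.mem_ball_self (by norm_num)⟩

/-- `IsTraceClass` asks for a series over `ℕ`: a countable index set is embedded in `ℕ` and the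
vectors are extended by zero. -/
theorem isTraceClass_of_hasSum {H ι : Type*} [NormedAddCommGroup H] [InnerProductSpace ℂ H]
    [Countable ι] {T : H →L[ℂ] H} {x y : ι → H} (hs : Summable fun i => ‖x i‖ * ‖y i‖)
    (hT : ∀ v, HasSum (fun i => ⟪y i, v⟫_ℂ • x i) (T v)) : IsTraceClass T := by
  obtain ⟨e, he⟩ := Countable.exists_injective_nat ι
  have hx : ∀ i, Function.extend e x 0 (e i) = x i := fun i => he.extend_apply _ _ _
  have hy : ∀ i, Function.extend e y 0 (e i) = y i := fun i => he.extend_apply _ _ _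
  have h0 : ∀ n ∉ range e, Function.extend e x 0 n = 0 := fun n hn =>
    Function.extend_apply' _ _ _ (by simpa using hn)
  refine ⟨Function.extend e x 0, Function.extend e y 0, ?_, fun v => ?_⟩
  · rw [← he.summable_iff]
    · simpa only [Function.comp_def, hx, hy] using hs
    · intro n hn
      simp [h0 n hn]
  · rw [← he.hasSum_iff]
    · simpa only [Function.comp_def, hx, hy] using hT v
    · intro n hn
      simp [h0 n hn]

variable [SFinite μ]

theorem separableSpace_Lp_two [MeasurableSpace.CountablyGenerated α] : TopologicalSpace.SeparableSpace (Lp (Fib N) 2 μ) := by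
  have : Fact ((2 : ℝ≥0∞) ≠ ⊤) := ⟨by norm_num⟩
  infer_instance

theorem summable_norm_sq_integralOperator {ι : Type*} [Countable ι]
    (b : HilbertBasis ι ℂ (Lp (Fib N) 2 μ)) {K : α → α → EndFib N}
    {S : Lp (Fib N) 2 μ →L[ℂ] Lp (Fib N) 2 μ}
    (hS : IsIntegralOperator μ K S) (hK : StronglyMeasurable (Function.uncurry K))
    (hK2 : MemLp (Function.uncurry K) 2 (μ.prod μ)) : Summable fun i => ‖S (b i)‖ ^ 2 := by
  have := (Complex.hasSum_re (hasSum_inner_integralOperator b hS hS hK hK hK2 hK2)).summable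
  simpa only [inner_self_eq_norm_sq_to_K, ← Complex.ofReal_pow, Complex.coe_algebraMap,
    Complex.ofReal_re] using this

variable {A B : Lp (Fib N) 2 μ →L[ℂ] Lp (Fib N) 2 μ} {K L : α → α → EndFib N} {C : ℝ≥0}

theorem memLp_two_adj_swap (hK2 : MemLp (Function.uncurry K) 2 (μ.prod μ)) :
    MemLp (Function.uncurry fun x y => adj (K y x)) 2 (μ.prod μ) :=
  memLp_adj (hK2.comp_measurePreserving Measure.measurePreserving_swap)

variable [MeasurableSpace.CountablyGenerated α]

/-- The product of two Hilbert-Schmidt integral operators is trace class. -/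
theorem isTraceClass_mul (hA : IsIntegralOperator μ K A) (hB : IsIntegralOperator μ L B)
    (hK : StronglyMeasurable (Function.uncurry K)) (hL : IsSchurKernel μ C L)
    (hK2 : MemLp (Function.uncurry K) 2 (μ.prod μ))
    (hL2 : MemLp (Function.uncurry L) 2 (μ.prod μ)) : IsTraceClass (A * B) := by
  have := separableSpace_Lp_two (N := N) (μ := μ)
  let b := (exists_hilbertBasis ℂ (Lp (Fib N) 2 μ)).choose_spec.choose
  have := countable_hilbertBasis b
  have hsA := summable_norm_sq_integralOperator b hA hK hK2
  have hsB := summable_norm_sq_integralOperator b (hL.isIntegralOperator_adjoint hB)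
    hL.adj.stronglyMeasurable (memLp_two_adj_swap hL2)
  -- Expanding `B v` in the basis gives `A B = ∑ ⟨B* bᵢ, ·⟩ A bᵢ`, and both `‖A bᵢ‖` and `‖B* bᵢ‖`
  -- are square summable.
  refine isTraceClass_of_hasSum (x := fun i => A (b i))
    (y := fun i => ContinuousLinearMap.adjoint B (b i)) ?_ fun v => ?_
  · refine Summable.of_nonneg_of_le (fun i => by positivity) (fun i => ?_) (hsA.add hsB)
    nlinarith [sq_nonneg (‖A (b i)‖ - ‖ContinuousLinearMap.adjoint B (b i)‖),
      sq_nonneg (‖A (b i)‖ + ‖ContinuousLinearMap.adjoint B (b i)‖)]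
  · have h := (b.hasSum_repr (B v)).mapL A
    simp only [map_smul, b.repr_apply_apply, ← ContinuousLinearMap.adjoint_inner_left] at h
    exact h

/-- The trace of the product of two Hilbert-Schmidt integral operators. -/
theorem opTrace_mul (hA : IsIntegralOperator μ K A) (hB : IsIntegralOperator μ L B)
    (hK : IsSchurKernel μ C K) (hL : StronglyMeasurable (Function.uncurry L))
    (hK2 : MemLp (Function.uncurry K) 2 (μ.prod μ))
    (hL2 : MemLp (Function.uncurry L) 2 (μ.prod μ)) :
    opTrace (A * B) = ∫ x, ∫ y, fibTr (L x y * K y x) ∂μ ∂μ := by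
  have := separableSpace_Lp_two (N := N) (μ := μ)
  have := countable_hilbertBasis (exists_hilbertBasis ℂ (Lp (Fib N) 2 μ)).choose_spec.choose
  -- The trace is the Hilbert-Schmidt pairing of `B` with `A*`: `⟨bᵢ, A B bᵢ⟩ = ⟨A* bᵢ, B bᵢ⟩`.
  have h := hasSum_inner_integralOperator (exists_hilbertBasis ℂ (Lp (Fib N) 2 μ)).choose_spec.choose
    hB (hK.isIntegralOperator_adjoint hA) hL
    hK.adj.stronglyMeasurable hL2 (memLp_two_adj_swap hK2)
  simp only [adj_adj, ContinuousLinearMap.adjoint_inner_left] at h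
  exact h.tsum_eq

end TraceFormula

/-! ### Decaying kernels on the cylinder and the cutoff `χ` -/

section Decay

theorem integrable_exp_neg_mul_abs {a : ℝ} (ha : 0 < a) :
    Integrable fun s : ℝ => Real.exp (-(a * |s|)) := by
  rw [← integrableOn_univ, ← Iic_union_Ioi (a := (0 : ℝ)), integrableOn_union]
  constructor
  · refine (integrableOn_exp_mul_Iic ha 0).congr_fun (fun s hs => ?_) measurableSet_Iic
    simp only [abs_of_nonpos (mem_Iic.1 hs)]
    ring_nf
  · refine (integrableOn_exp_mul_Ioi (neg_lt_zero.2 ha) 0).congr_fun (fun s hs => ?_)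
      measurableSet_Ioi
    simp only [abs_of_pos (mem_Ioi.1 hs)]
    ring_nf

theorem integrable_exp_neg_abs : Integrable fun s : ℝ => Real.exp (-|s|) := by
  simpa using integrable_exp_neg_mul_abs one_pos

variable {Y : Type*} [MeasurableSpace Y] {N : ℕ}

/-- Measurable kernels on the cylinder decaying faster than every exponential. -/
structure IsDecayKernel (ℓ : ℝ → Y → Y → EndFib N) : Prop where
  stronglyMeasurable : StronglyMeasurable fun q : ℝ × Y × Y => ℓ q.1 q.2.1 q.2.2
  decay : ∀ m : ℕ, ∃ C : ℝ, ∀ s y z, ‖ℓ s y z‖ ≤ C * Real.exp (-(m * |s|))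

theorem IsDecayKernel.exists_bound {ℓ : ℝ → Y → Y → EndFib N} (h : IsDecayKernel ℓ) (m : ℕ) :
    ∃ C : ℝ, 0 ≤ C ∧ ∀ s y z, ‖ℓ s y z‖ ≤ C * Real.exp (-(m * |s|)) := by
  obtain ⟨C, hC⟩ := h.decay m
  exact ⟨max C 0, le_max_right _ _, fun s y z => (hC s y z).trans
    (mul_le_mul_of_nonneg_right (le_max_left _ _) (Real.exp_pos _).le)⟩

variable {ν : Measure Y} [IsFiniteMeasure ν]

theorem integrable_comp_fst {f : ℝ → ℝ} (hf : Integrable f) :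
    Integrable (fun q : ℝ × Y => f q.1) ((volume : Measure ℝ).prod ν) := by
  simpa using hf.mul_prod (ν := ν) (integrable_const (1 : ℝ))

/-- A kernel on the cylinder dominated by `c e^{-|s - t|}` satisfies the Schur test. -/
theorem isSchurKernel_of_le {K : ℝ × Y → ℝ × Y → EndFib N} {c : ℝ}
    (hK : StronglyMeasurable (Function.uncurry K))
    (h : ∀ p q, ‖K p q‖ ≤ c * Real.exp (-|p.1 - q.1|)) :
    ∃ C, IsSchurKernel ((volume : Measure ℝ).prod ν) C K := by
  -- Translation invariance of Lebesgue measure makes the Schur constant independent of the base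
  -- point.
  have hI : ∀ a : ℝ, ∫⁻ q : ℝ × Y, ENNReal.ofReal (c * Real.exp (-|a - q.1|))
      ∂((volume : Measure ℝ).prod ν) = ∫⁻ q : ℝ × Y, ENNReal.ofReal (c * Real.exp (-|q.1|))
      ∂((volume : Measure ℝ).prod ν) := by
    intro a
    have hm : ∀ b : ℝ, Measurable fun q : ℝ × Y => ENNReal.ofReal (c * Real.exp (-|b - q.1|)) :=
      fun b => by fun_prop
    rw [lintegral_prod _ (hm a).aemeasurable]
    have := hm 0
    simp only [zero_sub, abs_neg] at this
    rw [lintegral_prod _ this.aemeasurable]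
    simp only [lintegral_const]
    rw [lintegral_mul_const _ (by fun_prop), lintegral_mul_const _ (by fun_prop)]
    congr 1
    have e := lintegral_sub_right_eq_self (μ := (volume : Measure ℝ))
      (fun t => ENNReal.ofReal (c * Real.exp (-|t|))) a
    rw [← e]
    apply lintegral_congr
    intro t
    rw [abs_sub_comm]
  have hfin : ∫⁻ q : ℝ × Y, ENNReal.ofReal (c * Real.exp (-|q.1|))
      ∂((volume : Measure ℝ).prod ν) ≠ ⊤ := by
    have := ((integrable_comp_fst (ν := ν) integrable_exp_neg_abs).const_mul c).lintegral_lt_top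
    exact this.ne
  refine ⟨(∫⁻ q : ℝ × Y, ENNReal.ofReal (c * Real.exp (-|q.1|))
      ∂((volume : Measure ℝ).prod ν)).toNNReal, hK, fun p => ?_, fun q => ?_⟩
  · rw [ENNReal.coe_toNNReal hfin, ← hI p.1]
    refine lintegral_mono fun q => ?_
    rw [← ofReal_norm]
    exact ENNReal.ofReal_le_ofReal (h p q)
  · rw [ENNReal.coe_toNNReal hfin, ← hI q.1]
    refine lintegral_mono fun p => ?_
    rw [← ofReal_norm, abs_sub_comm]
    exact ENNReal.ofReal_le_ofReal (h p q)

theorem integrable_exp_prod :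
    Integrable (fun p : (ℝ × Y) × (ℝ × Y) => Real.exp (-|p.1.1|) * Real.exp (-|p.2.1|))
      (((volume : Measure ℝ).prod ν).prod ((volume : Measure ℝ).prod ν)) :=
  (integrable_comp_fst integrable_exp_neg_abs).mul_prod (integrable_comp_fst integrable_exp_neg_abs)

theorem memLp_two_of_le {K : ℝ × Y → ℝ × Y → EndFib N} {c : ℝ}
    (hK : StronglyMeasurable (Function.uncurry K))
    (h : ∀ p q, ‖K p q‖ ≤ c * (Real.exp (-|p.1|) * Real.exp (-|q.1|))) :
    MemLp (Function.uncurry K) 2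
      (((volume : Measure ℝ).prod ν).prod ((volume : Measure ℝ).prod ν)) := by
  rw [memLp_two_iff_integrable_sq_norm hK.aestronglyMeasurable]
  refine ((integrable_exp_prod (ν := ν)).const_mul (c ^ 2)).mono'
    (hK.norm.pow 2).aestronglyMeasurable (Eventually.of_forall fun p => ?_)
  have h1 := h p.1 p.2
  -- The weight is at most `1`, so its square is dominated by the weight itself, which is
  -- integrable.
  have h2 : Real.exp (-|p.1.1|) * Real.exp (-|p.2.1|) ≤ 1 := by
    rw [← Real.exp_add]
    exact Real.exp_le_one_iff.2 (by linarith [abs_nonneg p.1.1, abs_nonneg p.2.1])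
  have h3 : 0 ≤ Real.exp (-|p.1.1|) * Real.exp (-|p.2.1|) := by positivity
  rw [Real.norm_of_nonneg (by positivity)]
  calc ‖K p.1 p.2‖ ^ 2 ≤ (c * (Real.exp (-|p.1.1|) * Real.exp (-|p.2.1|))) ^ 2 := by gcongr
    _ = c ^ 2 * ((Real.exp (-|p.1.1|) * Real.exp (-|p.2.1|)) *
        (Real.exp (-|p.1.1|) * Real.exp (-|p.2.1|))) := by ring
    _ ≤ c ^ 2 * ((Real.exp (-|p.1.1|) * Real.exp (-|p.2.1|)) * 1) := by gcongr
    _ = _ := by rw [mul_one]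

/-- The characteristic function of `(-∞, 0]`. -/
def chi (t : ℝ) : ℝ := if t ≤ 0 then 1 else 0

theorem measurable_chi : Measurable chi :=
  Measurable.ite measurableSet_Iic measurable_const measurable_const

/-- The two values of `χ` differ only when `u` and `v` are on opposite sides of `0`. This is the
mechanism behind the trace class property: on the support of the commutator, distance to the
diagonal controls both `|u|` and `|v|`. -/
theorem abs_chi_sub_mul_exp_le (u v : ℝ) :
    |chi u - chi v| ≤ 1 ∧ (chi u - chi v ≠ 0 → |u| + |v| = |u - v|) := by
  unfold chi
  split_ifs with h1 h2 h2
  · simp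
  · push Not at h2
    refine ⟨by simp, fun _ => ?_⟩
    rw [abs_of_nonpos h1, abs_of_pos h2, abs_of_nonpos (by linarith)]; ring
  · push Not at h1
    refine ⟨by simp, fun _ => ?_⟩
    rw [abs_of_nonpos h2, abs_of_pos h1, abs_of_nonneg (by linarith)]; ring
  · simp

/-- `χ(u)` and `χ(u + v)` differ exactly on the interval between `-v` and `0`, and the sign of the
difference is that of `v`. This signed length is the origin of the factor `s` in the moment pairing.
-/
theorem integral_chi_sub_chi (v : ℝ) : ∫ u : ℝ, (chi u - chi (u + v)) = v := by
  rcases le_total 0 v with hv | hv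
  · have : (fun u => chi u - chi (u + v)) = (Ioc (-v) 0).indicator fun _ => (1 : ℝ) := by
      funext u
      unfold chi
      by_cases h : u ∈ Ioc (-v) 0
      · rw [indicator_of_mem h, if_pos h.2, if_neg (by linarith [h.1])]; norm_num
      · rw [indicator_of_notMem h]
        by_cases h0 : u ≤ 0
        · rw [if_pos h0, if_pos, sub_self]
          by_contra h1
          exact h ⟨by linarith, h0⟩
        · rw [if_neg h0, if_neg (by linarith), sub_self]
    rw [this, integral_indicator measurableSet_Ioc]
    simp [hv]
  · have : (fun u => chi u - chi (u + v)) = (Ioc 0 (-v)).indicator fun _ => (-1 : ℝ) := by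
      funext u
      unfold chi
      by_cases h : u ∈ Ioc 0 (-v)
      · rw [indicator_of_mem h, if_neg (by linarith [h.1]), if_pos (by linarith [h.2])]; norm_num
      · rw [indicator_of_notMem h]
        by_cases h0 : u ≤ 0
        · rw [if_pos h0, if_pos (by linarith), sub_self]
        · rw [if_neg h0, if_neg, sub_self]
          by_contra h1
          exact h ⟨by linarith, by linarith⟩
    rw [this, integral_indicator measurableSet_Ioc]
    simp [hv]

/-- Of the decay `e^{-2|u-v|}`, one half becomes `e^{-|u|} e^{-|v|}` on the support of the
difference and the other half is kept. -/
theorem norm_chi_sub_chi_smul_le {E : Type*} [NormedAddCommGroup E] [NormedSpace ℝ E] {x : E}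
    {c u v : ℝ} (hc : 0 ≤ c) (hx : ‖x‖ ≤ c * Real.exp (-(2 * |u - v|))) :
    ‖(chi u - chi v) • x‖ ≤ c * (Real.exp (-|u|) * Real.exp (-|v|)) * Real.exp (-|u - v|) := by
  obtain ⟨h1, h2⟩ := abs_chi_sub_mul_exp_le u v
  by_cases h0 : chi u - chi v = 0
  · rw [h0, zero_smul, norm_zero]; positivity
  · rw [norm_smul, Real.norm_eq_abs, ← Real.exp_add, mul_assoc, ← Real.exp_add, ← neg_add, h2 h0]
    calc |chi u - chi v| * ‖x‖ ≤ 1 * (c * Real.exp (-(2 * |u - v|))) := by gcongr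
      _ = _ := by rw [one_mul]; ring_nf

/-- Substitute `s = u + v` and integrate over `u` first; the remaining half of the decay of `h`
justifies Fubini. -/
theorem integral_integral_chi_sub_chi {h : ℝ → ℂ} (hm : StronglyMeasurable h) {c : ℝ} (hc : 0 ≤ c)
    (hb : ∀ v, ‖h v‖ ≤ c * Real.exp (-(2 * |v|))) :
    ∫ u : ℝ, ∫ s : ℝ, (chi u - chi s) • h (s - u) = ∫ v : ℝ, v • h v := by
  have e1 : ∀ u : ℝ, ∫ s : ℝ, (chi u - chi s) • h (s - u)
      = ∫ v : ℝ, (chi u - chi (u + v)) • h v := by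
    intro u
    rw [← integral_add_right_eq_self (fun s => (chi u - chi s) • h (s - u)) u]
    simp only [add_comm _ u, add_sub_cancel_left]
  simp only [e1]
  rw [integral_integral_swap]
  · congr 1
    funext v
    rw [integral_smul_const, integral_chi_sub_chi]
  · refine ((integrable_exp_neg_abs.mul_prod integrable_exp_neg_abs).const_mul c).mono' ?_
      (Eventually.of_forall fun p => ?_)
    · exact (StronglyMeasurable.smul (((measurable_chi.comp measurable_fst).sub
        (measurable_chi.comp (measurable_fst.add measurable_snd))).stronglyMeasurable)
        (hm.comp_measurable measurable_snd)).aestronglyMeasurable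
    · have h1 := norm_chi_sub_chi_smul_le (u := p.1) (v := p.1 + p.2) (x := h p.2) hc
        (by simpa using hb p.2)
      refine h1.trans ?_
      rw [mul_assoc]
      gcongr ?_ * ?_
      rw [mul_assoc]
      gcongr
      simp only [sub_add_cancel_left, abs_neg]
      exact mul_le_of_le_one_left (Real.exp_pos _).le (Real.exp_le_one_iff.2 (by simp))

end Decay

/-! ### Roe's cocycle as a moment pairing -/

section Roe

theorem real_smul_mul {N : ℕ} (c : ℝ) (A B : EndFib N) : (c • A) * B = c • (A * B) := rfl

theorem mul_real_smul {N : ℕ} (c : ℝ) (A B : EndFib N) : A * (c • B) = c • (A * B) := by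
  ext1 v
  exact A.map_smul_of_tower c (B v)

theorem fibTr_real_smul {N : ℕ} (c : ℝ) (A : EndFib N) : fibTr (c • A) = c • fibTr A := by
  rw [← fibTrCLM_apply, ← fibTrCLM_apply, ContinuousLinearMap.map_smul_of_tower]

variable {Y : Type*} [MeasurableSpace Y] {N : ℕ} {ℓ ℓ' : ℝ → Y → Y → EndFib N}

theorem IsDecayKernel.stronglyMeasurable_comp (h : IsDecayKernel ℓ) {β : Type*}
    [MeasurableSpace β] {f : β → ℝ} {g g' : β → Y} (hf : Measurable f) (hg : Measurable g)
    (hg' : Measurable g') : StronglyMeasurable fun x => ℓ (f x) (g x) (g' x) :=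
  h.stronglyMeasurable.comp_measurable (hf.prodMk (hg.prodMk hg'))

theorem IsDecayKernel.stronglyMeasurable_cylKernel (h : IsDecayKernel ℓ) :
    StronglyMeasurable (Function.uncurry (cylKernel ℓ)) :=
  h.stronglyMeasurable_comp (f := fun p : (ℝ × Y) × (ℝ × Y) => p.1.1 - p.2.1) (by fun_prop)
    (measurable_snd.comp measurable_fst) (measurable_snd.comp measurable_snd)

variable {ν : Measure Y} [IsFiniteMeasure ν]

theorem IsDecayKernel.isSchurKernel (h : IsDecayKernel ℓ) :
    ∃ C, IsSchurKernel ((volume : Measure ℝ).prod ν) C (cylKernel ℓ) := by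
  obtain ⟨c, hc⟩ := h.decay 1
  exact isSchurKernel_of_le h.stronglyMeasurable_cylKernel fun p q => by
    simpa [cylKernel] using hc (p.1 - q.1) p.2 q.2

theorem IsDecayKernel.isIntegralOperator_cylOperator (h : IsDecayKernel ℓ) :
    IsIntegralOperator ((volume : Measure ℝ).prod ν) (cylKernel ℓ) (cylOperator ν ℓ) :=
  h.isSchurKernel.choose_spec.isIntegralOperator

/-- The kernel of `ℓ` composed with the weight `e^{-2|t|}`. -/
def dampedKernel (ℓ : ℝ → Y → Y → EndFib N) : ℝ × Y → ℝ × Y → EndFib N :=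
  fun p q => Real.exp (-(2 * |q.1|)) • cylKernel ℓ p q

/-- The kernel of the commutator of `χ⁰` and `ℓ`, multiplied by the weight `e^{2|t|}`. -/
def commutatorKernel (ℓ : ℝ → Y → Y → EndFib N) : ℝ × Y → ℝ × Y → EndFib N :=
  fun p q => Real.exp (2 * |p.1|) • (chi p.1 - chi q.1) • cylKernel ℓ p q

theorem stronglyMeasurable_dampedKernel (h : IsDecayKernel ℓ) :
    StronglyMeasurable (Function.uncurry (dampedKernel ℓ)) :=
  StronglyMeasurable.smul (f := fun p : (ℝ × Y) × (ℝ × Y) => Real.exp (-(2 * |p.2.1|)))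
    (Measurable.stronglyMeasurable (by fun_prop)) h.stronglyMeasurable_cylKernel

theorem stronglyMeasurable_commutatorKernel (h : IsDecayKernel ℓ) :
    StronglyMeasurable (Function.uncurry (commutatorKernel ℓ)) :=
  StronglyMeasurable.smul (f := fun p : (ℝ × Y) × (ℝ × Y) => Real.exp (2 * |p.1.1|))
    (Measurable.stronglyMeasurable (by fun_prop))
    (StronglyMeasurable.smul (f := fun p : (ℝ × Y) × (ℝ × Y) => chi p.1.1 - chi p.2.1)
      (Measurable.stronglyMeasurable ((measurable_chi.comp (by fun_prop)).sub
        (measurable_chi.comp (by fun_prop)))) h.stronglyMeasurable_cylKernel)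

/-- The first bound makes the operator Hilbert-Schmidt, the second feeds the Schur test. The weight
controls `|q|`, and then `|p| ≤ |p - q| + |q|` controls `|p|`. -/
theorem norm_dampedKernel_le (h : IsDecayKernel ℓ) : ∃ c : ℝ, ∀ p q,
    ‖dampedKernel ℓ p q‖ ≤ c * (Real.exp (-|p.1|) * Real.exp (-|q.1|)) ∧
    ‖dampedKernel ℓ p q‖ ≤ c * Real.exp (-|p.1 - q.1|) := by
  obtain ⟨c, hc0, hc⟩ := h.exists_bound 2
  refine ⟨c, fun p q => ?_⟩
  have h1 : ‖dampedKernel ℓ p q‖ ≤ c * Real.exp (-(2 * |p.1 - q.1|) - 2 * |q.1|) := by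
    unfold dampedKernel
    rw [norm_smul, Real.norm_of_nonneg (Real.exp_pos _).le]
    calc _ ≤ Real.exp (-(2 * |q.1|)) * (c * Real.exp (-(2 * |p.1 - q.1|))) := by
          gcongr
          simpa [cylKernel] using hc (p.1 - q.1) p.2 q.2
      _ = _ := by
          rw [Real.exp_sub, Real.exp_neg (2 * |q.1|)]; ring
  have h2 : |p.1| ≤ |p.1 - q.1| + |q.1| := by
    simpa using abs_add_le (p.1 - q.1) q.1
  constructor <;> refine h1.trans ?_
  · rw [← Real.exp_add]
    gcongr
    linarith [abs_nonneg (p.1 - q.1)]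
  · gcongr
    linarith [abs_nonneg (p.1 - q.1), abs_nonneg q.1]

theorem norm_commutatorKernel_le (h : IsDecayKernel ℓ) : ∃ c : ℝ, ∀ p q,
    ‖commutatorKernel ℓ p q‖ ≤ c * (Real.exp (-|p.1|) * Real.exp (-|q.1|)) ∧
    ‖commutatorKernel ℓ p q‖ ≤ c * Real.exp (-|p.1 - q.1|) := by
  -- Where the commutator is nonzero, `e^{-4|p-q|} = e^{-4|p|-4|q|}`, enough to absorb the growing
  -- weight `e^{2|p|}` and leave decay in both variables.
  obtain ⟨c, hc0, hc⟩ := h.exists_bound 4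
  refine ⟨c, fun p q => ?_⟩
  obtain ⟨h1, h2⟩ := abs_chi_sub_mul_exp_le p.1 q.1
  by_cases h0 : chi p.1 - chi q.1 = 0
  · have h5 : commutatorKernel ℓ p q = 0 := by
      rw [commutatorKernel, h0, zero_smul ℝ (cylKernel ℓ p q)]
      exact smul_zero (A := EndFib N) (Real.exp (2 * |p.1|))
    rw [h5, norm_zero]
    constructor <;> positivity
  have h3 := h2 h0
  have h4 : ‖commutatorKernel ℓ p q‖ ≤ c * Real.exp (2 * |p.1| - 4 * |p.1 - q.1|) := by
    unfold commutatorKernel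
    rw [norm_smul, norm_smul, Real.norm_of_nonneg (Real.exp_pos _).le, Real.norm_eq_abs]
    calc _ ≤ Real.exp (2 * |p.1|) * (1 * (c * Real.exp (-(4 * |p.1 - q.1|)))) := by
          gcongr
          simpa [cylKernel] using hc (p.1 - q.1) p.2 q.2
      _ = _ := by rw [Real.exp_sub, Real.exp_neg]; ring
  constructor <;> refine h4.trans ?_
  · rw [← Real.exp_add]
    gcongr
    linarith [abs_nonneg p.1, abs_nonneg q.1]
  · gcongr
    linarith [abs_nonneg p.1, abs_nonneg q.1]

omit [IsFiniteMeasure ν] in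
theorem chiZero_apply_ae (f : Lp (Fib N) 2 ((volume : Measure ℝ).prod ν)) :
    ∀ᵐ p ∂((volume : Measure ℝ).prod ν), chiZero N ν f p = chi p.1 • f p := by
  have h := ((Lp.memLp f).indicator ((measurableSet_Iic (a := (0 : ℝ))).prod
    (MeasurableSet.univ (α := Y)))).coeFn_toLp
  filter_upwards [h] with p hp
  refine hp.trans ?_
  unfold chi
  by_cases h0 : p.1 ≤ 0
  · rw [indicator_of_mem (by simpa using h0), if_pos h0, one_smul]
  · rw [indicator_of_notMem (by simpa using h0), if_neg h0, zero_smul]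

/-- `ℓ [χ⁰, ℓ']` is the product of two Hilbert-Schmidt operators. -/
theorem roeOperator_eq_mul (h : IsDecayKernel ℓ) (h' : IsDecayKernel ℓ') :
    roeOperator ν ℓ ℓ' = integralOperator ((volume : Measure ℝ).prod ν) (dampedKernel ℓ) *
      integralOperator ((volume : Measure ℝ).prod ν) (commutatorKernel ℓ') := by
  set m := (volume : Measure ℝ).prod ν with hm
  obtain ⟨c, hc⟩ := norm_dampedKernel_le h
  obtain ⟨c', hc'⟩ := norm_commutatorKernel_le h'
  obtain ⟨C, hC⟩ := isSchurKernel_of_le (ν := ν) (stronglyMeasurable_dampedKernel h)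
    fun p q => (hc p q).2
  obtain ⟨C', hC'⟩ := isSchurKernel_of_le (ν := ν) (stronglyMeasurable_commutatorKernel h')
    fun p q => (hc' p q).2
  have hA := hC.isIntegralOperator
  have hB := hC'.isIntegralOperator
  have hL := h.isIntegralOperator_cylOperator (ν := ν)
  have hL' := h'.isIntegralOperator_cylOperator (ν := ν)
  ext1 f
  set g := (chiZero N ν * cylOperator ν ℓ' - cylOperator ν ℓ' * chiZero N ν) f with hg
  set k := integralOperator m (commutatorKernel ℓ') f with hk
  -- Multiplication by `e^{2|t|}` is unbounded on `L²`, so the weight is moved across the product by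
  -- a pointwise identity and not by a factorization of operators.
  have hkg : ∀ᵐ p ∂m, k p = Real.exp (2 * |p.1|) • g p := by
    have e0 : g = chiZero N ν (cylOperator ν ℓ' f) - cylOperator ν ℓ' (chiZero N ν f) := rfl
    filter_upwards [hB f, hL' f, hL' (chiZero N ν f), chiZero_apply_ae (cylOperator ν ℓ' f),
      Lp.coeFn_sub (chiZero N ν (cylOperator ν ℓ' f)) (cylOperator ν ℓ' (chiZero N ν f))]
      with p h1 h2 h3 h4 h5
    rw [h1.2, e0, h5, Pi.sub_apply, h4, h2.2, h3.2, ← integral_smul, ← integral_sub, ← integral_smul]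
    · apply integral_congr_ae
      filter_upwards [chiZero_apply_ae f] with q hq
      simp only [commutatorKernel, hq, smul_apply, ContinuousLinearMap.map_smul_of_tower,
        sub_smul]
    · exact h2.1.smul (chi p.1)
    · exact h3.1
  apply Lp.ext
  change (cylOperator ν ℓ g : ℝ × Y → Fib N) =ᵐ[m] (integralOperator m (dampedKernel ℓ) k)
  filter_upwards [hL g, hA k] with p h1 h2
  rw [h1.2, h2.2]
  apply integral_congr_ae
  filter_upwards [hkg] with q hq
  rw [hq, dampedKernel, smul_apply, ContinuousLinearMap.map_smul_of_tower,
    smul_smul, ← Real.exp_add]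
  simp

theorem isTraceClass_roeOperator [MeasurableSpace.CountablyGenerated Y]
    (h : IsDecayKernel ℓ) (h' : IsDecayKernel ℓ') :
    IsTraceClass (roeOperator ν ℓ ℓ') ∧
    roeCocycle ν ℓ ℓ' = ∫ p, ∫ q, fibTr (commutatorKernel ℓ' p q * dampedKernel ℓ q p)
      ∂((volume : Measure ℝ).prod ν) ∂((volume : Measure ℝ).prod ν) := by
  obtain ⟨c, hc⟩ := norm_dampedKernel_le h
  obtain ⟨c', hc'⟩ := norm_commutatorKernel_le h'
  obtain ⟨C, hC⟩ := isSchurKernel_of_le (ν := ν) (stronglyMeasurable_dampedKernel h)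
    fun p q => (hc p q).2
  obtain ⟨C', hC'⟩ := isSchurKernel_of_le (ν := ν) (stronglyMeasurable_commutatorKernel h')
    fun p q => (hc' p q).2
  have h2 := memLp_two_of_le (ν := ν) (stronglyMeasurable_dampedKernel h) fun p q => (hc p q).1
  have h2' := memLp_two_of_le (ν := ν) (stronglyMeasurable_commutatorKernel h')
    fun p q => (hc' p q).1
  unfold roeCocycle
  rw [roeOperator_eq_mul h h']
  exact ⟨isTraceClass_mul hC.isIntegralOperator hC'.isIntegralOperator hC.stronglyMeasurable hC'
    h2 h2', opTrace_mul hC.isIntegralOperator hC'.isIntegralOperator hC hC'.stronglyMeasurable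
    h2 h2'⟩

/-- Fubini, ordered so that for fixed `u, s` the inner double integral over `Y` is literally a
`correlation` at `s - u`. -/
theorem integral_integral_prod_prod {F : (ℝ × Y) × (ℝ × Y) → ℂ}
    (hF : Integrable F (((volume : Measure ℝ).prod ν).prod ((volume : Measure ℝ).prod ν))) :
    ∫ p, ∫ q, F (p, q) ∂((volume : Measure ℝ).prod ν) ∂((volume : Measure ℝ).prod ν)
      = ∫ u : ℝ, ∫ s : ℝ, ∫ z, ∫ y, F ((u, y), (s, z)) ∂ν ∂ν := by
  rw [integral_prod _ hF.integral_prod_left]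
  have hF' : Integrable (fun p : ℝ × (Y × (ℝ × Y)) => F ((p.1, p.2.1), p.2.2))
      ((volume : Measure ℝ).prod (ν.prod ((volume : Measure ℝ).prod ν))) :=
    ((measurePreserving_prodAssoc (volume : Measure ℝ) ν
      ((volume : Measure ℝ).prod ν)).symm).integrable_comp_of_integrable hF
  apply integral_congr_ae
  filter_upwards [hF'.prod_right_ae] with u hu
  rw [integral_integral_swap (f := fun y q => F ((u, y), q)) hu]
  exact integral_prod _ hu.integral_prod_right

/-- The correlation function `s ↦ ∫∫ tr (ℓ(s, y, z) ℓ'(-s, z, y))`. -/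
def correlation (ν : Measure Y) (ℓ ℓ' : ℝ → Y → Y → EndFib N) (s : ℝ) : ℂ :=
  ∫ y, ∫ z, fibTr (ℓ s y z * ℓ' (-s) z y) ∂ν ∂ν

/-- The pairing `∫ s ∫∫ tr (ℓ(s, y, z) ℓ'(-s, z, y))` computing both cocycles. -/
def momentPairing (ν : Measure Y) (ℓ ℓ' : ℝ → Y → Y → EndFib N) : ℂ :=
  ∫ s : ℝ, s • correlation ν ℓ ℓ' s

theorem stronglyMeasurable_fibTr_mul (h : IsDecayKernel ℓ) (h' : IsDecayKernel ℓ') :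
    StronglyMeasurable fun q : ℝ × Y × Y => fibTr (ℓ q.1 q.2.1 q.2.2 * ℓ' (-q.1) q.2.2 q.2.1) :=
  stronglyMeasurable_fibTr (h.stronglyMeasurable.mul
    (h'.stronglyMeasurable_comp measurable_fst.neg (by fun_prop) (by fun_prop)))

theorem norm_fibTr_mul_le_exp (h : IsDecayKernel ℓ) (h' : IsDecayKernel ℓ') (m : ℕ) :
    ∃ c : ℝ, 0 ≤ c ∧ ∀ s y z y' z', ‖fibTr (ℓ s y z * ℓ' (-s) y' z')‖ ≤
      c * Real.exp (-(m * |s|)) := by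
  obtain ⟨c, hc0, hc⟩ := h.exists_bound m
  obtain ⟨c', hc0', hc'⟩ := h'.exists_bound 0
  refine ⟨‖fibTrCLM N‖ * (c * c'), by positivity, fun s y z y' z' => ?_⟩
  refine (norm_fibTr_mul_le _ _).trans ?_
  have h1 := hc s y z
  have h2 := hc' (-s) y' z'
  simp only [Nat.cast_zero, zero_mul, neg_zero, Real.exp_zero, mul_one] at h2
  calc _ ≤ ‖fibTrCLM N‖ * ((c * Real.exp (-(m * |s|))) * c') := by gcongr
    _ = _ := by ring

theorem stronglyMeasurable_correlation (h : IsDecayKernel ℓ) (h' : IsDecayKernel ℓ') :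
    StronglyMeasurable (correlation ν ℓ ℓ') := by
  have h1 : StronglyMeasurable fun q : (ℝ × Y) × Y =>
      fibTr (ℓ q.1.1 q.1.2 q.2 * ℓ' (-q.1.1) q.2 q.1.2) :=
    (stronglyMeasurable_fibTr_mul h h').comp_measurable
      (g := fun q : (ℝ × Y) × Y => (q.1.1, q.1.2, q.2)) (by fun_prop)
  exact (h1.integral_prod_right' (ν := ν)).integral_prod_right' (ν := ν)

theorem norm_correlation_le (h : IsDecayKernel ℓ) (h' : IsDecayKernel ℓ') (m : ℕ) :
    ∃ c : ℝ, 0 ≤ c ∧ ∀ s, ‖correlation ν ℓ ℓ' s‖ ≤ c * Real.exp (-(m * |s|)) := by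
  obtain ⟨c, hc0, hc⟩ := norm_fibTr_mul_le_exp h h' m
  refine ⟨c * ν.real univ * ν.real univ, by positivity, fun s => ?_⟩
  refine (norm_integral_le_of_norm_le_const (C := c * Real.exp (-(m * |s|)) * ν.real univ)
    (Eventually.of_forall fun y => norm_integral_le_of_norm_le_const
      (Eventually.of_forall fun z => hc s y z z y))).trans (le_of_eq (by ring))

theorem integrable_chi_sub_chi_smul (h : IsDecayKernel ℓ) (h' : IsDecayKernel ℓ') :
    Integrable (fun p : (ℝ × Y) × (ℝ × Y) => (chi p.1.1 - chi p.2.1) •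
      fibTr (ℓ (p.2.1 - p.1.1) p.2.2 p.1.2 * ℓ' (-(p.2.1 - p.1.1)) p.1.2 p.2.2))
      (((volume : Measure ℝ).prod ν).prod ((volume : Measure ℝ).prod ν)) := by
  obtain ⟨c, hc0, hc⟩ := norm_fibTr_mul_le_exp h h' 2
  refine ((integrable_exp_prod (ν := ν)).const_mul c).mono' ?_ (Eventually.of_forall fun p => ?_)
  · refine (StronglyMeasurable.smul (Measurable.stronglyMeasurable
      ((measurable_chi.comp (by fun_prop)).sub (measurable_chi.comp (by fun_prop)))) ?_).aestronglyMeasurable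
    exact (stronglyMeasurable_fibTr_mul h h').comp_measurable
      (g := fun p : (ℝ × Y) × (ℝ × Y) => (p.2.1 - p.1.1, p.2.2, p.1.2)) (by fun_prop)
  · refine (norm_chi_sub_chi_smul_le (c := c) hc0 ?_).trans ?_
    · have := hc (p.2.1 - p.1.1) p.2.2 p.1.2 p.1.2 p.2.2
      rw [abs_sub_comm p.1.1]
      simpa using this
    · exact mul_le_of_le_one_right (by positivity) (Real.exp_le_one_iff.2 (by simp))

theorem integral_chi_sub_chi_smul (h : IsDecayKernel ℓ) (h' : IsDecayKernel ℓ') :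
    ∫ p : ℝ × Y, ∫ q : ℝ × Y, (chi p.1 - chi q.1) •
      fibTr (ℓ (q.1 - p.1) q.2 p.2 * ℓ' (-(q.1 - p.1)) p.2 q.2)
      ∂((volume : Measure ℝ).prod ν) ∂((volume : Measure ℝ).prod ν) = momentPairing ν ℓ ℓ' := by
  obtain ⟨c, hc0, hc⟩ := norm_correlation_le (ν := ν) h h' 2
  rw [momentPairing,
    ← integral_integral_chi_sub_chi (stronglyMeasurable_correlation h h') hc0 (by simpa using hc),
    integral_integral_prod_prod (F := fun p => (chi p.1.1 - chi p.2.1) •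
    fibTr (ℓ (p.2.1 - p.1.1) p.2.2 p.1.2 * ℓ' (-(p.2.1 - p.1.1)) p.1.2 p.2.2))
    (integrable_chi_sub_chi_smul h h')]
  congr 1; funext u; congr 1; funext s
  simp only [integral_smul]
  rfl

/-- Roe's cocycle as an integral over the cylinder. -/
theorem roeCocycle_eq_momentPairing [MeasurableSpace.CountablyGenerated Y]
    (h : IsDecayKernel ℓ) (h' : IsDecayKernel ℓ') :
    roeCocycle ν ℓ ℓ' = momentPairing ν ℓ ℓ' := by
  rw [(isTraceClass_roeOperator h h').2, ← integral_chi_sub_chi_smul h h']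
  -- Both weights sit at the same point `p` and cancel; cyclicity of the fibre trace puts `ℓ` first.
  have e : ∀ p q : ℝ × Y, fibTr (commutatorKernel ℓ' p q * dampedKernel ℓ q p)
      = (chi p.1 - chi q.1) • fibTr (ℓ (q.1 - p.1) q.2 p.2 * ℓ' (-(q.1 - p.1)) p.2 q.2) := by
    intro p q
    have e1 : commutatorKernel ℓ' p q * dampedKernel ℓ q p
        = (chi p.1 - chi q.1) • (ℓ' (p.1 - q.1) p.2 q.2 * ℓ (q.1 - p.1) q.2 p.2) := by
      simp only [commutatorKernel, dampedKernel, cylKernel, real_smul_mul, mul_real_smul]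
      rw [smul_comm, smul_smul, smul_smul, ← Real.exp_add]
      simp
    rw [e1, neg_sub, ← fibTr_mul_comm, fibTr_real_smul]
  simp only [e]

end Roe

/-! ### Plancherel for the transform `∫ e^{-iμs} f(s) ds` -/

section Plancherel

open scoped FourierTransform SchwartzMap ComplexConjugate

/-- The Fourier transform of an integrable and square integrable function is its `L²` Fourier
transform. -/
theorem fourier_toLp_ae_eq {f : ℝ → ℂ} (hf : Integrable f) (hf2 : MemLp f 2) :
    (𝓕 (hf2.toLp f) : Lp ℂ 2 (volume : Measure ℝ)) =ᵐ[volume] 𝓕 f := by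
  -- Both sides are tested against smooth compactly supported functions. The `L²` transform pairs as
  -- a tempered distribution, the integral transform by Fubini, and both give `∫ (𝓕 φ) f`.
  refine ae_eq_of_integral_contDiff_smul_eq ((Lp.memLp _).locallyIntegrable (by norm_num)) ?_ ?_
  · exact (VectorFourier.fourierIntegral_continuous Real.continuous_fourierChar
      (L := innerₗ ℝ) continuous_inner hf).locallyIntegrable
  · intro g hg hgc
    have hgc' : HasCompactSupport (fun x => (g x : ℂ)) := hgc.comp_left Complex.ofReal_zero
    let φ : 𝓢(ℝ, ℂ) := hgc'.toSchwartzMap (Complex.ofRealCLM.contDiff.comp hg)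
    have hφ : ∀ x, φ x = (g x : ℂ) := fun x => rfl
    have h1 := congrArg (fun T : 𝓢'(ℝ, ℂ) => T φ)
      (Lp.fourier_toTemperedDistribution_eq (hf2.toLp f))
    simp only [TemperedDistribution.fourier_apply, Lp.toTemperedDistribution_apply] at h1
    have h2 : ∫ x, (𝓕 φ) x • (hf2.toLp f) x = ∫ x, (𝓕 φ) x • f x := by
      apply integral_congr_ae
      filter_upwards [hf2.coeFn_toLp] with x hx
      rw [hx]
    have h3 : ∫ x, (𝓕 φ) x • f x = ∫ x, φ x • 𝓕 f x := by
      have := VectorFourier.integral_fourierIntegral_smul_eq_flip (𝕜 := ℝ) (V := ℝ) (W := ℝ)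
        (e := Real.fourierChar) (μ := volume) (ν := volume) (L := innerₗ ℝ) (f := φ) (g := f)
        Real.continuous_fourierChar continuous_inner φ.integrable hf
      rw [flip_innerₗ] at this
      exact this
    rw [h2, h3] at h1
    simp only [hφ] at h1
    simpa using h1.symm

/-- The Fourier transform `∫ e^{-iμs} f(s) ds`. -/
def angularFourier (f : ℝ → ℂ) (μ : ℝ) : ℂ := ∫ s : ℝ, Complex.exp (-(Complex.I * μ * s)) • f s

theorem angularFourier_eq (f : ℝ → ℂ) (μ : ℝ) :
    angularFourier f μ = 𝓕 f (μ / (2 * Real.pi)) := by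
  rw [angularFourier, Real.fourier_eq']
  congr 1; funext s
  congr 2
  simp only [RCLike.inner_apply, conj_trivial]
  push_cast
  have : (Real.pi : ℂ) ≠ 0 := by exact_mod_cast Real.pi_ne_zero
  field_simp

theorem memLp_fourier {f : ℝ → ℂ} (hf : Integrable f) (hf2 : MemLp f 2) : MemLp (𝓕 f) 2 :=
  (memLp_congr_ae (fourier_toLp_ae_eq hf hf2)).1 (Lp.memLp _)

theorem fourier_conj_neg (g : ℝ → ℂ) (ξ : ℝ) :
    𝓕 (fun s => conj (g (-s))) ξ = conj (𝓕 g ξ) := by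
  rw [Real.fourier_eq', Real.fourier_eq', ← integral_conj, ← integral_neg_eq_self]
  congr 1; funext s
  simp only [neg_neg, smul_eq_mul, map_mul, ← Complex.exp_conj, Complex.conj_ofReal, Complex.conj_I,
    inner_neg_left]
  congr 2
  push_cast
  ring

/-- Apply unitarity of the `L²` transform to `f` and `s ↦ conj (g (-s))`, whose transform is the
conjugate of that of `g`. The factor `2π` is the Jacobian of `μ = 2πξ`. -/
theorem integrable_and_integral_angularFourier_mul {f g : ℝ → ℂ} (hf : Integrable f)
    (hf2 : MemLp f 2) (hg : Integrable g) (hg2 : MemLp g 2) :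
    Integrable (fun μ => angularFourier f μ * angularFourier g μ) ∧
      ∫ μ, angularFourier f μ * angularFourier g μ = 2 * Real.pi * ∫ s, f s * g (-s) := by
  have hF := memLp_fourier hf hf2
  have hG := memLp_fourier hg hg2
  have h2π : 2 * Real.pi ≠ 0 := by positivity
  simp only [angularFourier_eq]
  constructor
  · exact (hF.integrable_mul hG).comp_div h2π
  · rw [Measure.integral_comp_div (fun ξ => 𝓕 f ξ * 𝓕 g ξ), abs_of_pos (by positivity)]
    have hh : Integrable (fun s => conj (g (-s))) :=
      (Complex.conjCLE : ℂ →L[ℝ] ℂ).integrable_comp hg.comp_neg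
    have hh2 : MemLp (fun s => conj (g (-s))) 2 := by
      have : MemLp (fun s => g (-s)) 2 :=
        hg2.comp_measurePreserving (Measure.measurePreserving_neg volume)
      exact (Complex.conjCLE : ℂ →L[ℝ] ℂ).comp_memLp' this
    have h1 := Lp.inner_fourier_eq (hh2.toLp _) (hf2.toLp _)
    rw [L2.inner_def, L2.inner_def] at h1
    have e1 : ∫ ξ, 𝓕 f ξ * 𝓕 g ξ = ∫ ξ, ⟪(𝓕 (hh2.toLp _) : Lp ℂ 2 (volume : Measure ℝ)) ξ,
        (𝓕 (hf2.toLp _) : Lp ℂ 2 (volume : Measure ℝ)) ξ⟫_ℂ := by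
      apply integral_congr_ae
      filter_upwards [fourier_toLp_ae_eq hh hh2, fourier_toLp_ae_eq hf hf2] with ξ a b
      rw [a, b, fourier_conj_neg]
      simp [RCLike.inner_apply]
    have e2 : ∫ s, f s * g (-s) = ∫ s, ⟪hh2.toLp _ s, hf2.toLp _ s⟫_ℂ := by
      apply integral_congr_ae
      filter_upwards [hh2.coeFn_toLp, hf2.coeFn_toLp] with ξ a b
      rw [a, b]
      simp [RCLike.inner_apply]
    rw [e1, e2, h1]
    simp

/-- The sesquilinear diagonal case; it gives bounds in `μ` that are uniform in the points of `Y`. -/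
theorem integral_norm_sq_angularFourier {f : ℝ → ℂ} (hf : Integrable f) (hf2 : MemLp f 2) :
    Integrable (fun μ => ‖angularFourier f μ‖ ^ 2) ∧
      ∫ μ, ‖angularFourier f μ‖ ^ 2 = 2 * Real.pi * ∫ s, ‖f s‖ ^ 2 := by
  have hF := memLp_fourier hf hf2
  have h2π : 2 * Real.pi ≠ 0 := by positivity
  simp only [angularFourier_eq]
  constructor
  · exact ((memLp_two_iff_integrable_sq_norm hF.1).1 hF).comp_div h2π
  · rw [Measure.integral_comp_div (fun ξ => ‖𝓕 f ξ‖ ^ 2), abs_of_pos (by positivity), smul_eq_mul]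
    congr 1
    have h1 := Lp.inner_fourier_eq (hf2.toLp _) (hf2.toLp _)
    rw [L2.inner_def, L2.inner_def] at h1
    rw [← Complex.ofReal_inj, ← integral_complex_ofReal, ← integral_complex_ofReal]
    have e1 : ∀ (u : Lp ℂ 2 (volume : Measure ℝ)) (v : ℝ → ℂ), u =ᵐ[volume] v →
        ∫ ξ, ⟪u ξ, u ξ⟫_ℂ = ∫ ξ, ((‖v ξ‖ ^ 2 : ℝ) : ℂ) := by
      intro u v huv
      apply integral_congr_ae
      filter_upwards [huv] with ξ a
      rw [a, inner_self_eq_norm_sq_to_K]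
      simp
    rwa [e1 _ _ (fourier_toLp_ae_eq hf hf2), e1 _ _ hf2.coeFn_toLp] at h1

end Plancherel

/-! ### Algebra of integral operators and bounded kernels -/

section BoundedKernels

variable {α : Type*} [MeasurableSpace α] {N : ℕ} {μ : Measure α}

theorem IsIntegralOperator.sub {K K' : α → α → EndFib N}
    {T T' : Lp (Fib N) 2 μ →L[ℂ] Lp (Fib N) 2 μ} (h : IsIntegralOperator μ K T)
    (h' : IsIntegralOperator μ K' T') :
    IsIntegralOperator μ (fun x y => K x y - K' x y) (T - T') := by
  intro f
  filter_upwards [h f, h' f, Lp.coeFn_sub (T f) (T' f)] with x h1 h2 h3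
  refine ⟨(h1.1.sub h2.1).congr (Eventually.of_forall fun _ => rfl), ?_⟩
  rw [sub_apply, h3, Pi.sub_apply, h1.2, h2.2, ← integral_sub h1.1 h2.1]
  rfl

theorem IsIntegralOperator.real_smul {K : α → α → EndFib N}
    {T : Lp (Fib N) 2 μ →L[ℂ] Lp (Fib N) 2 μ} (h : IsIntegralOperator μ K T) (c : ℝ) :
    IsIntegralOperator μ (fun x y => c • K x y) (c • T) := by
  intro f
  filter_upwards [h f, Lp.coeFn_smul c (T f)] with x h1 h3
  refine ⟨h1.1.smul c, ?_⟩
  rw [smul_apply, h3, Pi.smul_apply, h1.2, ← integral_smul]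
  rfl

theorem isSchurKernel_of_norm_le_const [IsFiniteMeasure μ] {K : α → α → EndFib N} {c : ℝ≥0}
    (hK : StronglyMeasurable (Function.uncurry K)) (h : ∀ x y, ‖K x y‖ ≤ c) :
    IsSchurKernel μ (c * (μ univ).toNNReal) K := by
  have key : ∀ (u : α → EndFib N), (∀ x, ‖u x‖ ≤ c) →
      ∫⁻ x, ‖u x‖ₑ ∂μ ≤ ((c * (μ univ).toNNReal : ℝ≥0) : ℝ≥0∞) := by
    intro u hu
    calc ∫⁻ x, ‖u x‖ₑ ∂μ ≤ ∫⁻ _, (c : ℝ≥0∞) ∂μ := by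
          refine lintegral_mono fun x => ?_
          rw [← ofReal_norm, ← ENNReal.ofReal_coe_nnreal]
          exact ENNReal.ofReal_le_ofReal (hu x)
      _ = _ := by
          rw [lintegral_const, ENNReal.coe_mul, ENNReal.coe_toNNReal (measure_ne_top _ _)]
  exact ⟨hK, fun x => key _ (h x), fun y => key _ fun x => h x y⟩

end BoundedKernels

/-! ### The indicial family and its derivative -/

section Indicial

variable {Y : Type*} [MeasurableSpace Y] {N : ℕ} {ℓ ℓ' : ℝ → Y → Y → EndFib N}

theorem IsDecayKernel.integrable_section (h : IsDecayKernel ℓ) (y z : Y) :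
    Integrable fun s => ℓ s y z := by
  obtain ⟨c, hc⟩ := h.decay 1
  refine (integrable_exp_neg_abs.const_mul c).mono'
    (h.stronglyMeasurable_comp (f := fun s : ℝ => s) measurable_id measurable_const
      measurable_const).aestronglyMeasurable (Eventually.of_forall fun s => ?_)
  simpa using hc s y z

theorem integrable_exp_smul {E : Type*} [NormedAddCommGroup E] [NormedSpace ℂ E] {f : ℝ → E}
    (hf : Integrable f) (μ : ℝ) : Integrable fun s : ℝ => Complex.exp (-(Complex.I * μ * s)) • f s := by
  refine hf.norm.mono' ((by fun_prop : Continuous fun s : ℝ =>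
    Complex.exp (-(Complex.I * μ * s))).aestronglyMeasurable.smul hf.1)
    (Eventually.of_forall fun s => ?_)
  rw [norm_smul, Complex.norm_exp]
  simp

theorem stronglyMeasurable_fourierKernel (h : IsDecayKernel ℓ) :
    StronglyMeasurable fun p : ℝ × (Y × Y) => fourierKernel ℓ p.1 p.2.1 p.2.2 := by
  have : StronglyMeasurable fun q : (ℝ × (Y × Y)) × ℝ =>
      Complex.exp (-(Complex.I * q.1.1 * q.2)) • ℓ q.2 q.1.2.1 q.1.2.2 :=
    (Measurable.stronglyMeasurable (by fun_prop : Measurable fun q : (ℝ × (Y × Y)) × ℝ =>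
      Complex.exp (-(Complex.I * q.1.1 * q.2)))).smul (h.stronglyMeasurable_comp (f := fun q : (ℝ × (Y × Y)) × ℝ => q.2) (g := fun q => q.1.2.1)
        (g' := fun q => q.1.2.2) (by fun_prop) (by fun_prop) (by fun_prop))
  exact this.integral_prod_right'

theorem stronglyMeasurable_uncurry_fourierKernel (h : IsDecayKernel ℓ) (μ : ℝ) :
    StronglyMeasurable (Function.uncurry (fourierKernel ℓ μ)) :=
  ((stronglyMeasurable_fourierKernel h).comp_measurable (g := fun p : Y × Y => (μ, p))
    (by fun_prop) :)

theorem real_smul_eq_coe_smul (c : ℝ) (A : EndFib N) : c • A = (c : ℂ) • A := by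
  ext v i
  simp

theorem exists_norm_fourierKernel_le (h : IsDecayKernel ℓ) :
    ∃ c : ℝ≥0, ∀ μ y z, ‖fourierKernel ℓ μ y z‖ ≤ c := by
  obtain ⟨c, hc0, hc⟩ := h.exists_bound 1
  refine ⟨(∫ s : ℝ, c * Real.exp (-|s|)).toNNReal, fun μ y z => ?_⟩
  rw [Real.coe_toNNReal _ (integral_nonneg fun s => by positivity)]
  refine norm_integral_le_of_norm_le (integrable_exp_neg_abs.const_mul c)
    (Eventually.of_forall fun s => ?_)
  rw [norm_smul, Complex.norm_exp]
  simpa using hc s y z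

variable {ν : Measure Y} [IsFiniteMeasure ν]

theorem IsDecayKernel.isSchurKernel_fourierKernel (h : IsDecayKernel ℓ) (μ : ℝ) :
    ∃ C, IsSchurKernel ν C (fourierKernel ℓ μ) := by
  obtain ⟨c, hc⟩ := exists_norm_fourierKernel_le h
  exact ⟨_, isSchurKernel_of_norm_le_const
    (stronglyMeasurable_uncurry_fourierKernel h μ) (hc μ)⟩

theorem IsDecayKernel.memLp_two_fourierKernel (h : IsDecayKernel ℓ) (μ : ℝ) :
    MemLp (Function.uncurry (fourierKernel ℓ μ)) 2 (ν.prod ν) := by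
  obtain ⟨c, hc⟩ := exists_norm_fourierKernel_le h
  exact MemLp.of_bound (stronglyMeasurable_uncurry_fourierKernel h μ).aestronglyMeasurable c
    (Eventually.of_forall fun p => hc μ p.1 p.2)

theorem IsDecayKernel.isIntegralOperator_indicialFamily (h : IsDecayKernel ℓ) (μ : ℝ) :
    IsIntegralOperator ν (fourierKernel ℓ μ) (indicialFamily ν ℓ μ) :=
  (h.isSchurKernel_fourierKernel μ).choose_spec.isIntegralOperator

/-- The kernel `-i s ℓ(s, y, z)`, whose Fourier transform is the derivative of that of `ℓ`. -/
def momentKernel (ℓ : ℝ → Y → Y → EndFib N) : ℝ → Y → Y → EndFib N :=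
  fun s y z => (-(Complex.I * s)) • ℓ s y z

theorem IsDecayKernel.momentKernel (h : IsDecayKernel ℓ) : IsDecayKernel (momentKernel ℓ) where
  stronglyMeasurable :=
    (Measurable.stronglyMeasurable (by fun_prop : Measurable fun q : ℝ × Y × Y =>
      (-(Complex.I * q.1)))).smul h.stronglyMeasurable
  decay m := by
    -- The extra order of decay pays for the factor `s`, since `|s| ≤ e^{|s|}`.
    obtain ⟨c, hc0, hc⟩ := h.exists_bound (m + 1)
    refine ⟨c, fun s y z => ?_⟩
    rw [RoeMelrose.momentKernel, norm_smul]
    have h1 : |s| ≤ Real.exp |s| := (by linarith : |s| ≤ |s| + 1).trans (Real.add_one_le_exp _)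
    calc _ ≤ Real.exp |s| * (c * Real.exp (-((m + 1 : ℕ) * |s|))) := by
          gcongr
          · simpa using h1
          · exact hc s y z
      _ = c * (Real.exp |s| * Real.exp (-((m + 1 : ℕ) * |s|))) := by ring
      _ = _ := by
          rw [← Real.exp_add]; push_cast; ring_nf

/-- For `|θ| ≤ 1` this is the Taylor remainder. For `|θ| ≥ 1` the three terms are bounded separately
by `2 + |θ| ≤ 3θ²`, whence the constant. -/
theorem norm_exp_sub_one_sub_le (θ : ℝ) :
    ‖Complex.exp (-(Complex.I * θ)) - 1 + Complex.I * θ‖ ≤ 3 * θ ^ 2 := by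
  have hn : ‖-(Complex.I * θ)‖ = |θ| := by simp
  rcases le_total |θ| 1 with h | h
  · have := Complex.norm_exp_sub_one_sub_id_le (x := -(Complex.I * θ)) (by rwa [hn])
    rw [hn, sub_neg_eq_add, sq_abs] at this
    nlinarith [sq_nonneg θ]
  · have h1 : ‖Complex.exp (-(Complex.I * θ))‖ = 1 := by
      rw [Complex.norm_exp]; simp
    calc _ ≤ ‖Complex.exp (-(Complex.I * θ))‖ + ‖(1 : ℂ)‖ + ‖Complex.I * θ‖ :=
          (norm_add_le _ _).trans (by gcongr; exact norm_sub_le _ _)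
      _ = 2 + |θ| := by rw [h1, ← norm_neg (Complex.I * (θ : ℂ)), hn, norm_one]; ring
      _ ≤ 3 * |θ| ^ 2 := by nlinarith
      _ = _ := by rw [sq_abs]

/-- The second-order Taylor estimate for `e^{-iμs}` integrated against `ℓ`. The bound is uniform in
`y, z` because `s² ℓ` still decays exponentially. -/
theorem norm_fourierKernel_sub_sub_le (h : IsDecayKernel ℓ) : ∃ c : ℝ≥0, ∀ μ μ' y z,
    ‖fourierKernel ℓ μ' y z - fourierKernel ℓ μ y z
      - (μ' - μ) • fourierKernel (momentKernel ℓ) μ y z‖ ≤ c * (μ' - μ) ^ 2 := by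
  -- Two applications of `momentKernel` give the factor `s²` up to sign.
  obtain ⟨c, hc0, hc⟩ := h.momentKernel.momentKernel.exists_bound 1
  refine ⟨(∫ s : ℝ, 3 * (c * Real.exp (-|s|))).toNNReal, fun μ μ' y z => ?_⟩
  rw [Real.coe_toNNReal _ (integral_nonneg fun s => by positivity)]
  have e1 : (μ' - μ) • fourierKernel (momentKernel ℓ) μ y z =
      ∫ s : ℝ, Complex.exp (-(Complex.I * μ * s)) • (-(Complex.I * (((μ' - μ) * s : ℝ)))) • ℓ s y z := by
    rw [fourierKernel, real_smul_eq_coe_smul, ← integral_smul]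
    congr 1; funext s
    rw [momentKernel, smul_smul, smul_smul, smul_smul]
    congr 1
    push_cast
    ring
  have hint : Integrable (fun s : ℝ => Complex.exp (-(Complex.I * μ * s)) •
      (-(Complex.I * (((μ' - μ) * s : ℝ)))) • ℓ s y z) := by
    have := integrable_exp_smul ((h.momentKernel.integrable_section y z).smul ((μ' - μ : ℝ) : ℂ)) μ
    refine this.congr (Eventually.of_forall fun s => ?_)
    simp only [momentKernel, Pi.smul_apply, smul_smul]
    congr 1
    push_cast
    ring
  have hsub : Integrable (fun s : ℝ => Complex.exp (-(Complex.I * μ' * s)) • ℓ s y z -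
      Complex.exp (-(Complex.I * μ * s)) • ℓ s y z) :=
    (integrable_exp_smul (h.integrable_section y z) μ').sub
      (integrable_exp_smul (h.integrable_section y z) μ)
  rw [e1, fourierKernel, fourierKernel,
    ← integral_sub (integrable_exp_smul (h.integrable_section y z) μ')
      (integrable_exp_smul (h.integrable_section y z) μ),
    ← integral_sub hsub hint]
  refine (norm_integral_le_of_norm_le
    (((integrable_exp_neg_abs.const_mul c).const_mul 3).const_mul ((μ' - μ) ^ 2))
    (Eventually.of_forall fun s => ?_)).trans (le_of_eq ?_)
  · have e2 : Complex.exp (-(Complex.I * μ' * s)) • ℓ s y z - Complex.exp (-(Complex.I * μ * s)) • ℓ s y z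
        - Complex.exp (-(Complex.I * μ * s)) • (-(Complex.I * (((μ' - μ) * s : ℝ)))) • ℓ s y z
        = (Complex.exp (-(Complex.I * μ * s)) * (Complex.exp (-(Complex.I * (((μ' - μ) * s : ℝ)))) - 1
          + Complex.I * (((μ' - μ) * s : ℝ)))) • ℓ s y z := by
      have : Complex.exp (-(Complex.I * μ' * s)) = Complex.exp (-(Complex.I * μ * s)) *
          Complex.exp (-(Complex.I * (((μ' - μ) * s : ℝ)))) := by
        rw [← Complex.exp_add]
        congr 1
        push_cast
        ring
      rw [this]
      module
    rw [e2, norm_smul, norm_mul, Complex.norm_exp]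
    have h1 := norm_exp_sub_one_sub_le ((μ' - μ) * s)
    have h2 := hc s y z
    rw [momentKernel, momentKernel, smul_smul, norm_smul, norm_mul] at h2
    simp only [norm_neg, norm_mul, Complex.norm_I, Complex.norm_real, Real.norm_eq_abs, one_mul,
      abs_mul_abs_self, Nat.cast_one] at h2
    have h3 : Real.exp (-(Complex.I * μ * s)).re = 1 := by simp
    rw [h3, one_mul]
    calc _ ≤ 3 * ((μ' - μ) * s) ^ 2 * ‖ℓ s y z‖ := by gcongr
      _ = (μ' - μ) ^ 2 * (3 * (s * s * ‖ℓ s y z‖)) := by ring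
      _ ≤ _ := by gcongr
  · rw [integral_const_mul, mul_comm]

/-- The indicial family is differentiable in operator norm. -/
theorem IsDecayKernel.hasDerivAt_indicialFamily (h : IsDecayKernel ℓ) (μ : ℝ) :
    HasDerivAt (indicialFamily ν ℓ) (indicialFamily ν (RoeMelrose.momentKernel ℓ) μ) μ := by
  obtain ⟨c, hc⟩ := norm_fourierKernel_sub_sub_le h
  rw [hasDerivAt_iff_isLittleO]
  -- The remainder is an integral operator with kernel uniformly `O((μ' - μ)²)`; on the finite
  -- measure space `Y` the Schur test makes this a bound in operator norm.
  refine Asymptotics.IsBigO.trans_isLittleO (g := fun μ' => (μ' - μ) ^ 2) ?_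
    (by simpa using Asymptotics.isLittleO_pow_sub_sub μ (m := 2) one_lt_two)
  refine Asymptotics.IsBigO.of_bound (c * (ν univ).toNNReal) (Eventually.of_forall fun μ' => ?_)
  have hop := ((h.isIntegralOperator_indicialFamily (ν := ν) μ').sub
    (h.isIntegralOperator_indicialFamily μ)).sub
    ((h.momentKernel.isIntegralOperator_indicialFamily μ).real_smul (μ' - μ))
  have hS := isSchurKernel_of_norm_le_const (μ := ν) (c := c * ((μ' - μ) ^ 2).toNNReal)
    (K := fun y z => fourierKernel ℓ μ' y z - fourierKernel ℓ μ y z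
      - (μ' - μ) • fourierKernel (RoeMelrose.momentKernel ℓ) μ y z)
    ((((stronglyMeasurable_uncurry_fourierKernel h μ').sub
      (stronglyMeasurable_uncurry_fourierKernel h μ)).sub
      ((stronglyMeasurable_uncurry_fourierKernel h.momentKernel μ).const_smul (μ' - μ)) :))
    (fun y z => by
      rw [NNReal.coe_mul, Real.coe_toNNReal _ (sq_nonneg _)]
      exact hc μ μ' y z)
  have := hS.norm_integralOperator_le
  rw [hop.integralOperator_eq] at this
  refine this.trans (le_of_eq ?_)
  rw [Real.norm_of_nonneg (sq_nonneg _)]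
  rw [NNReal.coe_mul, NNReal.coe_mul, Real.coe_toNNReal _ (sq_nonneg _)]
  ring

theorem IsDecayKernel.melroseOperator_eq (h : IsDecayKernel ℓ) (μ : ℝ) :
    melroseOperator ν ℓ ℓ' μ =
      indicialFamily ν (RoeMelrose.momentKernel ℓ) μ * indicialFamily ν ℓ' μ := by
  rw [melroseOperator, (h.hasDerivAt_indicialFamily μ).deriv]

variable [MeasurableSpace.CountablyGenerated Y]

theorem isTraceClass_melroseOperator (h : IsDecayKernel ℓ) (h' : IsDecayKernel ℓ') (μ : ℝ) :
    IsTraceClass (melroseOperator ν ℓ ℓ' μ) := by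
  rw [h.melroseOperator_eq]
  exact isTraceClass_mul (h.momentKernel.isIntegralOperator_indicialFamily μ)
    (h'.isIntegralOperator_indicialFamily μ)
    (h.momentKernel.isSchurKernel_fourierKernel (ν := ν) μ).choose_spec.stronglyMeasurable
    (h'.isSchurKernel_fourierKernel μ).choose_spec (h.momentKernel.memLp_two_fourierKernel μ)
    (h'.memLp_two_fourierKernel μ)

theorem opTrace_melroseOperator (h : IsDecayKernel ℓ) (h' : IsDecayKernel ℓ') (μ : ℝ) :
    opTrace (melroseOperator ν ℓ ℓ' μ) =
      ∫ x, ∫ y, fibTr (fourierKernel ℓ' μ x y * fourierKernel (momentKernel ℓ) μ y x) ∂ν ∂ν := by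
  rw [h.melroseOperator_eq]
  exact opTrace_mul (h.momentKernel.isIntegralOperator_indicialFamily μ)
    (h'.isIntegralOperator_indicialFamily μ)
    (h.momentKernel.isSchurKernel_fourierKernel μ).choose_spec
    (h'.isSchurKernel_fourierKernel (ν := ν) μ).choose_spec.stronglyMeasurable
    (h.momentKernel.memLp_two_fourierKernel μ) (h'.memLp_two_fourierKernel μ)

end Indicial

/-! ### Antisymmetry of the moment pairing -/

section Antisymmetry

variable {Y : Type*} [MeasurableSpace Y] {N : ℕ} {ℓ ℓ' ℓ₀ ℓ₁ ℓ₂ : ℝ → Y → Y → EndFib N}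
  {ν : Measure Y} [IsFiniteMeasure ν]

theorem integrable_fibTr_mul_section (h : IsDecayKernel ℓ) (h' : IsDecayKernel ℓ') (s : ℝ) :
    Integrable (fun p : Y × Y => fibTr (ℓ s p.1 p.2 * ℓ' (-s) p.2 p.1)) (ν.prod ν) := by
  obtain ⟨c, -, hc⟩ := norm_fibTr_mul_le_exp h h' 0
  refine Integrable.of_bound ((stronglyMeasurable_fibTr_mul h h').comp_measurable
    (g := fun p : Y × Y => (s, p)) (by fun_prop)).aestronglyMeasurable c
    (Eventually.of_forall fun p => ?_)
  simpa using hc s p.1 p.2 p.2 p.1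

/-- Exchange `y` and `z`, then use cyclicity of the fibre trace. -/
theorem correlation_neg (h : IsDecayKernel ℓ) (h' : IsDecayKernel ℓ') (s : ℝ) :
    correlation ν ℓ ℓ' (-s) = correlation ν ℓ' ℓ s := by
  unfold correlation
  rw [integral_integral_swap (integrable_fibTr_mul_section h h' (-s))]
  simp only [neg_neg, fibTr_mul_comm (ℓ (-s) _ _)]

/-- The weight `s` is odd, and reflecting the correlation exchanges its two arguments. -/
theorem momentPairing_antisymm (h : IsDecayKernel ℓ) (h' : IsDecayKernel ℓ') :
    momentPairing ν ℓ ℓ' = -momentPairing ν ℓ' ℓ := by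
  unfold momentPairing
  rw [← integral_neg_eq_self, ← integral_neg]
  simp only [correlation_neg h h', neg_smul]

/-- A bounded function of `(s, p)` dominated by `c e^{-|s|}` is integrable over `ℝ × Y × Y`. -/
theorem integrable_of_norm_le_exp {β : Type*} [MeasurableSpace β] {m : Measure β}
    [IsFiniteMeasure m] {E : Type*} [NormedAddCommGroup E] {f : ℝ × β → E}
    (hf : StronglyMeasurable f) {c : ℝ} (hc : ∀ p, ‖f p‖ ≤ c * Real.exp (-|p.1|)) :
    Integrable f ((volume : Measure ℝ).prod m) :=
  ((integrable_comp_fst integrable_exp_neg_abs).const_mul c).mono' hf.aestronglyMeasurable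
    (Eventually.of_forall hc)

end Antisymmetry

/-! ### Melrose's cocycle as a moment pairing -/

section Melrose

variable {Y : Type*} [MeasurableSpace Y] {N : ℕ} {ℓ ℓ' : ℝ → Y → Y → EndFib N}

/-- The matrix coefficient of an endomorphism of the fibre. -/
def entry (i j : Fin N) : EndFib N →L[ℂ] ℂ :=
  (innerSL ℂ (EuclideanSpace.basisFun (Fin N) ℂ i)).comp
    (ContinuousLinearMap.apply ℂ (Fib N) (EuclideanSpace.basisFun (Fin N) ℂ j))

/-- This reduces Plancherel for endomorphism-valued functions to the scalar case. -/
theorem fibTr_mul_eq_sum_entry (A B : EndFib N) :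
    fibTr (A * B) = ∑ i, ∑ j, entry i j A * entry j i B := by
  rw [fibTr_eq_sum_inner]
  refine Finset.sum_congr rfl fun i _ => ?_
  let e := EuclideanSpace.basisFun (Fin N) ℂ
  have h : (A * B) (e i) = ∑ j, ⟪e j, B (e i)⟫_ℂ • A (e j) := by
    change A (B (e i)) = _
    conv_lhs => rw [← e.sum_repr' (B (e i))]
    simp
  change ⟪e i, (A * B) (e i)⟫_ℂ = _
  rw [h, inner_sum]
  refine Finset.sum_congr rfl fun j _ => ?_
  rw [inner_smul_right, mul_comm]
  rfl

theorem IsDecayKernel.entry_integrable (h : IsDecayKernel ℓ) (i j : Fin N) (y z : Y) :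
    Integrable fun s => entry i j (ℓ s y z) :=
  (entry i j).integrable_comp (h.integrable_section y z)

theorem IsDecayKernel.norm_entry_le (h : IsDecayKernel ℓ) (i j : Fin N) (m : ℕ) :
    ∃ c : ℝ, 0 ≤ c ∧ ∀ s y z, ‖entry i j (ℓ s y z)‖ ≤ c * Real.exp (-(m * |s|)) := by
  obtain ⟨c, hc0, hc⟩ := h.exists_bound m
  refine ⟨‖entry i j‖ * c, by positivity, fun s y z => ((entry i j).le_opNorm _).trans ?_⟩
  rw [mul_assoc]
  gcongr
  exact hc s y z

theorem IsDecayKernel.entry_memLp_two (h : IsDecayKernel ℓ) (i j : Fin N) (y z : Y) :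
    MemLp (fun s => entry i j (ℓ s y z)) 2 := by
  obtain ⟨c, hc0, hc⟩ := h.norm_entry_le i j 0
  obtain ⟨c', hc0', hc'⟩ := h.norm_entry_le i j 1
  rw [memLp_two_iff_integrable_sq_norm (h.entry_integrable i j y z).1]
  refine ((h.entry_integrable i j y z).norm.const_mul c).mono'
    ((h.entry_integrable i j y z).1.norm.pow 2) (Eventually.of_forall fun s => ?_)
  rw [Real.norm_of_nonneg (by positivity), sq]
  gcongr
  simpa using hc s y z

theorem IsDecayKernel.exists_integral_sq_le (h : IsDecayKernel ℓ) (i j : Fin N) :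
    ∃ c : ℝ, ∀ y z, ∫ s, ‖entry i j (ℓ s y z)‖ ^ 2 ≤ c := by
  obtain ⟨c, hc0, hc⟩ := h.norm_entry_le i j 0
  obtain ⟨c', hc0', hc'⟩ := h.norm_entry_le i j 1
  refine ⟨∫ s : ℝ, c * (c' * Real.exp (-|s|)), fun y z => ?_⟩
  refine integral_mono_of_nonneg (Eventually.of_forall fun s => by positivity)
    ((integrable_exp_neg_abs.const_mul c').const_mul c) (Eventually.of_forall fun s => ?_)
  have h1 := hc s y z
  have h2 := hc' s y z
  simp only [Nat.cast_zero, zero_mul, neg_zero, Real.exp_zero, mul_one, Nat.cast_one, one_mul] at h1 h2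
  simp only [sq]
  gcongr

theorem IsDecayKernel.entry_fourierKernel (h : IsDecayKernel ℓ) (i j : Fin N) (μ : ℝ) (y z : Y) :
    entry i j (fourierKernel ℓ μ y z) = angularFourier (fun s => entry i j (ℓ s y z)) μ := by
  rw [fourierKernel, ← (entry i j).integral_comp_comm (integrable_exp_smul (h.integrable_section y z) μ)]
  simp only [map_smul]
  rfl

variable {ν : Measure Y} [IsFiniteMeasure ν]

/-- No pointwise decay in `μ` is needed: for fixed `y, z` Plancherel bounds the `L²` norms in `μ` of
both entries uniformly, hence the `L¹` norm of their product, and `Y × Y` has finite measure. -/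
theorem integrable_entry_mul_entry (h : IsDecayKernel ℓ) (h' : IsDecayKernel ℓ') (i j : Fin N) :
    Integrable (fun p : ℝ × (Y × Y) => entry i j (fourierKernel ℓ p.1 p.2.1 p.2.2) *
      entry j i (fourierKernel ℓ' p.1 p.2.2 p.2.1)) ((volume : Measure ℝ).prod (ν.prod ν)) := by
  have hm1 := (entry i j).continuous.comp_stronglyMeasurable (stronglyMeasurable_fourierKernel h)
  have hm2 := (entry j i).continuous.comp_stronglyMeasurable
    ((stronglyMeasurable_fourierKernel h').comp_measurable
      (g := fun p : ℝ × (Y × Y) => (p.1, (p.2.2, p.2.1))) (by fun_prop))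
  obtain ⟨c, hc⟩ := h.exists_integral_sq_le i j
  obtain ⟨c', hc'⟩ := h'.exists_integral_sq_le j i
  have hp : ∀ y z, Integrable (fun μ => ‖entry i j (fourierKernel ℓ μ y z) *
      entry j i (fourierKernel ℓ' μ z y)‖) ∧
      ∫ μ, ‖entry i j (fourierKernel ℓ μ y z) * entry j i (fourierKernel ℓ' μ z y)‖
        ≤ 2 * Real.pi * c + 2 * Real.pi * c' := by
    intro y z
    have a1 := integral_norm_sq_angularFourier (h.entry_integrable i j y z) (h.entry_memLp_two i j y z)
    have a2 := integral_norm_sq_angularFourier (h'.entry_integrable j i z y)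
      (h'.entry_memLp_two j i z y)
    simp only [h.entry_fourierKernel, h'.entry_fourierKernel]
    refine ⟨(integrable_and_integral_angularFourier_mul (h.entry_integrable i j y z)
      (h.entry_memLp_two i j y z) (h'.entry_integrable j i z y) (h'.entry_memLp_two j i z y)).1.norm, ?_⟩
    refine (integral_mono_of_nonneg (Eventually.of_forall fun μ => norm_nonneg _) (a1.1.add a2.1)
      (Eventually.of_forall fun μ => ?_)).trans ?_
    · simp only [Pi.add_apply, norm_mul]
      nlinarith [sq_nonneg (‖angularFourier (fun s => entry i j (ℓ s y z)) μ‖ -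
        ‖angularFourier (fun s => entry j i (ℓ' s z y)) μ‖),
        sq_nonneg (‖angularFourier (fun s => entry i j (ℓ s y z)) μ‖ +
        ‖angularFourier (fun s => entry j i (ℓ' s z y)) μ‖)]
    · rw [integral_add' a1.1 a2.1, a1.2, a2.2]
      gcongr
      · exact hc y z
      · exact hc' z y
  have hm : StronglyMeasurable (fun p : ℝ × (Y × Y) => entry i j (fourierKernel ℓ p.1 p.2.1 p.2.2) *
      entry j i (fourierKernel ℓ' p.1 p.2.2 p.2.1)) := hm1.mul hm2
  rw [integrable_prod_iff' hm.aestronglyMeasurable]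
  refine ⟨Eventually.of_forall fun p => ?_, ?_⟩
  · refine (integrable_norm_iff ?_).1 (hp p.1 p.2).1
    exact (hm.comp_measurable (measurable_prodMk_right (y := p))).aestronglyMeasurable
  · refine Integrable.of_bound (hm.norm.integral_prod_left').aestronglyMeasurable
      (2 * Real.pi * c + 2 * Real.pi * c') (Eventually.of_forall fun p => ?_)
    rw [Real.norm_of_nonneg (integral_nonneg fun _ => norm_nonneg _)]
    exact (hp p.1 p.2).2

theorem integral_fibTr_fourierKernel (h : IsDecayKernel ℓ) (h' : IsDecayKernel ℓ') (y z : Y) :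
    ∫ μ, fibTr (fourierKernel ℓ μ y z * fourierKernel ℓ' μ z y) =
      2 * Real.pi * ∫ s, fibTr (ℓ s y z * ℓ' (-s) z y) := by
  have a := fun i j => integrable_and_integral_angularFourier_mul (h.entry_integrable i j y z)
      (h.entry_memLp_two i j y z) (h'.entry_integrable j i z y) (h'.entry_memLp_two j i z y)
  simp only [fibTr_mul_eq_sum_entry, h.entry_fourierKernel, h'.entry_fourierKernel]
  have b : ∀ i j, Integrable fun s => entry i j (ℓ s y z) * entry j i (ℓ' (-s) z y) := by
    intro i j
    exact (h.entry_memLp_two i j y z).integrable_mul ((h'.entry_memLp_two j i z y).comp_measurePreserving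
      (Measure.measurePreserving_neg volume))
  rw [integral_finsetSum _ fun i _ => integrable_finsetSum _ fun j _ => (a i j).1,
    integral_finsetSum _ fun i _ => integrable_finsetSum _ fun j _ => b i j, Finset.mul_sum]
  refine Finset.sum_congr rfl fun i _ => ?_
  rw [integral_finsetSum _ fun j _ => (a i j).1, integral_finsetSum _ fun j _ => b i j,
    Finset.mul_sum]
  exact Finset.sum_congr rfl fun j _ => (a i j).2

theorem integrable_fibTr_fourierKernel (h : IsDecayKernel ℓ) (h' : IsDecayKernel ℓ') :
    Integrable (fun p : ℝ × (Y × Y) => fibTr (fourierKernel ℓ p.1 p.2.1 p.2.2 *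
      fourierKernel ℓ' p.1 p.2.2 p.2.1)) ((volume : Measure ℝ).prod (ν.prod ν)) := by
  simp only [fibTr_mul_eq_sum_entry]
  exact integrable_finsetSum _ fun i _ => integrable_finsetSum _ fun j _ =>
    integrable_entry_mul_entry h h' i j

theorem integrable_fibTr_mul_swap {K L : Y → Y → EndFib N}
    (hK : MemLp (Function.uncurry K) 2 (ν.prod ν)) (hL : MemLp (Function.uncurry L) 2 (ν.prod ν)) :
    Integrable (fun p : Y × Y => fibTr (K p.1 p.2 * L p.2 p.1)) (ν.prod ν) := by
  have h2 : MemLp (fun p : Y × Y => L p.2 p.1) 2 (ν.prod ν) :=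
    hL.comp_measurePreserving Measure.measurePreserving_swap
  exact integrable_fibTr (A := fun p : Y × Y => K p.1 p.2 * L p.2 p.1)
    (integrable_mul_of_memLp_two (A := fun p : Y × Y => K p.1 p.2) hK h2)

theorem integrable_fibTr_fourierKernel_section (h : IsDecayKernel ℓ) (h' : IsDecayKernel ℓ')
    (μ : ℝ) : Integrable (fun p : Y × Y => fibTr (fourierKernel ℓ μ p.1 p.2 *
      fourierKernel ℓ' μ p.2 p.1)) (ν.prod ν) :=
  integrable_fibTr_mul_swap (K := fourierKernel ℓ μ) (L := fourierKernel ℓ' μ)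
    (h.memLp_two_fourierKernel μ) (h'.memLp_two_fourierKernel μ)

variable [MeasurableSpace.CountablyGenerated Y]

/-- The trace is an integral over `Y × Y`. Fubini brings the integral over `μ` inside, Plancherel
converts it at each pair of points, and a second Fubini reassembles a correlation. -/
theorem integrable_opTrace_melroseOperator (h : IsDecayKernel ℓ) (h' : IsDecayKernel ℓ') :
    Integrable (fun μ : ℝ => opTrace (melroseOperator ν ℓ ℓ' μ)) ∧
      ∫ μ : ℝ, opTrace (melroseOperator ν ℓ ℓ' μ) =
        2 * Real.pi * ∫ s : ℝ, correlation ν ℓ' (momentKernel ℓ) s := by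
  have hint := integrable_fibTr_fourierKernel (ν := ν) h' h.momentKernel
  have e : ∀ μ, opTrace (melroseOperator ν ℓ ℓ' μ) = ∫ p : Y × Y,
      fibTr (fourierKernel ℓ' μ p.1 p.2 * fourierKernel (momentKernel ℓ) μ p.2 p.1) ∂(ν.prod ν) := by
    intro μ
    rw [opTrace_melroseOperator h h', integral_prod _
      (integrable_fibTr_fourierKernel_section h' h.momentKernel μ)]
  simp only [e]
  refine ⟨hint.integral_prod_left, ?_⟩
  rw [integral_integral_swap hint]
  simp only [integral_fibTr_fourierKernel h' h.momentKernel]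
  rw [integral_const_mul]
  congr 1
  obtain ⟨c, hc0, hc⟩ := norm_fibTr_mul_le_exp h' h.momentKernel 1
  rw [← integral_integral_swap (integrable_of_norm_le_exp
    (stronglyMeasurable_fibTr_mul h' h.momentKernel) (c := c)
    fun p => by simpa [Function.uncurry] using hc p.1 p.2.1 p.2.2 p.2.2 p.2.1)]
  congr 1; funext s
  exact integral_prod _ (integrable_fibTr_mul_section h' h.momentKernel s)

-- The moment kernel is evaluated at `-s`, which turns its factor `-i s` into `+i s`.
omit [IsFiniteMeasure ν] [MeasurableSpace.CountablyGenerated Y] in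
theorem correlation_momentKernel (s : ℝ) :
    correlation ν ℓ' (momentKernel ℓ) s = Complex.I * (s • correlation ν ℓ' ℓ s) := by
  have : ∀ y z, fibTr (ℓ' s y z * momentKernel ℓ (-s) z y) =
      (Complex.I * s) * fibTr (ℓ' s y z * ℓ (-s) z y) := by
    intro y z
    rw [momentKernel, mul_smul_comm, ← fibTrCLM_apply, map_smul, fibTrCLM_apply, smul_eq_mul]
    push_cast
    ring
  simp only [correlation, this, integral_const_mul]
  rw [Complex.real_smul, mul_assoc]

/-- Melrose's cocycle as an integral over the cylinder. -/
theorem melroseCocycle_eq_momentPairing (h : IsDecayKernel ℓ) (h' : IsDecayKernel ℓ') :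
    melroseCocycle ν ℓ ℓ' = momentPairing ν ℓ ℓ' := by
  -- The constants combine to `(i/2π) · 2π · i = -1`, which is the sign of the exchange of `ℓ` and
  -- `ℓ'`.
  rw [melroseCocycle, (integrable_opTrace_melroseOperator h h').2, momentPairing_antisymm h h',
    momentPairing]
  simp only [correlation_momentKernel]
  rw [integral_const_mul]
  have : (Real.pi : ℂ) ≠ 0 := by exact_mod_cast Real.pi_ne_zero
  field_simp
  rw [Complex.I_sq]
  ring

end Melrose

/-! ### Convolution and the cocycle identity -/

section Convolution

variable {Y : Type*} [MeasurableSpace Y] {N : ℕ} {ℓ ℓ' ℓ₀ ℓ₁ ℓ₂ : ℝ → Y → Y → EndFib N}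
  {ν : Measure Y} [IsFiniteMeasure ν]

/-- Decay of order `m` in `s - q` and in `q` gives decay of order `m` in `s` by the triangle
inequality; the extra order in `q` is kept for integrability. -/
theorem norm_mul_le_exp (h : IsDecayKernel ℓ) (h' : IsDecayKernel ℓ') (m : ℕ) :
    ∃ c : ℝ, 0 ≤ c ∧ ∀ s q y w w' z, ‖ℓ (s - q) y w * ℓ' q w' z‖ ≤
      c * Real.exp (-(m * |s|)) * Real.exp (-|q|) := by
  obtain ⟨c, hc0, hc⟩ := h.exists_bound m
  obtain ⟨c', hc0', hc'⟩ := h'.exists_bound (m + 1)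
  refine ⟨c * c', by positivity, fun s q y w w' z => (norm_mul_le _ _).trans ?_⟩
  have h1 : Real.exp (-(m * |s - q|)) * Real.exp (-((m + 1 : ℕ) * |q|)) ≤
      Real.exp (-(m * |s|)) * Real.exp (-|q|) := by
    rw [← Real.exp_add, ← Real.exp_add]
    apply Real.exp_le_exp.2
    have h2 : |s| ≤ |s - q| + |q| := by simpa using abs_add_le (s - q) q
    have h3 : (m : ℝ) * |s| ≤ m * (|s - q| + |q|) := by gcongr
    push_cast
    linarith
  calc ‖ℓ (s - q) y w‖ * ‖ℓ' q w' z‖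
      ≤ (c * Real.exp (-(m * |s - q|))) * (c' * Real.exp (-((m + 1 : ℕ) * |q|))) := by
        gcongr
        · exact hc _ _ _
        · exact hc' _ _ _
    _ = c * c' * (Real.exp (-(m * |s - q|)) * Real.exp (-((m + 1 : ℕ) * |q|))) := by ring
    _ ≤ c * c' * (Real.exp (-(m * |s|)) * Real.exp (-|q|)) := by gcongr
    _ = _ := by ring

theorem integrable_conv (h : IsDecayKernel ℓ) (h' : IsDecayKernel ℓ') (s : ℝ) (y z : Y) :
    Integrable (fun q : ℝ × Y => ℓ (s - q.1) y q.2 * ℓ' q.1 q.2 z)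
      ((volume : Measure ℝ).prod ν) := by
  obtain ⟨c, -, hc⟩ := norm_mul_le_exp h h' 0
  refine integrable_of_norm_le_exp ((h.stronglyMeasurable_comp (f := fun q : ℝ × Y => s - q.1)
    (g := fun _ => y) (g' := fun q => q.2) (by fun_prop) (by fun_prop) (by fun_prop)).mul
    (h'.stronglyMeasurable_comp (f := fun q : ℝ × Y => q.1) (g := fun q => q.2) (g' := fun _ => z)
    (by fun_prop) (by fun_prop) (by fun_prop))) (c := c) fun q => ?_
  simpa using hc s q.1 y q.2 q.2 z

/-- The convolution of decaying kernels is a decaying kernel. -/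
theorem IsDecayKernel.conv (h : IsDecayKernel ℓ) (h' : IsDecayKernel ℓ') :
    IsDecayKernel (conv ν ℓ ℓ') where
  stronglyMeasurable := by
    have : StronglyMeasurable fun x : (ℝ × Y × Y) × (ℝ × Y) =>
        ℓ (x.1.1 - x.2.1) x.1.2.1 x.2.2 * ℓ' x.2.1 x.2.2 x.1.2.2 :=
      (h.stronglyMeasurable_comp (f := fun x : (ℝ × Y × Y) × (ℝ × Y) => x.1.1 - x.2.1)
        (g := fun x => x.1.2.1) (g' := fun x => x.2.2) (by fun_prop) (by fun_prop)
        (by fun_prop)).mul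
      (h'.stronglyMeasurable_comp (f := fun x : (ℝ × Y × Y) × (ℝ × Y) => x.2.1)
        (g := fun x => x.2.2) (g' := fun x => x.1.2.2) (by fun_prop) (by fun_prop) (by fun_prop))
    exact this.integral_prod_right'
  decay m := by
    obtain ⟨c, -, hc⟩ := norm_mul_le_exp h h' m
    refine ⟨∫ q : ℝ × Y, c * Real.exp (-|q.1|) ∂((volume : Measure ℝ).prod ν), fun s y z => ?_⟩
    rw [← integral_mul_const]
    refine norm_integral_le_of_norm_le
      (((integrable_comp_fst integrable_exp_neg_abs).const_mul c).mul_const _)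
      (Eventually.of_forall fun q => (hc s q.1 y q.2 q.2 z).trans (le_of_eq (by ring)))

/-- The integrand `tr (ℓ₀(a, y, w) ℓ₁(b, w, z) ℓ₂(-a-b, z, y))` at the point `(z, (y, w))`. -/
def tripleKernel (ℓ₀ ℓ₁ ℓ₂ : ℝ → Y → Y → EndFib N) (a b : ℝ) (x : Y × (Y × Y)) : ℂ :=
  fibTr (ℓ₀ a x.2.1 x.2.2 * (ℓ₁ b x.2.2 x.1 * ℓ₂ (-a - b) x.1 x.2.1))

/-- The integral of `tr (ℓ₀(a, y, w) ℓ₁(b, w, z) ℓ₂(-a-b, z, y))` over `Y × Y × Y`. -/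
def tripleCorrelation (ν : Measure Y) (ℓ₀ ℓ₁ ℓ₂ : ℝ → Y → Y → EndFib N) (a b : ℝ) : ℂ :=
  ∫ x, tripleKernel ℓ₀ ℓ₁ ℓ₂ a b x ∂(ν.prod (ν.prod ν))

theorem measurePreserving_rotate :
    MeasurePreserving (fun x : Y × (Y × Y) => (x.2.1, (x.2.2, x.1))) (ν.prod (ν.prod ν))
      (ν.prod (ν.prod ν)) :=
  (measurePreserving_prodAssoc ν ν ν).comp Measure.measurePreserving_swap

-- The three times `a`, `b`, `-a-b` have sum zero, so a cyclic rotation of the factors only permutes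
-- them.
omit [MeasurableSpace Y] in
theorem tripleKernel_rotate (a b : ℝ) (x : Y × (Y × Y)) :
    tripleKernel ℓ₁ ℓ₂ ℓ₀ b (-a - b) (x.2.1, (x.2.2, x.1)) = tripleKernel ℓ₀ ℓ₁ ℓ₂ a b x := by
  simp only [tripleKernel]
  rw [show -b - (-a - b) = a by ring, fibTr_mul_comm (ℓ₀ _ _ _), mul_assoc]

theorem stronglyMeasurable_tripleKernel (h₀ : IsDecayKernel ℓ₀) (h₁ : IsDecayKernel ℓ₁)
    (h₂ : IsDecayKernel ℓ₂) :
    StronglyMeasurable fun p : (ℝ × ℝ) × (Y × (Y × Y)) => tripleKernel ℓ₀ ℓ₁ ℓ₂ p.1.1 p.1.2 p.2 :=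
  stronglyMeasurable_fibTr
    ((h₀.stronglyMeasurable_comp (f := fun p : (ℝ × ℝ) × (Y × (Y × Y)) => p.1.1)
      (g := fun p => p.2.2.1) (g' := fun p => p.2.2.2) (by fun_prop) (by fun_prop)
      (by fun_prop)).mul
    ((h₁.stronglyMeasurable_comp (f := fun p : (ℝ × ℝ) × (Y × (Y × Y)) => p.1.2)
      (g := fun p => p.2.2.2) (g' := fun p => p.2.1) (by fun_prop) (by fun_prop)
      (by fun_prop)).mul
    (h₂.stronglyMeasurable_comp (f := fun p : (ℝ × ℝ) × (Y × (Y × Y)) => -p.1.1 - p.1.2)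
      (g := fun p => p.2.1) (g' := fun p => p.2.2.1) (by fun_prop) (by fun_prop)
      (by fun_prop))))

/-- Boundedness of the third factor suffices. The first two decay at rate `2`, leaving room for the
linear weights in the cocycle identity. -/
theorem norm_tripleKernel_le (h₀ : IsDecayKernel ℓ₀) (h₁ : IsDecayKernel ℓ₁)
    (h₂ : IsDecayKernel ℓ₂) : ∃ c : ℝ, 0 ≤ c ∧ ∀ a b x, ‖tripleKernel ℓ₀ ℓ₁ ℓ₂ a b x‖ ≤
      c * (Real.exp (-(2 * |a|)) * Real.exp (-(2 * |b|))) := by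
  obtain ⟨c₀, hc₀, h₀⟩ := h₀.exists_bound 2
  obtain ⟨c₁, hc₁, h₁⟩ := h₁.exists_bound 2
  obtain ⟨c₂, hc₂, h₂⟩ := h₂.exists_bound 0
  refine ⟨‖fibTrCLM N‖ * (c₀ * (c₁ * c₂)), by positivity, fun a b x => ?_⟩
  refine (norm_fibTr_mul_le _ _).trans ?_
  simp only [Nat.cast_zero, zero_mul, neg_zero, Real.exp_zero, mul_one, Nat.cast_ofNat] at h₀ h₁ h₂
  calc _ ≤ ‖fibTrCLM N‖ * ((c₀ * Real.exp (-(2 * |a|))) * ((c₁ * Real.exp (-(2 * |b|))) * c₂)) := by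
        gcongr
        · exact h₀ _ _ _
        · refine (norm_mul_le _ _).trans ?_
          gcongr
          · exact h₁ _ _ _
          · exact h₂ _ _ _
    _ = _ := by ring

theorem tripleCorrelation_rotate (h₀ : IsDecayKernel ℓ₀) (h₁ : IsDecayKernel ℓ₁)
    (h₂ : IsDecayKernel ℓ₂) (a b : ℝ) :
    tripleCorrelation ν ℓ₁ ℓ₂ ℓ₀ b (-a - b) = tripleCorrelation ν ℓ₀ ℓ₁ ℓ₂ a b := by
  have hm := (stronglyMeasurable_tripleKernel h₁ h₂ h₀).comp_measurable
    (g := fun x : Y × (Y × Y) => ((b, -a - b), x)) (by fun_prop)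
  have := integral_map (f := tripleKernel ℓ₁ ℓ₂ ℓ₀ b (-a - b)) (measurePreserving_rotate (ν := ν)).aemeasurable
    hm.aestronglyMeasurable
  rw [(measurePreserving_rotate (ν := ν)).map_eq] at this
  rw [tripleCorrelation, this]
  simp only [tripleKernel_rotate]
  rfl

/-- The correlation function of `ℓ₀` and the convolution of `ℓ₁` and `ℓ₂`. -/
theorem correlation_conv (h₀ : IsDecayKernel ℓ₀) (h₁ : IsDecayKernel ℓ₁)
    (h₂ : IsDecayKernel ℓ₂) (a : ℝ) :
    correlation ν ℓ₀ (conv ν ℓ₁ ℓ₂) a = ∫ b, tripleCorrelation ν ℓ₀ ℓ₁ ℓ₂ a b := by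
  obtain ⟨c, hc0, hc⟩ := norm_tripleKernel_le h₀ h₁ h₂
  -- The convolution at time `-a` integrates over the time `q` of `ℓ₂`; the time of `ℓ₁` is then `b
  -- = -a - q`.
  have hm : StronglyMeasurable fun p : ℝ × (Y × (Y × Y)) =>
      tripleKernel ℓ₀ ℓ₁ ℓ₂ a (-a - p.1) p.2 :=
    (stronglyMeasurable_tripleKernel h₀ h₁ h₂).comp_measurable
      (g := fun p : ℝ × (Y × (Y × Y)) => ((a, -a - p.1), p.2)) (by fun_prop)
  have hint : Integrable (fun p : ℝ × (Y × (Y × Y)) => tripleKernel ℓ₀ ℓ₁ ℓ₂ a (-a - p.1) p.2)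
      ((volume : Measure ℝ).prod (ν.prod (ν.prod ν))) := by
    refine integrable_of_norm_le_exp hm (c := c) fun p => (hc _ _ _).trans ?_
    gcongr
    rw [← Real.exp_add]
    apply Real.exp_le_exp.2
    have : |p.1| ≤ |-a - p.1| + |a| := by
      have := abs_add_le (-a - p.1) a
      rw [show -a - p.1 + a = -p.1 by ring, abs_neg] at this
      exact this
    linarith [abs_nonneg a, abs_nonneg (-a - p.1)]
  have hmp : MeasurePreserving (fun p : (Y × Y) × (ℝ × Y) => (p.2.1, (p.2.2, p.1)))
      ((ν.prod ν).prod ((volume : Measure ℝ).prod ν))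
      ((volume : Measure ℝ).prod (ν.prod (ν.prod ν))) :=
    (measurePreserving_prodAssoc (volume : Measure ℝ) ν (ν.prod ν)).comp
      Measure.measurePreserving_swap
  have hint2 : Integrable (fun p : (Y × Y) × (ℝ × Y) =>
      fibTr (ℓ₀ a p.1.1 p.1.2 * (ℓ₁ (-a - p.2.1) p.1.2 p.2.2 * ℓ₂ p.2.1 p.2.2 p.1.1)))
      ((ν.prod ν).prod ((volume : Measure ℝ).prod ν)) := by
    have := hmp.integrable_comp_of_integrable hint
    refine this.congr (Eventually.of_forall fun p => ?_)
    simp [tripleKernel]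
  have e1 : correlation ν ℓ₀ (conv ν ℓ₁ ℓ₂) a = ∫ p : Y × Y, ∫ q : ℝ × Y,
      fibTr (ℓ₀ a p.1 p.2 * (ℓ₁ (-a - q.1) p.2 q.2 * ℓ₂ q.1 q.2 p.1))
        ∂((volume : Measure ℝ).prod ν) ∂(ν.prod ν) := by
    rw [integral_prod _ hint2.integral_prod_left]
    refine integral_congr_ae (Eventually.of_forall fun y => integral_congr_ae
      (Eventually.of_forall fun w => ?_))
    have hi := integrable_conv (ν := ν) h₁ h₂ (-a) w y
    simp only [conv]
    rw [integral_fibTr (hi.const_mul (ℓ₀ a y w)), integral_const_mul_of_integrable hi]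
  rw [e1, ← integral_sub_left_eq_self (fun b => tripleCorrelation ν ℓ₀ ℓ₁ ℓ₂ a b) volume (-a)]
  simp only [tripleCorrelation]
  rw [← integral_prod (fun p : (Y × Y) × (ℝ × Y) =>
      fibTr (ℓ₀ a p.1.1 p.1.2 * (ℓ₁ (-a - p.2.1) p.1.2 p.2.2 * ℓ₂ p.2.1 p.2.2 p.1.1))) hint2,
    ← integral_prod (fun p : ℝ × (Y × (Y × Y)) => tripleKernel ℓ₀ ℓ₁ ℓ₂ a (-a - p.1) p.2) hint,
    ← hmp.map_eq, integral_map hmp.aemeasurable hm.aestronglyMeasurable]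
  simp only [tripleKernel, sub_sub_cancel]

theorem stronglyMeasurable_tripleCorrelation (h₀ : IsDecayKernel ℓ₀) (h₁ : IsDecayKernel ℓ₁)
    (h₂ : IsDecayKernel ℓ₂) :
    StronglyMeasurable fun p : ℝ × ℝ => tripleCorrelation ν ℓ₀ ℓ₁ ℓ₂ p.1 p.2 :=
  (stronglyMeasurable_tripleKernel h₀ h₁ h₂).integral_prod_right'

theorem integrable_smul_tripleCorrelation (h₀ : IsDecayKernel ℓ₀) (h₁ : IsDecayKernel ℓ₁)
    (h₂ : IsDecayKernel ℓ₂) {f : ℝ × ℝ → ℝ} (hf : Measurable f)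
    (hb : ∀ p, |f p| ≤ |p.1| + |p.2|) :
    Integrable (fun p : ℝ × ℝ => f p • tripleCorrelation ν ℓ₀ ℓ₁ ℓ₂ p.1 p.2) := by
  obtain ⟨c, hc0, hc⟩ := norm_tripleKernel_le h₀ h₁ h₂
  have hb2 : ∀ a b, ‖tripleCorrelation ν ℓ₀ ℓ₁ ℓ₂ a b‖ ≤
      c * (Real.exp (-(2 * |a|)) * Real.exp (-(2 * |b|))) * (ν.prod (ν.prod ν)).real univ :=
    fun a b => norm_integral_le_of_norm_le_const (Eventually.of_forall fun x => hc a b x)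
  refine ((integrable_exp_neg_abs.mul_prod integrable_exp_neg_abs).const_mul
    (c * (ν.prod (ν.prod ν)).real univ)).mono' (hf.stronglyMeasurable.smul
      (stronglyMeasurable_tripleCorrelation h₀ h₁ h₂)).aestronglyMeasurable
      (Eventually.of_forall fun p => ?_)
  rw [norm_smul, Real.norm_eq_abs]
  have h1 : |f p| ≤ Real.exp (|p.1| + |p.2|) :=
    (hb p).trans ((le_add_of_nonneg_right zero_le_one).trans (Real.add_one_le_exp _))
  calc _ ≤ Real.exp (|p.1| + |p.2|) *
        (c * (Real.exp (-(2 * |p.1|)) * Real.exp (-(2 * |p.2|))) *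
          (ν.prod (ν.prod ν)).real univ) := by
        gcongr
        exact hb2 _ _
    _ = c * (ν.prod (ν.prod ν)).real univ *
        (Real.exp (|p.1| + |p.2|) * (Real.exp (-(2 * |p.1|)) * Real.exp (-(2 * |p.2|)))) := by ring
    _ = _ := by
        rw [← Real.exp_add, ← Real.exp_add, ← Real.exp_add]
        ring_nf

theorem momentPairing_conv (h₀ : IsDecayKernel ℓ₀) (h₁ : IsDecayKernel ℓ₁)
    (h₂ : IsDecayKernel ℓ₂) :
    momentPairing ν ℓ₀ (conv ν ℓ₁ ℓ₂) =
      ∫ a : ℝ, ∫ b : ℝ, a • tripleCorrelation ν ℓ₀ ℓ₁ ℓ₂ a b := by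
  simp only [momentPairing, correlation_conv h₀ h₁ h₂, integral_smul]

/-- The cyclic cocycle identity for the pairing. -/
theorem momentPairing_cocycle (h₀ : IsDecayKernel ℓ₀) (h₁ : IsDecayKernel ℓ₁)
    (h₂ : IsDecayKernel ℓ₂) :
    momentPairing ν (conv ν ℓ₀ ℓ₁) ℓ₂ - momentPairing ν ℓ₀ (conv ν ℓ₁ ℓ₂)
      + momentPairing ν (conv ν ℓ₂ ℓ₀) ℓ₁ = 0 := by
  -- By antisymmetry each term becomes minus the pairing of one kernel with a convolution of the
  -- other two. Each such pairing is the integral of `T` against the time of the single kernel, and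
  -- the times `a`, `b`, `-a-b` cancel.
  let T := tripleCorrelation ν ℓ₀ ℓ₁ ℓ₂
  have i0 : Integrable (fun p : ℝ × ℝ => p.1 • T p.1 p.2) :=
    integrable_smul_tripleCorrelation h₀ h₁ h₂ measurable_fst fun p => by
      linarith [abs_nonneg p.2]
  have i1 : Integrable (fun p : ℝ × ℝ => p.2 • T p.1 p.2) :=
    integrable_smul_tripleCorrelation h₀ h₁ h₂ measurable_snd fun p => by
      linarith [abs_nonneg p.1]
  have i2 : Integrable (fun p : ℝ × ℝ => (-p.1 - p.2) • T p.1 p.2) :=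
    (i0.neg.sub i1).congr (Eventually.of_forall fun p => by simp [sub_smul])
  have j2 : Integrable (fun p : ℝ × ℝ => p.1 • tripleCorrelation ν ℓ₂ ℓ₀ ℓ₁ p.1 p.2) :=
    integrable_smul_tripleCorrelation h₂ h₀ h₁ measurable_fst fun p => by
      linarith [abs_nonneg p.2]
  have e0 : momentPairing ν ℓ₀ (conv ν ℓ₁ ℓ₂) = ∫ p : ℝ × ℝ, p.1 • T p.1 p.2 := by
    rw [momentPairing_conv h₀ h₁ h₂]
    exact (integral_prod _ i0).symm
  have e1 : momentPairing ν ℓ₁ (conv ν ℓ₂ ℓ₀) = ∫ p : ℝ × ℝ, p.2 • T p.1 p.2 := by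
    rw [momentPairing_conv h₁ h₂ h₀, Measure.volume_eq_prod, integral_prod _ i1]
    rw [integral_integral_swap (f := fun a b => b • T a b) i1]
    congr 1; funext b
    rw [← integral_sub_left_eq_self (fun c => b • tripleCorrelation ν ℓ₁ ℓ₂ ℓ₀ b c) volume (-b)]
    congr 1; funext a
    rw [show -b - a = -a - b by ring, tripleCorrelation_rotate h₀ h₁ h₂]
  have e2 : momentPairing ν ℓ₂ (conv ν ℓ₀ ℓ₁) = ∫ p : ℝ × ℝ, (-p.1 - p.2) • T p.1 p.2 := by
    rw [momentPairing_conv h₂ h₀ h₁, Measure.volume_eq_prod, integral_prod _ i2]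
    rw [integral_integral_swap (f := fun c a => c • tripleCorrelation ν ℓ₂ ℓ₀ ℓ₁ c a) j2]
    congr 1; funext a
    rw [← integral_sub_left_eq_self (fun c => c • tripleCorrelation ν ℓ₂ ℓ₀ ℓ₁ c a) volume (-a)]
    congr 1; funext b
    congr 1
    -- Two rotations bring `ℓ₂` to the front.
    have r1 := tripleCorrelation_rotate (ν := ν) h₀ h₁ h₂ a b
    have r2 := tripleCorrelation_rotate (ν := ν) h₁ h₂ h₀ b (-a - b)
    rw [show -b - (-a - b) = a by ring] at r2
    rw [r2, r1]
  have e3 : ∫ p : ℝ × ℝ, (-p.1 - p.2) • T p.1 p.2 =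
      -(∫ p : ℝ × ℝ, p.1 • T p.1 p.2) - ∫ p : ℝ × ℝ, p.2 • T p.1 p.2 := by
    have i0' : Integrable (fun p : ℝ × ℝ => -(p.1 • T p.1 p.2)) := i0.neg
    rw [← integral_neg, ← integral_sub i0' i1]
    congr 1; funext p
    module
  rw [momentPairing_antisymm (h₀.conv h₁) h₂, momentPairing_antisymm (h₂.conv h₀) h₁, e0, e1, e2, e3]
  ring

end Convolution

/-! ### From smooth densities and kernels to measure theory -/

section Manifold

/-- In a chart the density is continuous, hence bounded on a small closed ball. Compactness then
makes `ν` finite and gives the core of `X` finite measure. -/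
theorem IsSmoothDensity.isLocallyFiniteMeasure {m : ℕ} {M : Type*} [TopologicalSpace M]
    [MeasurableSpace M] [BorelSpace M] [ChartedSpace (EuclideanSpace ℝ (Fin m)) M] {μ : Measure M}
    (h : IsSmoothDensity m μ) : IsLocallyFiniteMeasure μ := by
  refine ⟨fun x => ?_⟩
  set e := chartAt (EuclideanSpace ℝ (Fin m)) x with he
  obtain ⟨ρ, hρ, -, hμ⟩ := h e (chart_mem_atlas _ x)
  have hx : x ∈ e.source := mem_chart_source _ x
  obtain ⟨r, hr, hball⟩ := Metric.nhds_basis_closedBall.mem_iff.1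
    (e.open_target.mem_nhds (e.map_source hx))
  obtain ⟨B, hB⟩ := (isCompact_closedBall (e x) r).exists_bound_of_continuousOn
    (hρ.continuousOn.mono hball)
  refine ⟨e ⁻¹' Metric.ball (e x) r ∩ e.source, ?_, ?_⟩
  · exact Filter.inter_mem ((e.continuousAt hx).preimage_mem_nhds (Metric.ball_mem_nhds _ hr))
      (e.open_source.mem_nhds hx)
  · have hae : AEMeasurable e (μ.restrict e.source) :=
      e.continuousOn.aemeasurable e.open_source.measurableSet
    rw [← Measure.restrict_apply' e.open_source.measurableSet,
      ← Measure.map_apply_of_aemeasurable hae Metric.isOpen_ball.measurableSet, hμ,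
      withDensity_apply _ Metric.isOpen_ball.measurableSet]
    calc ∫⁻ u in Metric.ball (e x) r, ENNReal.ofReal (ρ u) ∂volume.restrict e.target
        ≤ ∫⁻ _ in Metric.ball (e x) r, ENNReal.ofReal B ∂volume.restrict e.target := by
          refine setLIntegral_mono' Metric.isOpen_ball.measurableSet fun u hu => ?_
          exact ENNReal.ofReal_le_ofReal ((le_abs_self _).trans
            (hB u (Metric.ball_subset_closedBall hu)))
      _ ≤ ENNReal.ofReal B * volume (Metric.ball (e x) r) := by
          rw [setLIntegral_const]
          gcongr
          exact Measure.restrict_le_self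
      _ < ⊤ := ENNReal.mul_lt_top ENNReal.ofReal_lt_top measure_ball_lt_top

theorem IsInvariantKernel.isDecayKernel {n N : ℕ} {Y : Type*} [TopologicalSpace Y]
    [SecondCountableTopology Y] [ChartedSpace (EuclideanSpace ℝ (Fin n)) Y]
    [MeasurableSpace Y] [BorelSpace Y] {P : Y → EndFib N} {ℓ : ℝ → Y → Y → EndFib N}
    (h : IsInvariantKernel n P ℓ) : IsDecayKernel ℓ :=
  ⟨h.smooth.continuous.stronglyMeasurable, h.decay⟩

end Manifold

/-! ### The end coordinate and the decomposition of the measure of `X` -/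

namespace CylindricalEnd

variable {n N : ℕ} {Y X : Type*} [TopologicalSpace Y] [TopologicalSpace X]
  [ChartedSpace (EuclideanSpace ℝ (Fin n)) Y]
  [ChartedSpace (EuclideanSpace ℝ (Fin (n + 1))) X]
  [MeasurableSpace Y] [MeasurableSpace X] {ν : Measure Y} {μ : Measure X}
  (C : CylindricalEnd n ν μ)

theorem mem_source {t : ℝ} (ht : t ≤ 0) (y : Y) : (t, y) ∈ C.incl.source := by
  rw [C.source_eq]
  exact ⟨ht.trans_lt C.width_pos, mem_univ _⟩

theorem endCoord_incl {t : ℝ} (ht : t < 0) (y : Y) : C.endCoord (C.incl (t, y)) = t := by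
  have h : C.incl (t, y) ∈ C.incl '' (Iio 0 ×ˢ univ) := ⟨(t, y), ⟨ht, mem_univ _⟩, rfl⟩
  rw [endCoord, if_pos h, C.incl.left_inv (C.mem_source ht.le y)]

theorem endCoord_of_notMem {x : X} (h : x ∉ C.incl '' (Iio 0 ×ˢ univ)) : C.endCoord x = 0 := by
  rw [endCoord, if_neg h]

theorem mem_image_iff {a : ℝ} (ha : a ≤ 0) (x : X) :
    x ∈ C.incl '' (Iio a ×ˢ univ) ↔ C.endCoord x < a := by
  constructor
  · rintro ⟨⟨t, y⟩, ⟨ht, -⟩, rfl⟩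
    rw [C.endCoord_incl (lt_of_lt_of_le ht ha)]
    exact ht
  · intro h
    by_cases hx : x ∈ C.incl '' (Iio 0 ×ˢ univ)
    · obtain ⟨⟨t, y⟩, ⟨ht, -⟩, rfl⟩ := hx
      rw [C.endCoord_incl ht] at h
      exact ⟨(t, y), ⟨h, mem_univ _⟩, rfl⟩
    · rw [C.endCoord_of_notMem hx] at h
      linarith

theorem endCoord_nonpos (x : X) : C.endCoord x ≤ 0 := by
  by_cases hx : x ∈ C.incl '' (Iio 0 ×ˢ univ)
  · exact ((C.mem_image_iff le_rfl x).1 hx).le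
  · exact (C.endCoord_of_notMem hx).le

theorem truncation_eq {r : ℝ} (hr : 0 ≤ r) : C.truncation r = {x | -r ≤ C.endCoord x} := by
  ext x
  rw [truncation, mem_compl_iff, C.mem_image_iff (by linarith)]
  simp

theorem endCoord_eq_zero_of_mem {x : X} (hx : x ∈ C.truncation 0) : C.endCoord x = 0 := by
  rw [C.truncation_eq le_rfl] at hx
  exact le_antisymm (C.endCoord_nonpos x) (by simpa using hx)

theorem isOpen_image {a : ℝ} (ha : a ≤ 0) : IsOpen (C.incl '' (Iio a ×ˢ univ)) := by
  apply C.incl.isOpen_image_of_subset_source (isOpen_Iio.prod isOpen_univ)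
  rintro ⟨t, y⟩ ⟨ht, -⟩
  exact C.mem_source (le_of_lt (lt_of_lt_of_le ht ha)) y

theorem measurable_endCoord [OpensMeasurableSpace X] : Measurable C.endCoord := by
  refine measurable_of_Iio fun a => ?_
  rcases le_total a 0 with ha | ha
  · have : C.endCoord ⁻¹' Iio a = C.incl '' (Iio a ×ˢ univ) := by
      ext x
      rw [C.mem_image_iff ha]
      rfl
    rw [this]
    exact (C.isOpen_image ha).measurableSet
  · have : C.endCoord ⁻¹' Iio a = C.incl '' (Iio 0 ×ˢ univ) ∪
        {x | x ∉ C.incl '' (Iio 0 ×ˢ univ) ∧ 0 < a} := by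
      ext x
      simp only [mem_preimage, mem_Iio, mem_union, mem_ofPred_eq]
      by_cases hx : x ∈ C.incl '' (Iio 0 ×ˢ univ)
      · simp only [hx, true_or, iff_true]
        exact ((C.mem_image_iff le_rfl x).1 hx).trans_le ha
      · simp [hx, C.endCoord_of_notMem hx]
    rw [this]
    exact (C.isOpen_image le_rfl).measurableSet.union
      ((C.isOpen_image le_rfl).measurableSet.compl.inter (MeasurableSet.const _))

theorem measurableSet_truncation [OpensMeasurableSpace X] {r : ℝ} (hr : 0 ≤ r) :
    MeasurableSet (C.truncation r) :=
  (C.isOpen_image (by linarith : -r ≤ 0)).measurableSet.compl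

/-- The inclusion of the end, extended to all of `ℝ × Y`. -/
def endMap (p : ℝ × Y) : X := C.incl (min p.1 0, p.2)

theorem endMap_of_nonpos {p : ℝ × Y} (hp : p.1 ≤ 0) : C.endMap p = C.incl p := by
  rw [endMap, min_eq_left hp]

theorem endCoord_endMap {p : ℝ × Y} (hp : p.1 < 0) : C.endCoord (C.endMap p) = p.1 := by
  rw [C.endMap_of_nonpos hp.le]
  exact C.endCoord_incl hp p.2

/-- The positive width of the collar puts the clamped point `(0, y)` in the domain of the inclusion,
so the total extension is continuous and can push measures forward. -/
theorem continuous_endMap : Continuous C.endMap :=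
  C.incl.continuousOn.comp_continuous (by fun_prop) fun p => C.mem_source (min_le_right _ _) p.2

variable [BorelSpace X] [BorelSpace Y] [SecondCountableTopology Y]

theorem measurable_endMap : Measurable C.endMap := C.continuous_endMap.measurable

/-- Restrict the density identity of the collar to `t < 0`, where `endMap` is the inclusion;
injectivity on the collar identifies the preimages. -/
theorem restrict_compl_truncation_zero :
    μ.restrict (C.truncation 0)ᶜ =
      (((volume : Measure ℝ).prod ν).restrict (Iio 0 ×ˢ univ)).map C.endMap := by
  have hV : (C.truncation 0)ᶜ = C.incl '' (Iio 0 ×ˢ univ) := by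
    rw [truncation, compl_compl, neg_zero]
  have hsub : C.incl '' (Iio 0 ×ˢ univ) ⊆ C.incl.target := by
    rintro _ ⟨⟨t, y⟩, ⟨ht, -⟩, rfl⟩
    exact C.incl.map_source (C.mem_source (le_of_lt ht) y)
  have hVm := (C.isOpen_image le_rfl).measurableSet
  have hae : AEMeasurable C.incl (((volume : Measure ℝ).prod ν).restrict C.incl.source) :=
    C.incl.continuousOn.aemeasurable C.incl.open_source.measurableSet
  rw [hV]
  ext s hs
  rw [Measure.restrict_apply hs, Measure.map_apply C.measurable_endMap hs,
    Measure.restrict_apply (C.measurable_endMap hs)]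
  have h1 : μ (s ∩ C.incl '' (Iio 0 ×ˢ univ)) =
      μ.restrict C.incl.target (s ∩ C.incl '' (Iio 0 ×ˢ univ)) := by
    rw [Measure.restrict_apply (hs.inter hVm),
      inter_eq_left.2 (inter_subset_right.trans hsub)]
  rw [h1, C.density_eq, Measure.map_apply_of_aemeasurable hae (hs.inter hVm),
    Measure.restrict_apply' C.incl.open_source.measurableSet]
  congr 1
  ext p
  constructor
  · rintro ⟨⟨h2, ⟨q, hq, hqp⟩⟩, h3⟩
    have : q = p := C.incl.injOn (C.mem_source (le_of_lt hq.1) q.2) h3 hqp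
    subst this
    refine ⟨?_, hq⟩
    rw [mem_preimage, C.endMap_of_nonpos (le_of_lt hq.1)]
    exact h2
  · rintro ⟨h2, h3⟩
    rw [mem_preimage, C.endMap_of_nonpos (le_of_lt h3.1)] at h2
    exact ⟨⟨h2, ⟨p, h3, rfl⟩⟩, C.mem_source (le_of_lt h3.1) p.2⟩

/-- The measure of `X` is the sum of the measures of the core and of the end. -/
theorem measure_eq : μ = μ.restrict (C.truncation 0) +
    (((volume : Measure ℝ).prod ν).restrict (Iio 0 ×ˢ univ)).map C.endMap := by
  rw [← C.restrict_compl_truncation_zero,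
    Measure.restrict_add_restrict_compl (C.measurableSet_truncation le_rfl)]

theorem restrict_truncation {r : ℝ} (hr : 0 ≤ r) : μ.restrict (C.truncation r) =
    μ.restrict (C.truncation 0) +
      (((volume : Measure ℝ).prod ν).restrict (Ico (-r) 0 ×ˢ univ)).map C.endMap := by
  have hm := C.measurableSet_truncation hr
  have h0 : C.truncation r ∩ C.truncation 0 = C.truncation 0 := by
    rw [inter_eq_right, C.truncation_eq hr, C.truncation_eq le_rfl]
    intro x (hx : -0 ≤ C.endCoord x)
    simp only [mem_ofPred_eq]
    linarith
  have h1 : C.endMap ⁻¹' C.truncation r ∩ Iio 0 ×ˢ univ = Ico (-r) 0 ×ˢ univ := by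
    ext p
    simp only [C.truncation_eq hr, mem_inter_iff, mem_preimage, mem_ofPred_eq, mem_prod, mem_Iio,
      mem_univ, and_true, mem_Ico]
    refine and_congr_left fun hp => ?_
    rw [C.endCoord_endMap hp]
  rw [congrArg (fun m => Measure.restrict m _) C.measure_eq, Measure.restrict_add, Measure.restrict_restrict hm, h0,
    Measure.restrict_map C.measurable_endMap hm,
    Measure.restrict_restrict (C.measurable_endMap hm), h1]

theorem restrict_compl_truncation {r : ℝ} (hr : 0 ≤ r) : μ.restrict (C.truncation r)ᶜ =
    (((volume : Measure ℝ).prod ν).restrict (Iio (-r) ×ˢ univ)).map C.endMap := by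
  have hm := (C.measurableSet_truncation hr).compl
  have h0 : (C.truncation r)ᶜ ∩ C.truncation 0 = ∅ := by
    rw [C.truncation_eq hr, C.truncation_eq le_rfl]
    ext x
    simp only [mem_inter_iff, mem_compl_iff, mem_ofPred_eq, mem_empty_iff_false, iff_false, not_and]
    intro h h'
    linarith
  have h1 : C.endMap ⁻¹' (C.truncation r)ᶜ ∩ Iio 0 ×ˢ univ = Iio (-r) ×ˢ univ := by
    ext p
    simp only [C.truncation_eq hr, mem_inter_iff, mem_preimage, mem_compl_iff, mem_ofPred_eq,
      mem_prod, mem_Iio, mem_univ, and_true, not_le]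
    constructor
    · rintro ⟨h1, h2⟩
      rwa [C.endCoord_endMap h2] at h1
    · intro h
      have h2 : p.1 < 0 := by linarith
      rw [C.endCoord_endMap h2]
      exact ⟨h, h2⟩
  rw [congrArg (fun m => Measure.restrict m _) C.measure_eq, Measure.restrict_add, Measure.restrict_restrict hm, h0, Measure.restrict_empty, zero_add,
    Measure.restrict_map C.measurable_endMap hm,
    Measure.restrict_restrict (C.measurable_endMap hm), h1]

omit [BorelSpace X] [BorelSpace Y] [SecondCountableTopology Y] in
theorem isFiniteMeasure_core [IsLocallyFiniteMeasure μ] :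
    IsFiniteMeasure (μ.restrict (C.truncation 0)) := by
  have : IsCompact (C.truncation 0) := by
    rw [truncation, neg_zero]
    exact C.isCompact_core
  exact ⟨by rw [Measure.restrict_apply_univ]; exact this.measure_lt_top⟩

end CylindricalEnd

/-! ### Translations of the cylinder -/

section Shift

variable {Y : Type*} [MeasurableSpace Y]

/-- Translation of the cylinder by `-a`. -/
def cylShift (Y : Type*) [MeasurableSpace Y] (a : ℝ) : ℝ × Y ≃ᵐ ℝ × Y :=
  (MeasurableEquiv.subRight a).prodCongr (MeasurableEquiv.refl Y)

theorem cylShift_apply (a : ℝ) (p : ℝ × Y) : cylShift Y a p = (p.1 - a, p.2) := rfl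

theorem measurePreserving_cylShift (ν : Measure Y) [SFinite ν] (a : ℝ) :
    MeasurePreserving (cylShift Y a) ((volume : Measure ℝ).prod ν) ((volume : Measure ℝ).prod ν) :=
  (measurePreserving_sub_right volume a).prod (MeasurePreserving.id ν)

theorem integrable_exp_sub {ν : Measure Y} [IsFiniteMeasure ν] (a : ℝ) :
    Integrable (fun p : ℝ × Y => Real.exp (-|p.1 - a|)) ((volume : Measure ℝ).prod ν) :=
  integrable_comp_fst (f := fun t => Real.exp (-|t - a|)) (integrable_exp_neg_abs.comp_sub_right a)

theorem integral_exp_sub {ν : Measure Y} [IsFiniteMeasure ν] (a : ℝ) :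
    ∫ p : ℝ × Y, Real.exp (-|p.1 - a|) ∂((volume : Measure ℝ).prod ν) =
      ∫ p : ℝ × Y, Real.exp (-|p.1|) ∂((volume : Measure ℝ).prod ν) :=
  (measurePreserving_cylShift ν a).integral_comp' (fun p : ℝ × Y => Real.exp (-|p.1|))

end Shift

/-! ### Kernels on `X` and their indicial limits -/

namespace CylindricalEnd

variable {n N : ℕ} {Y X : Type*} [TopologicalSpace Y] [TopologicalSpace X]
  [ChartedSpace (EuclideanSpace ℝ (Fin n)) Y]
  [ChartedSpace (EuclideanSpace ℝ (Fin (n + 1))) X]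
  [MeasurableSpace Y] [MeasurableSpace X] {ν : Measure Y} {μ : Measure X}
  (C : CylindricalEnd n ν μ)

/-- Measurable kernels on a manifold with cylindrical end, decaying faster than every exponential
away from the diagonal and asymptotic to the invariant kernel `ℓ` along the end. -/
structure IsEndKernel (k : X → X → EndFib N) (ℓ : ℝ → Y → Y → EndFib N) : Prop where
  stronglyMeasurable : StronglyMeasurable (Function.uncurry k)
  isDecayKernel : IsDecayKernel ℓ
  decay : ∀ m : ℕ, ∃ c : ℝ, 0 ≤ c ∧ ∀ x x',
    ‖k x x'‖ ≤ c * Real.exp (-(m * |C.endCoord x - C.endCoord x'|))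
  asymptotic : ∀ m : ℕ, ∃ c : ℝ, 0 ≤ c ∧ ∀ t < 0, ∀ t' < 0, ∀ y z,
    ‖k (C.incl (t, y)) (C.incl (t', z)) - ℓ (t - t') y z‖
      ≤ c * Real.exp (max t t') * Real.exp (-(m * |t - t'|))

variable {C}

theorem IsSmoothingKernel.exists_isEndKernel [SecondCountableTopology X] [BorelSpace X]
    [SecondCountableTopology Y] [BorelSpace Y] {P : Y → EndFib N} {Q : X → EndFib N}
    {k : X → X → EndFib N} (h : C.IsSmoothingKernel P Q k) :
    ∃ ℓ, IsInvariantKernel n P ℓ ∧ C.IsEndKernel k ℓ := by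
  obtain ⟨ℓ, hℓ, ha⟩ := h.asymptotic
  refine ⟨ℓ, hℓ, h.smooth.continuous.stronglyMeasurable, hℓ.isDecayKernel, fun m => ?_, fun m => ?_⟩
  · obtain ⟨c, hc⟩ := h.decay m
    exact ⟨max c 0, le_max_right _ _, fun x x' => (hc x x').trans
      (mul_le_mul_of_nonneg_right (le_max_left _ _) (Real.exp_pos _).le)⟩
  · obtain ⟨c, hc⟩ := ha m
    refine ⟨max c 0, le_max_right _ _, fun t ht t' ht' y z => (hc t ht t' ht' y z).trans ?_⟩
    gcongr
    exact le_max_left _ _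

/-- For fixed `s` the error `e^{max(t+s, t)}` vanishes as `t → -∞`. The hypothesis asks for no decay
in `|t - t'|`, so it applies to composed kernels as well. -/
theorem tendsto_indicial {k : X → X → EndFib N} {s : ℝ} {y z : Y} {A : EndFib N} {c : ℝ}
    (h : ∀ t < 0, ∀ t' < 0, t - t' = s → ‖k (C.incl (t, y)) (C.incl (t', z)) - A‖
      ≤ c * Real.exp (max t t')) :
    C.indicialKernel k s y z = A := by
  refine Tendsto.limUnder_eq ?_
  rw [tendsto_iff_norm_sub_tendsto_zero]
  refine squeeze_zero' (g := fun t : ℝ => c * Real.exp (max (t + s) t))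
    (Eventually.of_forall fun t => norm_nonneg _) ?_ ?_
  · filter_upwards [eventually_lt_atBot (min 0 (-s))] with t ht
    have h1 : t < 0 := ht.trans_le (min_le_left _ _)
    have h2 : t < -s := ht.trans_le (min_le_right _ _)
    exact h (t + s) (by linarith) t h1 (by ring)
  · have : Tendsto (fun t : ℝ => max (t + s) t) atBot atBot := by
      refine tendsto_atBot_mono (fun t => ?_) (tendsto_atBot_add_const_right atBot |s| tendsto_id)
      exact max_le (by simpa using le_abs_self s) (by simp)
    simpa using (Real.tendsto_exp_atBot.comp this).const_mul c

theorem IsEndKernel.indicialKernel_eq {k : X → X → EndFib N} {ℓ : ℝ → Y → Y → EndFib N}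
    (h : C.IsEndKernel k ℓ) : C.indicialKernel k = ℓ := by
  obtain ⟨c, -, hc⟩ := h.asymptotic 0
  funext s y z
  refine tendsto_indicial (c := c) fun t ht t' ht' hs => ?_
  have := hc t ht t' ht' y z
  rw [hs] at this
  simpa using this

variable [BorelSpace X] [BorelSpace Y] [SecondCountableTopology Y]

variable (C) in
theorem integral_eq {E : Type*} [NormedAddCommGroup E] [NormedSpace ℝ E] {h : X → E}
    (hm : StronglyMeasurable h) (hi : Integrable h μ) :
    ∫ x, h x ∂μ = ∫ x in C.truncation 0, h x ∂μ +
      ∫ p in Iio 0 ×ˢ univ, h (C.endMap p) ∂((volume : Measure ℝ).prod ν) := by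
  rw [← integral_map C.measurable_endMap.aemeasurable hm.aestronglyMeasurable,
    ← C.restrict_compl_truncation_zero, integral_add_compl (C.measurableSet_truncation le_rfl) hi]

variable (C) in
theorem setIntegral_truncation {E : Type*} [NormedAddCommGroup E] [NormedSpace ℝ E] {h : X → E}
    (hm : StronglyMeasurable h) {r : ℝ} (hr : 0 ≤ r) (hi : IntegrableOn h (C.truncation r) μ) :
    ∫ x in C.truncation r, h x ∂μ = ∫ x in C.truncation 0, h x ∂μ +
      ∫ p in Ico (-r) 0 ×ˢ univ, h (C.endMap p) ∂((volume : Measure ℝ).prod ν) := by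
  rw [IntegrableOn, C.restrict_truncation hr, integrable_add_measure] at hi
  rw [C.restrict_truncation hr, integral_add_measure hi.1 hi.2,
    integral_map C.measurable_endMap.aemeasurable hm.aestronglyMeasurable]

variable (C) in
theorem setIntegral_compl_truncation {E : Type*} [NormedAddCommGroup E] [NormedSpace ℝ E]
    {h : X → E} (hm : StronglyMeasurable h) {r : ℝ} (hr : 0 ≤ r) :
    ∫ x in (C.truncation r)ᶜ, h x ∂μ =
      ∫ p in Iio (-r) ×ˢ univ, h (C.endMap p) ∂((volume : Measure ℝ).prod ν) := by
  rw [C.restrict_compl_truncation hr,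
    integral_map C.measurable_endMap.aemeasurable hm.aestronglyMeasurable]

variable [IsFiniteMeasure ν] [IsLocallyFiniteMeasure μ]

variable (C) in
-- The core has finite measure and there the integrand is at most `1`; on the end it is a translate
-- of `e^{-|t|}`. The bound does not depend on `a`, which makes the later integrals uniform in the
-- base point.
theorem integrable_exp_endCoord (a : ℝ) :
    Integrable (fun x => Real.exp (-|C.endCoord x - a|)) μ ∧
      ∫ x, Real.exp (-|C.endCoord x - a|) ∂μ ≤ μ.real (C.truncation 0) +
        ∫ p : ℝ × Y, Real.exp (-|p.1|) ∂((volume : Measure ℝ).prod ν) := by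
  have hfin := C.isFiniteMeasure_core
  have hm : StronglyMeasurable (fun x => Real.exp (-|C.endCoord x - a|)) := by
    have := C.measurable_endCoord
    exact Measurable.stronglyMeasurable (by fun_prop)
  have hU : MeasurableSet (Iio (0 : ℝ) ×ˢ (univ : Set Y)) := measurableSet_Iio.prod .univ
  have h1 : IntegrableOn (fun x => Real.exp (-|C.endCoord x - a|)) (C.truncation 0) μ :=
    Integrable.of_bound hm.aestronglyMeasurable 1 (Eventually.of_forall fun x => by
      rw [Real.norm_of_nonneg (Real.exp_pos _).le]
      exact Real.exp_le_one_iff.2 (by simp))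
  have hcongr : ∀ p ∈ Iio (0 : ℝ) ×ˢ (univ : Set Y),
      Real.exp (-|C.endCoord (C.endMap p) - a|) = Real.exp (-|p.1 - a|) := by
    intro p hp
    rw [C.endCoord_endMap hp.1]
  have h2 : IntegrableOn (fun p : ℝ × Y => Real.exp (-|C.endCoord (C.endMap p) - a|))
      (Iio 0 ×ˢ univ) ((volume : Measure ℝ).prod ν) :=
    (integrable_exp_sub a).integrableOn.congr_fun (fun p hp => (hcongr p hp).symm) hU
  have hint : Integrable (fun x => Real.exp (-|C.endCoord x - a|)) μ := by
    rw [← integrableOn_univ, ← union_compl_self (C.truncation 0), integrableOn_union]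
    refine ⟨h1, ?_⟩
    rw [IntegrableOn, C.restrict_compl_truncation_zero,
      integrable_map_measure hm.aestronglyMeasurable C.measurable_endMap.aemeasurable]
    exact h2
  refine ⟨hint, ?_⟩
  rw [C.integral_eq hm hint]
  gcongr
  · calc ∫ x in C.truncation 0, Real.exp (-|C.endCoord x - a|) ∂μ
        ≤ ∫ _ in C.truncation 0, (1 : ℝ) ∂μ := by
          refine integral_mono h1 (integrable_const _) fun x => ?_
          exact Real.exp_le_one_iff.2 (by simp)
      _ = _ := by simp
  · rw [setIntegral_congr_fun hU hcongr, ← integral_exp_sub a]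
    exact setIntegral_le_integral (integrable_exp_sub a)
      (Eventually.of_forall fun p => (Real.exp_pos _).le)

variable {k k' : X → X → EndFib N} {ℓ ℓ' : ℝ → Y → Y → EndFib N}

omit [BorelSpace X] [BorelSpace Y] [SecondCountableTopology Y] [IsFiniteMeasure ν]
  [IsLocallyFiniteMeasure μ] in
theorem IsEndKernel.stronglyMeasurable_comp (h : C.IsEndKernel k ℓ) {β : Type*}
    [MeasurableSpace β] {f g : β → X} (hf : Measurable f) (hg : Measurable g) :
    StronglyMeasurable fun b => k (f b) (g b) :=
  h.stronglyMeasurable.comp_measurable (hf.prodMk hg)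

omit [BorelSpace X] [BorelSpace Y] [SecondCountableTopology Y] [IsFiniteMeasure ν]
  [IsLocallyFiniteMeasure μ] in
theorem IsEndKernel.norm_mul_le (h : C.IsEndKernel k ℓ) (h' : C.IsEndKernel k' ℓ') (m : ℕ) :
    ∃ c : ℝ, 0 ≤ c ∧ ∀ x w w' z, ‖k x w * k' w' z‖ ≤
      c * Real.exp (-(m * |C.endCoord x - C.endCoord w|)) := by
  obtain ⟨c, hc0, hc⟩ := h.decay m
  obtain ⟨c', hc0', hc'⟩ := h'.decay 0
  simp only [Nat.cast_zero, zero_mul, neg_zero, Real.exp_zero, mul_one] at hc'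
  refine ⟨c * c', by positivity, fun x w w' z => (_root_.norm_mul_le _ _).trans ?_⟩
  calc _ ≤ (c * Real.exp (-(m * |C.endCoord x - C.endCoord w|))) * c' := by
        gcongr
        · exact hc _ _
        · exact hc' _ _
    _ = _ := by ring

theorem IsEndKernel.integrable_mul (h : C.IsEndKernel k ℓ) (h' : C.IsEndKernel k' ℓ') (x z : X) :
    Integrable (fun w => k x w * k' w z) μ := by
  obtain ⟨c, -, hc⟩ := h.norm_mul_le h' 1
  refine ((C.integrable_exp_endCoord (C.endCoord x)).1.const_mul c).mono'
    ((h.stronglyMeasurable_comp (f := fun _ => x) (g := fun w => w) measurable_const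
      measurable_id).mul (h'.stronglyMeasurable_comp (f := fun w => w) (g := fun _ => z)
      measurable_id measurable_const)).aestronglyMeasurable (Eventually.of_forall fun w => ?_)
  rw [abs_sub_comm]
  simpa using hc x w w z

theorem IsEndKernel.norm_comp_le (h : C.IsEndKernel k ℓ) (h' : C.IsEndKernel k' ℓ') :
    ∃ B : ℝ, ∀ x z, ‖comp μ k k' x z‖ ≤ B := by
  obtain ⟨c, hc0, hc⟩ := h.norm_mul_le h' 1
  refine ⟨c * (μ.real (C.truncation 0) +
        ∫ p : ℝ × Y, Real.exp (-|p.1|) ∂((volume : Measure ℝ).prod ν)), fun x z => ?_⟩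
  obtain ⟨h1, h2⟩ := C.integrable_exp_endCoord (C.endCoord x)
  refine (norm_integral_le_of_norm_le (h1.const_mul c) (Eventually.of_forall fun w => ?_)).trans ?_
  · rw [abs_sub_comm]
    simpa using hc x w w z
  · rw [integral_const_mul]
    gcongr

omit [BorelSpace Y] in
theorem conv_eq_integral (s t : ℝ) (y z : Y) : conv ν ℓ ℓ' (s - t) y z =
    ∫ p : ℝ × Y, ℓ (s - p.1) y p.2 * ℓ' (p.1 - t) p.2 z ∂((volume : Measure ℝ).prod ν) := by
  rw [conv, ← (measurePreserving_cylShift ν t).integral_comp']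
  simp only [cylShift_apply, sub_sub_sub_cancel_right]

end CylindricalEnd

/-! ### Composition along the end and existence of the regularized trace -/

namespace CylindricalEnd

variable {n N : ℕ} {Y X : Type*} [TopologicalSpace Y] [TopologicalSpace X]
  [ChartedSpace (EuclideanSpace ℝ (Fin n)) Y]
  [ChartedSpace (EuclideanSpace ℝ (Fin (n + 1))) X]
  [MeasurableSpace Y] [MeasurableSpace X] {ν : Measure Y} {μ : Measure X}
  {C : CylindricalEnd n ν μ} {k k' : X → X → EndFib N} {ℓ ℓ' : ℝ → Y → Y → EndFib N}

/-- Along the end, the integrand of the product of two kernels is close to the one of the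
convolution of their indicial kernels. -/
theorem IsEndKernel.norm_indicator_mul_sub_le (h : C.IsEndKernel k ℓ) (h' : C.IsEndKernel k' ℓ') :
    ∃ c : ℝ, 0 ≤ c ∧ ∀ t < 0, ∀ t' < 0, ∀ y z, ∀ p : ℝ × Y,
      ‖(Iio 0 ×ˢ univ).indicator (fun p => k (C.incl (t, y)) (C.endMap p) *
          k' (C.endMap p) (C.incl (t', z))) p - ℓ (t - p.1) y p.2 * ℓ' (p.1 - t') p.2 z‖ ≤
        c * Real.exp (max t t') * Real.exp (-|p.1 - t|) := by
  obtain ⟨a, ha0, ha⟩ := h.asymptotic 2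
  obtain ⟨a', ha0', ha'⟩ := h'.asymptotic 0
  obtain ⟨b', hb0', hb'⟩ := h'.decay 0
  obtain ⟨d, hd0, hd⟩ := h.isDecayKernel.exists_bound 2
  obtain ⟨d', hd0', hd'⟩ := h'.isDecayKernel.exists_bound 0
  simp only [Nat.cast_zero, zero_mul, neg_zero, Real.exp_zero, mul_one, Nat.cast_ofNat]
    at ha ha' hb' hd hd'
  refine ⟨a * b' + d * a' + d * d', by positivity, fun t ht t' ht' y z p => ?_⟩
  have e0 : |p.1 - t| = |t - p.1| := abs_sub_comm _ _
  have e1 := neg_abs_le (t - p.1)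
  have e2 : t ≤ max t t' := le_max_left _ _
  have e3 : t' ≤ max t t' := le_max_right _ _
  have e4 := abs_nonneg (t - p.1)
  -- One of the two orders of decay replaces the exponent `x` by `max t t'`; the other remains to
  -- make the estimate integrable in `p`.
  have key : ∀ x : ℝ, x ≤ max t t' + |t - p.1| → Real.exp x * Real.exp (-(2 * |t - p.1|)) ≤
      Real.exp (max t t') * Real.exp (-|p.1 - t|) := by
    intro x hx
    rw [← Real.exp_add, ← Real.exp_add, e0]
    apply Real.exp_le_exp.2
    linarith
  by_cases hp : p.1 < 0
  · rw [indicator_of_mem (by simpa using hp), C.endMap_of_nonpos hp.le]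
    have k1 : ‖k (C.incl (t, y)) (C.incl p) - ℓ (t - p.1) y p.2‖ ≤ _ := ha t ht p.1 hp y p.2
    have k2 : ‖k' (C.incl p) (C.incl (t', z)) - ℓ' (p.1 - t') p.2 z‖ ≤ _ :=
      ha' p.1 hp t' ht' p.2 z
    rw [show k (C.incl (t, y)) (C.incl p) * k' (C.incl p) (C.incl (t', z)) -
        ℓ (t - p.1) y p.2 * ℓ' (p.1 - t') p.2 z =
      (k (C.incl (t, y)) (C.incl p) - ℓ (t - p.1) y p.2) * k' (C.incl p) (C.incl (t', z)) +
        ℓ (t - p.1) y p.2 * (k' (C.incl p) (C.incl (t', z)) - ℓ' (p.1 - t') p.2 z) by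
        rw [sub_mul, mul_sub]; abel]
    calc _ ≤ ‖k (C.incl (t, y)) (C.incl p) - ℓ (t - p.1) y p.2‖ *
            ‖k' (C.incl p) (C.incl (t', z))‖ +
          ‖ℓ (t - p.1) y p.2‖ * ‖k' (C.incl p) (C.incl (t', z)) - ℓ' (p.1 - t') p.2 z‖ :=
          (norm_add_le _ _).trans (add_le_add (_root_.norm_mul_le _ _) (_root_.norm_mul_le _ _))
      _ ≤ (a * Real.exp (max t p.1) * Real.exp (-(2 * |t - p.1|))) * b' +
          (d * Real.exp (-(2 * |t - p.1|))) * (a' * Real.exp (max p.1 t')) := by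
          gcongr
          · exact hb' _ _
          · exact hd _ _ _
      _ = a * b' * (Real.exp (max t p.1) * Real.exp (-(2 * |t - p.1|))) +
          d * a' * (Real.exp (max p.1 t') * Real.exp (-(2 * |t - p.1|))) + d * d' * 0 := by ring
      _ ≤ a * b' * (Real.exp (max t t') * Real.exp (-|p.1 - t|)) +
          d * a' * (Real.exp (max t t') * Real.exp (-|p.1 - t|)) +
          d * d' * (Real.exp (max t t') * Real.exp (-|p.1 - t|)) := by
          gcongr a * b' * ?_ + d * a' * ?_ + d * d' * ?_
          · exact key _ (max_le (by linarith) (by linarith))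
          · exact key _ (max_le (by linarith) (by linarith))
          · positivity
      _ = _ := by ring
  · rw [indicator_of_notMem (by simpa using hp), zero_sub, norm_neg]
    push Not at hp
    -- Only the tail of the convolution over `p ≥ 0` is left; since `t < 0`, the distance `|t - p|`
    -- is at least `-t`, and decay in it gives `e^t`.
    have e5 : |t - p.1| = p.1 - t := by rw [abs_of_nonpos (by linarith)]; ring
    calc _ ≤ ‖ℓ (t - p.1) y p.2‖ * ‖ℓ' (p.1 - t') p.2 z‖ := _root_.norm_mul_le _ _
      _ ≤ (d * Real.exp (-(2 * |t - p.1|))) * d' := by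
          gcongr
          · exact hd _ _ _
          · exact hd' _ _ _
      _ = a * b' * 0 + d * a' * 0 + d * d' * (Real.exp 0 * Real.exp (-(2 * |t - p.1|))) := by
          rw [Real.exp_zero]; ring
      _ ≤ a * b' * (Real.exp (max t t') * Real.exp (-|p.1 - t|)) +
          d * a' * (Real.exp (max t t') * Real.exp (-|p.1 - t|)) +
          d * d' * (Real.exp (max t t') * Real.exp (-|p.1 - t|)) := by
          gcongr a * b' * ?_ + d * a' * ?_ + d * d' * ?_
          · positivity
          · positivity
          · exact key _ (by linarith)
      _ = _ := by ring

variable [BorelSpace X] [BorelSpace Y] [SecondCountableTopology Y]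
  [IsFiniteMeasure ν] [IsLocallyFiniteMeasure μ]

omit [IsFiniteMeasure ν] [IsLocallyFiniteMeasure μ] in
variable (C) in
theorem integrable_indicator_comp_endMap {E : Type*} [NormedAddCommGroup E] {f : X → E}
    (hm : StronglyMeasurable f) (hi : Integrable f μ) :
    Integrable ((Iio 0 ×ˢ univ).indicator fun p => f (C.endMap p))
      ((volume : Measure ℝ).prod ν) := by
  have h1 := hi.restrict (s := (C.truncation 0)ᶜ)
  rw [C.restrict_compl_truncation_zero, integrable_map_measure hm.aestronglyMeasurable
    C.measurable_endMap.aemeasurable] at h1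
  exact IntegrableOn.integrable_indicator h1 (measurableSet_Iio.prod .univ)

/-- The integral over `X` splits into core and end. The core is at distance `|t|` from the first
point and contributes `O(e^t)`; on the end the integrand is compared with that of the convolution.
-/
theorem IsEndKernel.norm_comp_sub_conv_le (h : C.IsEndKernel k ℓ) (h' : C.IsEndKernel k' ℓ') :
    ∃ c : ℝ, ∀ t < 0, ∀ t' < 0, ∀ y z,
      ‖comp μ k k' (C.incl (t, y)) (C.incl (t', z)) - conv ν ℓ ℓ' (t - t') y z‖ ≤
        c * Real.exp (max t t') := by
  have hfin := C.isFiniteMeasure_core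
  obtain ⟨a, ha0, ha⟩ := h.norm_mul_le h' 1
  obtain ⟨b, hb0, hb⟩ := h.norm_indicator_mul_sub_le h'
  set B := ∫ p : ℝ × Y, Real.exp (-|p.1|) ∂((volume : Measure ℝ).prod ν) with hB
  refine ⟨a * (μ.restrict (C.truncation 0)).real univ + b * B, fun t ht t' ht' y z => ?_⟩
  have hU : MeasurableSet (Iio (0 : ℝ) ×ˢ (univ : Set Y)) := measurableSet_Iio.prod .univ
  have hm : StronglyMeasurable fun w => k (C.incl (t, y)) w * k' w (C.incl (t', z)) :=
    (h.stronglyMeasurable_comp (f := fun _ => C.incl (t, y)) (g := fun w => w) measurable_const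
      measurable_id).mul (h'.stronglyMeasurable_comp (f := fun w => w)
      (g := fun _ => C.incl (t', z)) measurable_id measurable_const)
  have hi := h.integrable_mul (μ := μ) h' (C.incl (t, y)) (C.incl (t', z))
  have hi2 : Integrable (fun p : ℝ × Y => ℓ (t - p.1) y p.2 * ℓ' (p.1 - t') p.2 z)
      ((volume : Measure ℝ).prod ν) := by
    have := (measurePreserving_cylShift ν t').integrable_comp_of_integrable
      (integrable_conv (ν := ν) h.isDecayKernel h'.isDecayKernel (t - t') y z)
    simpa [Function.comp_def, cylShift_apply] using this
  have hi1 : Integrable ((Iio 0 ×ˢ univ).indicator (fun p => k (C.incl (t, y)) (C.endMap p) *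
          k' (C.endMap p) (C.incl (t', z)))) ((volume : Measure ℝ).prod ν) :=
    C.integrable_indicator_comp_endMap hm hi
  rw [comp, C.integral_eq hm hi, conv_eq_integral, add_sub_assoc, ← integral_indicator hU,
    ← integral_sub hi1 hi2, add_mul]
  refine (norm_add_le _ _).trans (add_le_add ?_ ?_)
  · refine (norm_setIntegral_le_of_norm_le_const_ae' (C := a * Real.exp (max t t')) ?_ ?_).trans
      (le_of_eq ?_)
    · simpa using hfin.measure_univ_lt_top
    · refine Eventually.of_forall fun w hw => (ha _ w w _).trans ?_
      rw [C.endCoord_incl ht, C.endCoord_eq_zero_of_mem hw]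
      gcongr
      simp [abs_of_neg ht]
    · simp; ring
  · refine (norm_integral_le_of_norm_le ((integrable_exp_sub t).const_mul (b * Real.exp (max t t')))
      (Eventually.of_forall fun p => hb t ht t' ht' y z p)).trans (le_of_eq ?_)
    rw [integral_const_mul, integral_exp_sub]
    ring

theorem IsEndKernel.indicialKernel_comp (h : C.IsEndKernel k ℓ) (h' : C.IsEndKernel k' ℓ') :
    C.indicialKernel (comp μ k k') = conv ν ℓ ℓ' := by
  obtain ⟨c, hc⟩ := h.norm_comp_sub_conv_le h'
  funext s y z
  exact tendsto_indicial (c := c) fun t ht t' ht' hs => hs ▸ hc t ht t' ht' y z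

variable (C) in
theorem isFiniteMeasure_restrict_truncation {r : ℝ} (hr : 0 ≤ r) :
    IsFiniteMeasure (μ.restrict (C.truncation r)) := by
  have hfin := C.isFiniteMeasure_core
  have hfin' : IsFiniteMeasure (((volume : Measure ℝ).prod ν).restrict (Ico (-r) 0 ×ˢ univ)) := by
    refine ⟨?_⟩
    rw [Measure.restrict_apply_univ, Measure.prod_prod]
    exact ENNReal.mul_lt_top measure_Ico_lt_top (measure_lt_top _ _)
  rw [C.restrict_truncation hr]
  infer_instance

/-- A bounded function on `X` which is exponentially asymptotic to a function on `Y` along the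
end has a regularized integral. -/
theorem exists_tendsto_setIntegral_truncation {f : X → ℂ} {g : Y → ℂ} (hf : StronglyMeasurable f)
    (hg : StronglyMeasurable g) {a b c : ℝ} (ha : ∀ x, ‖f x‖ ≤ a) (hb : ∀ y, ‖g y‖ ≤ b)
    (hc : ∀ t < 0, ∀ y, ‖f (C.incl (t, y)) - g y‖ ≤ c * Real.exp t) :
    ∃ L, Tendsto (fun r : ℝ => ∫ x in C.truncation r, f x ∂μ - r * ∫ y, g y ∂ν) atTop (𝓝 L) := by
  have hU : ⋃ r : ℝ, Ico (-r) 0 ×ˢ (univ : Set Y) = Iio 0 ×ˢ univ := by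
    ext p
    simp only [mem_iUnion, mem_prod, mem_Ico, mem_univ, and_true, mem_Iio, exists_and_right]
    exact and_iff_right ⟨-p.1, by simp⟩
  -- The counterterm `λ ∫ g` is the integral of `g` over `[-λ, 0) × Y`. After subtraction the
  -- integrand is `O(e^t)`, integrable over the whole end, so the increasing truncations converge.
  have hi : IntegrableOn (fun p : ℝ × Y => f (C.endMap p) - g p.2)
      (⋃ r : ℝ, Ico (-r) 0 ×ˢ (univ : Set Y)) ((volume : Measure ℝ).prod ν) := by
    rw [hU]
    refine ((integrable_comp_fst integrable_exp_neg_abs).const_mul c).integrableOn.mono'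
      ((hf.comp_measurable C.measurable_endMap).sub
        (hg.comp_measurable measurable_snd)).aestronglyMeasurable ?_
    refine (ae_restrict_iff' (measurableSet_Iio.prod .univ)).2 (Eventually.of_forall fun p hp => ?_)
    have hp1 : p.1 < 0 := hp.1
    rw [C.endMap_of_nonpos hp1.le, abs_of_neg hp1, neg_neg]
    exact hc p.1 hp1 p.2
  have hlim := tendsto_setIntegral_of_monotone (s := fun r : ℝ => Ico (-r) 0 ×ˢ (univ : Set Y))
    (fun r => measurableSet_Ico.prod .univ)
    (fun r r' hr => prod_mono (Ico_subset_Ico_left (neg_le_neg hr)) le_rfl) hi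
  refine ⟨_, (hlim.const_add (∫ x in C.truncation 0, f x ∂μ)).congr' ?_⟩
  filter_upwards [eventually_ge_atTop 0] with r hr
  have hfin' : IsFiniteMeasure (((volume : Measure ℝ).prod ν).restrict (Ico (-r) 0 ×ˢ univ)) := by
    refine ⟨?_⟩
    rw [Measure.restrict_apply_univ, Measure.prod_prod]
    exact ENNReal.mul_lt_top measure_Ico_lt_top (measure_lt_top _ _)
  have hfinr := C.isFiniteMeasure_restrict_truncation (μ := μ) hr
  rw [C.setIntegral_truncation hf hr
      (Integrable.of_bound hf.aestronglyMeasurable a (Eventually.of_forall ha)),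
    integral_sub (f := fun p => f (C.endMap p)) (g := fun p => g p.2)
      (Integrable.of_bound (hf.comp_measurable C.measurable_endMap).aestronglyMeasurable
      a (Eventually.of_forall fun _ => ha _)) (Integrable.of_bound
      (hg.comp_measurable measurable_snd).aestronglyMeasurable b
      (Eventually.of_forall fun _ => hb _)), ← Measure.prod_restrict, Measure.restrict_univ]
  have e : ∫ p, g p.2 ∂((volume.restrict (Ico (-r) 0)).prod ν) = r * ∫ y, g y ∂ν := by
    have := integral_prod_mul (μ := volume.restrict (Ico (-r) 0)) (ν := ν) (fun _ => (1 : ℂ)) g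
    simp only [one_mul] at this
    rw [this]
    simp [Measure.real, hr]
  rw [e]
  ring

theorem IsEndKernel.exists_tendsto_regularizedIntegral (h : C.IsEndKernel k ℓ) :
    ∃ L, Tendsto (C.regularizedIntegral k) atTop (𝓝 L) := by
  obtain ⟨a, -, ha⟩ := h.decay 0
  obtain ⟨b, -, hb⟩ := h.isDecayKernel.exists_bound 0
  obtain ⟨c, -, hc⟩ := h.asymptotic 0
  unfold regularizedIntegral
  rw [h.indicialKernel_eq]
  refine exists_tendsto_setIntegral_truncation (a := ‖fibTrCLM N‖ * a) (b := ‖fibTrCLM N‖ * b)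
    (c := ‖fibTrCLM N‖ * c)
    (stronglyMeasurable_fibTr (h.stronglyMeasurable_comp (f := fun x => x) (g := fun x => x)
      measurable_id measurable_id))
    (stronglyMeasurable_fibTr (h.isDecayKernel.stronglyMeasurable_comp (f := fun _ => 0)
      (g := fun y => y) (g' := fun y => y) measurable_const measurable_id measurable_id))
    (fun x => (norm_fibTr_le _).trans ?_) (fun y => (norm_fibTr_le _).trans ?_)
    fun t ht y => ?_
  · gcongr
    simpa using ha x x
  · gcongr
    simpa using hb 0 y y
  · rw [← fibTrCLM_apply, ← fibTrCLM_apply, ← map_sub, mul_assoc]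
    refine ((fibTrCLM N).le_opNorm _).trans ?_
    gcongr
    simpa using hc t ht t ht y y

omit [BorelSpace X] [BorelSpace Y] [SecondCountableTopology Y] [IsFiniteMeasure ν]
  [IsLocallyFiniteMeasure μ] in
theorem IsEndKernel.stronglyMeasurable_fibTr_comp [SFinite μ] (h : C.IsEndKernel k ℓ)
    (h' : C.IsEndKernel k' ℓ') : StronglyMeasurable fun x => fibTr (comp μ k k' x x) := by
  have : StronglyMeasurable fun p : X × X => k p.1 p.2 * k' p.2 p.1 :=
    (h.stronglyMeasurable_comp measurable_fst measurable_snd).mul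
      (h'.stronglyMeasurable_comp measurable_snd measurable_fst)
  exact stronglyMeasurable_fibTr this.integral_prod_right'

theorem IsEndKernel.exists_tendsto_regularizedIntegral_comp [SFinite μ] (h : C.IsEndKernel k ℓ)
    (h' : C.IsEndKernel k' ℓ') :
    ∃ L, Tendsto (C.regularizedIntegral (comp μ k k')) atTop (𝓝 L) := by
  obtain ⟨a, ha⟩ := h.norm_comp_le (μ := μ) h'
  have hconv := h.isDecayKernel.conv (ν := ν) h'.isDecayKernel
  obtain ⟨b, -, hb⟩ := hconv.exists_bound 0
  obtain ⟨c, hc⟩ := h.norm_comp_sub_conv_le h'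
  unfold regularizedIntegral
  rw [h.indicialKernel_comp h']
  refine exists_tendsto_setIntegral_truncation (a := ‖fibTrCLM N‖ * a) (b := ‖fibTrCLM N‖ * b)
    (c := ‖fibTrCLM N‖ * c) (h.stronglyMeasurable_fibTr_comp h')
    (stronglyMeasurable_fibTr (hconv.stronglyMeasurable_comp (f := fun _ => 0)
      (g := fun y => y) (g' := fun y => y) measurable_const measurable_id measurable_id))
    (fun x => (norm_fibTr_le _).trans ?_) (fun y => (norm_fibTr_le _).trans ?_)
    fun t ht y => ?_
  · gcongr
    exact ha x x
  · gcongr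
    simpa using hb 0 y y
  · rw [← fibTrCLM_apply, ← fibTrCLM_apply, ← map_sub, mul_assoc]
    refine ((fibTrCLM N).le_opNorm _).trans ?_
    gcongr
    simpa using hc t ht t ht y y

end CylindricalEnd

/-! ### The moment pairing as an integral over a quadrant -/

section Cylinder

variable {Y : Type*} [MeasurableSpace Y] {N : ℕ} {ℓ ℓ' : ℝ → Y → Y → EndFib N}
  {ν : Measure Y} [IsFiniteMeasure ν]

theorem integral_fibTr_conv (h : IsDecayKernel ℓ) (h' : IsDecayKernel ℓ') :
    ∫ y, fibTr (conv ν ℓ ℓ' 0 y y) ∂ν = ∫ s : ℝ, correlation ν ℓ' ℓ s := by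
  have hm : StronglyMeasurable fun p : Y × (ℝ × Y) =>
      fibTr (ℓ (0 - p.2.1) p.1 p.2.2 * ℓ' p.2.1 p.2.2 p.1) :=
    stronglyMeasurable_fibTr ((h.stronglyMeasurable_comp (f := fun p : Y × (ℝ × Y) => 0 - p.2.1)
      (g := fun p => p.1) (g' := fun p => p.2.2) (by fun_prop) (by fun_prop) (by fun_prop)).mul
      (h'.stronglyMeasurable_comp (f := fun p : Y × (ℝ × Y) => p.2.1)
      (g := fun p => p.2.2) (g' := fun p => p.1) (by fun_prop) (by fun_prop) (by fun_prop)))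
  have hint : Integrable (fun p : Y × (ℝ × Y) =>
      fibTr (ℓ (0 - p.2.1) p.1 p.2.2 * ℓ' p.2.1 p.2.2 p.1))
      (ν.prod ((volume : Measure ℝ).prod ν)) := by
    obtain ⟨c, -, hc⟩ := norm_fibTr_mul_le_exp h h' 1
    refine (((integrable_comp_fst (ν := ν) integrable_exp_neg_abs).comp_snd ν).const_mul c).mono'
      hm.aestronglyMeasurable (Eventually.of_forall fun p => ?_)
    simpa using hc (0 - p.2.1) p.1 p.2.2 p.2.2 p.1
  have e : ∀ y, fibTr (conv ν ℓ ℓ' 0 y y) = ∫ q : ℝ × Y,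
      fibTr (ℓ (0 - q.1) y q.2 * ℓ' q.1 q.2 y) ∂((volume : Measure ℝ).prod ν) :=
    fun y => (integral_fibTr (integrable_conv h h' 0 y y)).symm
  simp only [e]
  rw [integral_integral_swap hint, integral_prod _ hint.integral_prod_right]
  simp only [correlation, zero_sub, fibTr_mul_comm (ℓ _ _ _)]

/-- Both sides are integrals of correlations that are reflections of each other. Hence `kk'` and
`k'k` have the same counterterm. -/
theorem integral_fibTr_conv_comm (h : IsDecayKernel ℓ) (h' : IsDecayKernel ℓ') :
    ∫ y, fibTr (conv ν ℓ ℓ' 0 y y) ∂ν = ∫ y, fibTr (conv ν ℓ' ℓ 0 y y) ∂ν := by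
  rw [integral_fibTr_conv h h', integral_fibTr_conv h' h, ← integral_neg_eq_self]
  simp only [correlation_neg h' h]

omit [IsFiniteMeasure ν] in
theorem ae_fst_ne_zero [SFinite ν] : ∀ᵐ p ∂((volume : Measure ℝ).prod ν), p.1 ≠ 0 :=
  Measure.quasiMeasurePreserving_fst.ae (compl_mem_ae_iff.2 (measure_singleton (0 : ℝ)))

/-- Up to points where `W` vanishes, `S` and its transpose partition the product, so folding along
the swap recovers the full integral. -/
theorem setIntegral_swap_add {α : Type*} [MeasurableSpace α] {m : Measure α} [SFinite m]
    {W : α × α → ℂ} (hW : Integrable W (m.prod m)) {S : Set (α × α)} (hS : MeasurableSet S)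
    (hd : Disjoint (Prod.swap ⁻¹' S) S)
    (h0 : ∀ᵐ x ∂(m.prod m), x ∉ Prod.swap ⁻¹' S ∪ S → W x = 0) :
    ∫ x in S, (W x.swap + W x) ∂(m.prod m) = ∫ x, W x ∂(m.prod m) := by
  have hsw : MeasurePreserving Prod.swap (m.prod m) (m.prod m) := Measure.measurePreserving_swap
  have e : ∫ x in S, W x.swap ∂(m.prod m) = ∫ x in Prod.swap ⁻¹' S, W x ∂(m.prod m) := by
    rw [← hsw.setIntegral_preimage_emb MeasurableEquiv.prodComm.measurableEmbedding W]
    rfl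
  rw [integral_add (f := fun x => W x.swap) (hsw.integrable_comp_of_integrable hW).restrict
    hW.restrict, e, ← setIntegral_union hd hS hW.integrableOn hW.integrableOn,
    setIntegral_eq_integral_of_ae_compl_eq_zero h0]

theorem chi_sub_chi_eq_zero {u s : ℝ} (hu : u ≠ 0) (h1 : 0 ≤ s → 0 ≤ u) (h2 : 0 ≤ u → 0 ≤ s)
    (hs : s ≠ 0) : chi u - chi s = 0 := by
  unfold chi
  rcases lt_or_gt_of_ne hu with h | h
  · have h3 : s ≤ 0 := not_lt.1 fun h3 => absurd (h1 h3.le) (not_le.2 h)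
    rw [if_pos h.le, if_pos h3, sub_self]
  · have h3 : 0 < s := lt_of_le_of_ne (h2 h.le) hs.symm
    rw [if_neg (not_le.2 h), if_neg (not_le.2 h3), sub_self]

/-- The moment pairing as an integral over the quadrant `p ≥ 0 > q`. -/
theorem integral_quadrant_eq_momentPairing (h : IsDecayKernel ℓ) (h' : IsDecayKernel ℓ') :
    ∫ x in (Ici 0 ×ˢ univ) ×ˢ (Iio 0 ×ˢ univ),
      (fibTr (ℓ (x.1.1 - x.2.1) x.1.2 x.2.2 * ℓ' (x.2.1 - x.1.1) x.2.2 x.1.2) -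
        fibTr (ℓ (x.2.1 - x.1.1) x.2.2 x.1.2 * ℓ' (x.1.1 - x.2.1) x.1.2 x.2.2))
      ∂(((volume : Measure ℝ).prod ν).prod ((volume : Measure ℝ).prod ν)) =
    momentPairing ν ℓ ℓ' := by
  have hSm : MeasurableSet ((Ici (0 : ℝ) ×ˢ (univ : Set Y)) ×ˢ (Iio (0 : ℝ) ×ˢ (univ : Set Y))) :=
    (measurableSet_Ici.prod .univ).prod (measurableSet_Iio.prod .univ)
  -- The cutoff `χ` counts `0` as negative while the quadrant counts it as nonnegative; the
  -- discrepancy is a null set.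
  have hne : ∀ᵐ x ∂(((volume : Measure ℝ).prod ν).prod ((volume : Measure ℝ).prod ν)),
      x.1.1 ≠ 0 ∧ x.2.1 ≠ 0 :=
    (Measure.quasiMeasurePreserving_fst.ae ae_fst_ne_zero).and
      (Measure.quasiMeasurePreserving_snd.ae ae_fst_ne_zero)
  rw [← integral_chi_sub_chi_smul h h', ← integral_prod (fun p : (ℝ × Y) × (ℝ × Y) =>
      (chi p.1.1 - chi p.2.1) •
      fibTr (ℓ (p.2.1 - p.1.1) p.2.2 p.1.2 * ℓ' (-(p.2.1 - p.1.1)) p.1.2 p.2.2))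
      (integrable_chi_sub_chi_smul h h'),
    ← setIntegral_swap_add (integrable_chi_sub_chi_smul h h') hSm]
  · refine setIntegral_congr_ae hSm ?_
    filter_upwards [hne] with x hx hxS
    have h1 : ¬ x.1.1 ≤ 0 := not_le.2 (lt_of_le_of_ne hxS.1.1 hx.1.symm)
    have h2 : x.2.1 ≤ 0 := le_of_lt hxS.2.1
    simp only [Prod.fst_swap, Prod.snd_swap, chi, if_neg h1, if_pos h2, neg_sub, sub_zero,
      zero_sub, one_smul, neg_smul]
    rw [sub_eq_add_neg]
  · refine Set.disjoint_left.2 fun x hx hx' => ?_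
    exact not_lt.2 (show (0 : ℝ) ≤ x.1.1 from hx'.1.1) (show x.1.1 < 0 from hx.2.1)
  · filter_upwards [hne] with x hx hxS
    simp only [mem_union, mem_preimage, mem_prod, Prod.fst_swap, Prod.snd_swap, mem_Ici,
      mem_Iio, mem_univ, and_true, not_or, not_and, not_lt] at hxS
    rw [chi_sub_chi_eq_zero hx.1 hxS.1 hxS.2 hx.2, zero_smul]

end Cylinder

/-! ### The commutator integrand and translation along the end -/

namespace CylindricalEnd

variable {n N : ℕ} {Y X : Type*} [TopologicalSpace Y] [TopologicalSpace X]
  [ChartedSpace (EuclideanSpace ℝ (Fin n)) Y]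
  [ChartedSpace (EuclideanSpace ℝ (Fin (n + 1))) X]
  [MeasurableSpace Y] [MeasurableSpace X] {ν : Measure Y} {μ : Measure X}
  {C : CylindricalEnd n ν μ} {k k' : X → X → EndFib N} {ℓ ℓ' : ℝ → Y → Y → EndFib N}

/-- The antisymmetric function `tr (k(x, w) k'(w, x)) - tr (k(w, x) k'(x, w))`. -/
def commTrace (k k' : X → X → EndFib N) (x w : X) : ℂ :=
  fibTr (k x w * k' w x) - fibTr (k w x * k' x w)

omit [TopologicalSpace X] [ChartedSpace (EuclideanSpace ℝ (Fin (n + 1))) X]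
  [MeasurableSpace X] in
theorem commTrace_swap (x w : X) : commTrace k k' w x = -commTrace k k' x w := by
  rw [commTrace, commTrace, neg_sub]

theorem IsEndKernel.stronglyMeasurable_commTrace (h : C.IsEndKernel k ℓ)
    (h' : C.IsEndKernel k' ℓ') : StronglyMeasurable (Function.uncurry (commTrace k k')) :=
  (stronglyMeasurable_fibTr ((h.stronglyMeasurable_comp measurable_fst measurable_snd).mul
    (h'.stronglyMeasurable_comp measurable_snd measurable_fst))).sub
  (stronglyMeasurable_fibTr ((h.stronglyMeasurable_comp measurable_snd measurable_fst).mul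
    (h'.stronglyMeasurable_comp measurable_fst measurable_snd)))

theorem IsEndKernel.norm_commTrace_le (h : C.IsEndKernel k ℓ) (h' : C.IsEndKernel k' ℓ') (m : ℕ) :
    ∃ c : ℝ, 0 ≤ c ∧ ∀ x w, ‖commTrace k k' x w‖ ≤
      c * Real.exp (-(m * |C.endCoord x - C.endCoord w|)) := by
  obtain ⟨c, hc0, hc⟩ := h.norm_mul_le h' m
  refine ⟨‖fibTrCLM N‖ * c + ‖fibTrCLM N‖ * c, by positivity, fun x w => ?_⟩
  refine (norm_sub_le _ _).trans ?_
  rw [add_mul, mul_assoc]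
  refine add_le_add ((norm_fibTr_le _).trans ?_) ((norm_fibTr_le _).trans ?_)
  · gcongr
    exact hc x w w x
  · gcongr
    rw [abs_sub_comm]
    exact hc w x x w

/-- Once both translated points lie on the end, the error is `O(e^{max(p, q) - r})`. -/
theorem IsEndKernel.tendsto_translate (h : C.IsEndKernel k ℓ) (p q : ℝ × Y) :
    Tendsto (fun r : ℝ => k (C.endMap (p.1 - r, p.2)) (C.endMap (q.1 - r, q.2))) atTop
      (𝓝 (ℓ (p.1 - q.1) p.2 q.2)) := by
  obtain ⟨c, -, hc⟩ := h.asymptotic 0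
  rw [tendsto_iff_norm_sub_tendsto_zero]
  refine squeeze_zero' (g := fun r : ℝ => c * Real.exp (max p.1 q.1 - r))
    (Eventually.of_forall fun r => norm_nonneg _) ?_ ?_
  · filter_upwards [eventually_gt_atTop p.1, eventually_gt_atTop q.1] with r h1 h2
    have := hc (p.1 - r) (by linarith) (q.1 - r) (by linarith) p.2 q.2
    rw [C.endMap_of_nonpos (by simpa using h1.le), C.endMap_of_nonpos (by simpa using h2.le)]
    simpa [max_sub_sub_right] using this
  · have : Tendsto (fun r : ℝ => max p.1 q.1 - r) atTop atBot :=
      by simpa only [sub_eq_add_neg] using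
        tendsto_atBot_add_const_left atTop (max p.1 q.1) tendsto_neg_atTop_atBot
    simpa using (Real.tendsto_exp_atBot.comp this).const_mul c

end CylindricalEnd

theorem integral_integral_eq_zero_of_antisymm {α : Type*} [MeasurableSpace α] {m : Measure α}
    [SFinite m] {f : α → α → ℂ} (hf : Integrable (Function.uncurry f) (m.prod m))
    (h : ∀ x y, f y x = -f x y) : ∫ x, ∫ y, f x y ∂m ∂m = 0 := by
  have e : ∫ y, ∫ x, f x y ∂m ∂m = -∫ x, ∫ y, f x y ∂m ∂m := by
    rw [← integral_neg]
    congr 1; funext y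
    rw [← integral_neg]
    congr 1; funext x
    exact h y x
  exact self_eq_neg.1 ((integral_integral_swap hf).trans e)

/-! ### The coboundary of the regularized trace -/

namespace CylindricalEnd

variable {n N : ℕ} {Y X : Type*} [TopologicalSpace Y] [TopologicalSpace X]
  [ChartedSpace (EuclideanSpace ℝ (Fin n)) Y]
  [ChartedSpace (EuclideanSpace ℝ (Fin (n + 1))) X]
  [MeasurableSpace Y] [MeasurableSpace X] {ν : Measure Y} {μ : Measure X}
  {C : CylindricalEnd n ν μ} {k k' : X → X → EndFib N} {ℓ ℓ' : ℝ → Y → Y → EndFib N}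
  [BorelSpace X] [BorelSpace Y] [SecondCountableTopology Y]
  [IsFiniteMeasure ν] [IsLocallyFiniteMeasure μ]

theorem IsEndKernel.integrable_commTrace (h : C.IsEndKernel k ℓ) (h' : C.IsEndKernel k' ℓ')
    (x : X) : Integrable (commTrace k k' x) μ := by
  obtain ⟨c, -, hc⟩ := h.norm_commTrace_le h' 1
  refine ((C.integrable_exp_endCoord (C.endCoord x)).1.const_mul c).mono'
    ((h.stronglyMeasurable_commTrace h').comp_measurable
      measurable_prodMk_left).aestronglyMeasurable (Eventually.of_forall fun w => ?_)
  rw [abs_sub_comm]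
  simpa [Function.uncurry] using hc x w

theorem IsEndKernel.exists_norm_setIntegral_commTrace_le (h : C.IsEndKernel k ℓ)
    (h' : C.IsEndKernel k' ℓ') :
    ∃ B : ℝ, 0 ≤ B ∧ ∀ x S, ‖∫ w in S, commTrace k k' x w ∂μ‖ ≤ B := by
  obtain ⟨c, hc0, hc⟩ := h.norm_commTrace_le h' 1
  set B := μ.real (C.truncation 0) +
        ∫ p : ℝ × Y, Real.exp (-|p.1|) ∂((volume : Measure ℝ).prod ν) with hB
  have hB0 : 0 ≤ B := add_nonneg measureReal_nonneg (integral_nonneg fun _ => (Real.exp_pos _).le)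
  refine ⟨c * B, by positivity, fun x S => ?_⟩
  obtain ⟨h1, h2⟩ := C.integrable_exp_endCoord (C.endCoord x)
  refine (norm_integral_le_of_norm_le (h1.const_mul c).restrict
    (Eventually.of_forall fun w => ?_)).trans ((setIntegral_le_integral (h1.const_mul c)
      (Eventually.of_forall fun w => ?_)).trans ?_)
  · rw [abs_sub_comm]
    simpa using hc x w
  · exact mul_nonneg hc0 (Real.exp_pos _).le
  · rw [integral_const_mul]
    gcongr

variable [SFinite μ]

omit [BorelSpace X] [BorelSpace Y] [SecondCountableTopology Y] [IsFiniteMeasure ν]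
  [IsLocallyFiniteMeasure μ] in
theorem IsEndKernel.stronglyMeasurable_setIntegral_commTrace (h : C.IsEndKernel k ℓ)
    (h' : C.IsEndKernel k' ℓ') (S : Set X) :
    StronglyMeasurable fun x => ∫ w in S, commTrace k k' x w ∂μ :=
  (h.stronglyMeasurable_commTrace h').integral_prod_right

/-- The counterterms cancel, and the difference of the traces at `(x, x)` is the integral of
`commTrace` over all `w`. Its part over `X_λ × X_λ` is zero by antisymmetry. -/
theorem IsEndKernel.regularizedIntegral_sub (h : C.IsEndKernel k ℓ) (h' : C.IsEndKernel k' ℓ')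
    {r : ℝ} (hr : 0 ≤ r) :
    C.regularizedIntegral (comp μ k k') r - C.regularizedIntegral (comp μ k' k) r =
      ∫ x in C.truncation r, ∫ w in (C.truncation r)ᶜ, commTrace k k' x w ∂μ ∂μ := by
  have hfin := C.isFiniteMeasure_restrict_truncation (μ := μ) hr
  obtain ⟨B, hB0, hB⟩ := h.exists_norm_setIntegral_commTrace_le (μ := μ) h'
  obtain ⟨b, hb⟩ := h.norm_comp_le (μ := μ) h'
  obtain ⟨b', hb'⟩ := h'.norm_comp_le (μ := μ) h
  obtain ⟨c, hc0, hc⟩ := h.norm_commTrace_le h' 0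
  simp only [Nat.cast_zero, zero_mul, neg_zero, Real.exp_zero, mul_one] at hc
  have hS := C.measurableSet_truncation hr
  have e1 : ∀ x, fibTr (comp μ k k' x x) - fibTr (comp μ k' k x x) =
      ∫ w in C.truncation r, commTrace k k' x w ∂μ +
        ∫ w in (C.truncation r)ᶜ, commTrace k k' x w ∂μ := by
    intro x
    rw [integral_add_compl hS (h.integrable_commTrace h' x), comp, comp,
      ← integral_fibTr (h.integrable_mul h' x x), ← integral_fibTr (h'.integrable_mul h x x),
      ← integral_sub (integrable_fibTr (h.integrable_mul h' x x))
        (integrable_fibTr (h'.integrable_mul h x x))]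
    simp only [commTrace, fibTr_mul_comm (k' _ _) (k _ _)]
  have e2 : ∫ x in C.truncation r, ∫ w in C.truncation r, commTrace k k' x w ∂μ ∂μ = 0 := by
    have hi : Integrable (Function.uncurry (commTrace k k'))
        ((μ.restrict (C.truncation r)).prod (μ.restrict (C.truncation r))) :=
      Integrable.of_bound (h.stronglyMeasurable_commTrace h').aestronglyMeasurable c
        (Eventually.of_forall fun p => hc p.1 p.2)
    exact integral_integral_eq_zero_of_antisymm hi commTrace_swap
  have i1 : Integrable (fun x => ∫ w in C.truncation r, commTrace k k' x w ∂μ)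
      (μ.restrict (C.truncation r)) :=
    Integrable.of_bound (h.stronglyMeasurable_setIntegral_commTrace h' _).aestronglyMeasurable B
      (Eventually.of_forall fun x => hB x _)
  have i2 : Integrable (fun x => ∫ w in (C.truncation r)ᶜ, commTrace k k' x w ∂μ)
      (μ.restrict (C.truncation r)) :=
    Integrable.of_bound (h.stronglyMeasurable_setIntegral_commTrace h' _).aestronglyMeasurable B
      (Eventually.of_forall fun x => hB x _)
  have j1 : Integrable (fun x => fibTr (comp μ k k' x x)) (μ.restrict (C.truncation r)) :=
    Integrable.of_bound (h.stronglyMeasurable_fibTr_comp h').aestronglyMeasurable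
      (‖fibTrCLM N‖ * b) (Eventually.of_forall fun x => (norm_fibTr_le _).trans (by
        gcongr
        exact hb x x))
  have j2 : Integrable (fun x => fibTr (comp μ k' k x x)) (μ.restrict (C.truncation r)) :=
    Integrable.of_bound (h'.stronglyMeasurable_fibTr_comp h).aestronglyMeasurable
      (‖fibTrCLM N‖ * b') (Eventually.of_forall fun x => (norm_fibTr_le _).trans (by
        gcongr
        exact hb' x x))
  rw [regularizedIntegral, regularizedIntegral, h.indicialKernel_comp h', h'.indicialKernel_comp h,
    integral_fibTr_conv_comm h.isDecayKernel h'.isDecayKernel, sub_sub_sub_cancel_right,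
    ← integral_sub j1 j2]
  simp only [e1]
  rw [integral_add i1 i2, e2, zero_add]

omit [IsLocallyFiniteMeasure μ] in
variable (C) in
/-- The part of `X_λ × X_λᶜ` lying over the end, translated by `λ` to the quadrant. -/
theorem setIntegral_setIntegral_compl_truncation {f : X → X → ℂ}
    (hf : StronglyMeasurable (Function.uncurry f)) {r : ℝ} (hr : 0 ≤ r)
    (hi : IntegrableOn (fun x => ∫ w in (C.truncation r)ᶜ, f x w ∂μ) (C.truncation r) μ)
    (hj : IntegrableOn (fun p : (ℝ × Y) × (ℝ × Y) =>
      f (C.endMap (p.1.1 - r, p.1.2)) (C.endMap (p.2.1 - r, p.2.2)))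
      ((Ico 0 r ×ˢ univ) ×ˢ (Iio 0 ×ˢ univ))
      (((volume : Measure ℝ).prod ν).prod ((volume : Measure ℝ).prod ν))) :
    ∫ x in C.truncation r, ∫ w in (C.truncation r)ᶜ, f x w ∂μ ∂μ =
      ∫ x in C.truncation 0, ∫ w in (C.truncation r)ᶜ, f x w ∂μ ∂μ +
      ∫ p in (Ico 0 r ×ˢ univ) ×ˢ (Iio 0 ×ˢ univ),
        f (C.endMap (p.1.1 - r, p.1.2)) (C.endMap (p.2.1 - r, p.2.2))
        ∂(((volume : Measure ℝ).prod ν).prod ((volume : Measure ℝ).prod ν)) := by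
  have hm : StronglyMeasurable (fun x => ∫ w in (C.truncation r)ᶜ, f x w ∂μ) :=
    hf.integral_prod_right
  have hsh := measurePreserving_cylShift ν r
  have s1 : cylShift Y r ⁻¹' (Ico (-r) 0 ×ˢ univ) = Ico 0 r ×ˢ univ := by
    ext p
    simp [cylShift_apply]
  have s2 : cylShift Y r ⁻¹' (Iio (-r) ×ˢ univ) = Iio 0 ×ˢ univ := by
    ext p
    simp only [mem_preimage, cylShift_apply, mem_prod, mem_Iio, mem_univ, and_true]
    exact ⟨fun h => by linarith, fun h => by linarith⟩
  rw [C.setIntegral_truncation hm hr hi, setIntegral_prod _ hj, ← s1, ← s2,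
    ← hsh.setIntegral_preimage_emb (cylShift Y r).measurableEmbedding]
  congr 2
  funext p
  rw [C.setIntegral_compl_truncation (h := f _) (hf.comp_measurable measurable_prodMk_left) hr,
    ← hsh.setIntegral_preimage_emb (cylShift Y r).measurableEmbedding]
  rfl

-- A core point and a point beyond `-r` differ by at least `r` in the end coordinate. One order of
-- decay yields `e^{-r}`, the other integrability in `w`.
omit [SFinite μ] in
theorem IsEndKernel.tendsto_setIntegral_core (h : C.IsEndKernel k ℓ) (h' : C.IsEndKernel k' ℓ') :
    Tendsto (fun r : ℝ => ∫ x in C.truncation 0, ∫ w in (C.truncation r)ᶜ, commTrace k k' x w ∂μ ∂μ)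
      atTop (𝓝 0) := by
  have hfin := C.isFiniteMeasure_core
  obtain ⟨c, hc0, hc⟩ := h.norm_commTrace_le h' 2
  obtain ⟨hi, -⟩ := C.integrable_exp_endCoord 0
  set B := ∫ x, Real.exp (-|C.endCoord x - 0|) ∂μ
  refine squeeze_zero_norm' (a := fun r : ℝ =>
    c * Real.exp (-r) * B * (μ.restrict (C.truncation 0)).real univ) ?_ ?_
  · filter_upwards [eventually_ge_atTop 0] with r hr
    refine (norm_setIntegral_le_of_norm_le_const_ae' (C := c * Real.exp (-r) * B) ?_ ?_).trans
      (le_of_eq ?_)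
    · simpa using hfin.measure_univ_lt_top
    · refine Eventually.of_forall fun x hx => ?_
      have hS := (C.measurableSet_truncation hr).compl
      have hi2 := hi.const_mul (c * Real.exp (-r))
      refine (norm_integral_le_of_norm_le hi2.restrict
        ((ae_restrict_iff' hS).2 (Eventually.of_forall fun w hw => ?_))).trans
        ((setIntegral_le_integral hi2 (Eventually.of_forall fun w => ?_)).trans_eq
          (integral_const_mul _ _))
      · refine (hc x w).trans ?_
        rw [C.truncation_eq hr, mem_compl_iff, mem_ofPred_eq, not_le] at hw
        rw [C.endCoord_eq_zero_of_mem hx, mul_assoc, ← Real.exp_add]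
        gcongr
        rw [zero_sub, abs_neg, sub_zero, abs_of_nonpos (C.endCoord_nonpos w)]
        push_cast
        linarith
      · exact mul_nonneg (mul_nonneg hc0 (Real.exp_pos _).le) (Real.exp_pos _).le
    · simp
  · have : Tendsto (fun r : ℝ => Real.exp (-r)) atTop (𝓝 0) :=
      Real.tendsto_exp_atBot.comp tendsto_neg_atTop_atBot
    simpa using ((this.const_mul c).mul_const B).mul_const
      ((μ.restrict (C.truncation 0)).real univ)

variable (C) in
omit [BorelSpace X] [BorelSpace Y] [SecondCountableTopology Y] [IsFiniteMeasure ν]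
  [IsLocallyFiniteMeasure μ] [SFinite μ] in
theorem endCoord_sub_endCoord {r : ℝ} {p q : ℝ × Y} (hp : p.1 < r) (hq : q.1 < 0) (hr : 0 ≤ r) :
    C.endCoord (C.endMap (p.1 - r, p.2)) - C.endCoord (C.endMap (q.1 - r, q.2)) = p.1 - q.1 := by
  rw [C.endCoord_endMap (by simpa using hp), C.endCoord_endMap (by simp only; linarith)]
  ring

-- In coordinates translated by `r` the integrand over the end converges pointwise to that of the
-- invariant kernels, and the domain exhausts the quadrant. For `p ≥ 0 > q` one has `|p - q| = |p| +
-- |q|`, so decay in the end coordinate dominates uniformly in `r`; the core part tends to `0`.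
variable (μ) in
theorem IsEndKernel.tendsto_setIntegral_commTrace (h : C.IsEndKernel k ℓ)
    (h' : C.IsEndKernel k' ℓ') :
    Tendsto (fun r : ℝ => ∫ x in C.truncation r, ∫ w in (C.truncation r)ᶜ,
      commTrace k k' x w ∂μ ∂μ) atTop (𝓝 (momentPairing ν ℓ ℓ')) := by
  obtain ⟨c, hc0, hc⟩ := h.norm_commTrace_le h' 1
  obtain ⟨B, hB0, hB⟩ := h.exists_norm_setIntegral_commTrace_le (μ := μ) h'
  set f : ℝ → (ℝ × Y) × (ℝ × Y) → ℂ := fun r p =>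
    commTrace k k' (C.endMap (p.1.1 - r, p.1.2)) (C.endMap (p.2.1 - r, p.2.2)) with hf
  set D : ℝ → Set ((ℝ × Y) × (ℝ × Y)) := fun r => (Ico 0 r ×ˢ univ) ×ˢ (Iio 0 ×ˢ univ) with hD
  have hDm : ∀ r, MeasurableSet (D r) := fun r =>
    (measurableSet_Ico.prod .univ).prod (measurableSet_Iio.prod .univ)
  have hfm : ∀ r, StronglyMeasurable (f r) := fun r => by
    have m1 := C.measurable_endMap
    exact (h.stronglyMeasurable_commTrace h').comp_measurable
      (g := fun p : (ℝ × Y) × (ℝ × Y) =>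
        (C.endMap (p.1.1 - r, p.1.2), C.endMap (p.2.1 - r, p.2.2))) (by fun_prop)
  have hfb : ∀ r ≥ 0, ∀ p, ‖(D r).indicator (f r) p‖ ≤
      c * (Real.exp (-|p.1.1|) * Real.exp (-|p.2.1|)) := by
    intro r hr p
    by_cases hp : p ∈ D r
    · rw [indicator_of_mem hp]
      have h1 : 0 ≤ p.1.1 := hp.1.1.1
      have h2 : p.1.1 < r := hp.1.1.2
      have h3 : p.2.1 < 0 := hp.2.1
      refine (hc _ _).trans ?_
      rw [C.endCoord_sub_endCoord h2 h3 hr, ← Real.exp_add, Nat.cast_one, one_mul,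
        abs_of_nonneg h1, abs_of_neg h3, abs_of_nonneg (by linarith)]
      gcongr
      linarith
    · rw [indicator_of_notMem hp, norm_zero]
      positivity
  have hbi := (integrable_exp_prod (ν := ν)).const_mul c
  have hlim : Tendsto (fun r : ℝ => ∫ p, (D r).indicator (f r) p
      ∂(((volume : Measure ℝ).prod ν).prod ((volume : Measure ℝ).prod ν))) atTop
      (𝓝 (momentPairing ν ℓ ℓ')) := by
    rw [← integral_quadrant_eq_momentPairing h.isDecayKernel h'.isDecayKernel,
      ← integral_indicator ((measurableSet_Ici.prod .univ).prod (measurableSet_Iio.prod .univ))]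
    refine tendsto_integral_filter_of_dominated_convergence _
      (Eventually.of_forall fun r => ((hfm r).indicator (hDm r)).aestronglyMeasurable)
      ((eventually_ge_atTop 0).mono fun r hr => Eventually.of_forall (hfb r hr)) hbi
      (Eventually.of_forall fun p => ?_)
    by_cases hp : p ∈ (Ici (0 : ℝ) ×ˢ (univ : Set Y)) ×ˢ (Iio (0 : ℝ) ×ˢ (univ : Set Y))
    · rw [indicator_of_mem hp]
      have t1 := ((h.tendsto_translate p.1 p.2).mul (h'.tendsto_translate p.2 p.1))
      have t2 := ((h.tendsto_translate p.2 p.1).mul (h'.tendsto_translate p.1 p.2))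
      have t3 := (((fibTrCLM N).continuous.tendsto _).comp t1).sub
        (((fibTrCLM N).continuous.tendsto _).comp t2)
      simp only [fibTrCLM_apply] at t3
      refine t3.congr' ?_
      -- The translated domain is cut off at `p < r` by the core, so every point of the quadrant
      -- eventually belongs to it.
      filter_upwards [eventually_gt_atTop p.1.1] with r hr
      rw [indicator_of_mem (show p ∈ D r from ⟨⟨⟨hp.1.1, hr⟩, mem_univ _⟩, hp.2⟩)]
      simp only [Function.comp_apply, fibTrCLM_apply]
      rfl
    · rw [indicator_of_notMem hp]
      refine tendsto_const_nhds.congr fun r => (indicator_of_notMem (fun hp' => hp ?_) _).symm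
      exact ⟨⟨hp'.1.1.1, mem_univ _⟩, hp'.2⟩
  have := (h.tendsto_setIntegral_core (μ := μ) h').add hlim
  rw [zero_add] at this
  refine this.congr' ?_
  filter_upwards [eventually_ge_atTop 0] with r hr
  have hfin := C.isFiniteMeasure_restrict_truncation (μ := μ) hr
  rw [C.setIntegral_setIntegral_compl_truncation (h.stronglyMeasurable_commTrace h') hr
    (Integrable.of_bound (h.stronglyMeasurable_setIntegral_commTrace h' _).aestronglyMeasurable B
      (Eventually.of_forall fun x => hB x _)), integral_indicator (hDm r)]
  rw [← integrable_indicator_iff (hDm r)]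
  exact hbi.mono' ((hfm r).indicator (hDm r)).aestronglyMeasurable
    (Eventually.of_forall (hfb r hr))

omit [SFinite μ] in
theorem IsEndKernel.tendsto_regularizedTrace (h : C.IsEndKernel k ℓ) :
    Tendsto (C.regularizedIntegral k) atTop (𝓝 (C.regularizedTrace k)) :=
  tendsto_nhds_limUnder h.exists_tendsto_regularizedIntegral

theorem IsEndKernel.tendsto_regularizedTrace_comp (h : C.IsEndKernel k ℓ)
    (h' : C.IsEndKernel k' ℓ') : Tendsto (C.regularizedIntegral (comp μ k k')) atTop
      (𝓝 (C.regularizedTrace (comp μ k k'))) :=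
  tendsto_nhds_limUnder (h.exists_tendsto_regularizedIntegral_comp h')

/-- The coboundary of the regularized trace is the moment pairing of the indicial kernels. -/
theorem IsEndKernel.regularizedTrace_sub (h : C.IsEndKernel k ℓ) (h' : C.IsEndKernel k' ℓ') :
    C.regularizedTrace (comp μ k k') - C.regularizedTrace (comp μ k' k) =
      momentPairing ν ℓ ℓ' := by
  refine tendsto_nhds_unique (((h.tendsto_regularizedTrace_comp h').sub
    (h'.tendsto_regularizedTrace_comp h)).congr' ?_) (h.tendsto_setIntegral_commTrace μ h')
  filter_upwards [eventually_ge_atTop 0] with r hr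
  exact h.regularizedIntegral_sub h' hr

end CylindricalEnd

end RoeMelrose

end

/-! ### The main theorem -/

theorem mainTheorem8 {n N : ℕ} {Y : Type*} [TopologicalSpace Y] [T2Space Y] [CompactSpace Y]
    [ChartedSpace (EuclideanSpace ℝ (Fin n)) Y] [IsManifold (𝓡 n) ∞ Y]
    [MeasurableSpace Y] [BorelSpace Y]
    (ν : Measure Y) (hν : IsSmoothDensity n ν)
    (P : Y → EndFib N) (hP : IsHermitianBundle n N P) :
    -- the two 1-cocycles are well defined and coincide
    (∀ ℓ ℓ' : ℝ → Y → Y → EndFib N, IsInvariantKernel n P ℓ → IsInvariantKernel n P ℓ' →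
      IsIntegralOperator ((volume : Measure ℝ).prod ν) (cylKernel ℓ) (cylOperator ν ℓ) ∧
      IsTraceClass (roeOperator ν ℓ ℓ') ∧
      (∀ μ : ℝ, IsIntegralOperator ν (fourierKernel ℓ μ) (indicialFamily ν ℓ μ)) ∧
      Differentiable ℝ (indicialFamily ν ℓ) ∧
      (∀ μ : ℝ, IsTraceClass (melroseOperator ν ℓ ℓ' μ)) ∧
      Integrable (fun μ : ℝ => opTrace (melroseOperator ν ℓ ℓ' μ)) ∧
      roeCocycle ν ℓ ℓ' = melroseCocycle ν ℓ ℓ') ∧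
    -- `σ₁` is cyclic
    (∀ ℓ ℓ' : ℝ → Y → Y → EndFib N, IsInvariantKernel n P ℓ → IsInvariantKernel n P ℓ' →
      roeCocycle ν ℓ ℓ' = -roeCocycle ν ℓ' ℓ) ∧
    -- `b σ₁ = 0`
    (∀ ℓ₀ ℓ₁ ℓ₂ : ℝ → Y → Y → EndFib N, IsInvariantKernel n P ℓ₀ → IsInvariantKernel n P ℓ₁ →
      IsInvariantKernel n P ℓ₂ →
      roeCocycle ν (conv ν ℓ₀ ℓ₁) ℓ₂ - roeCocycle ν ℓ₀ (conv ν ℓ₁ ℓ₂)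
        + roeCocycle ν (conv ν ℓ₂ ℓ₀) ℓ₁ = 0) ∧
    -- `b τ₀ʳ = I^* σ₁` on every manifold with cylindrical end over `Y`
    (∀ {X : Type*} [TopologicalSpace X] [T2Space X] [SecondCountableTopology X]
      [ChartedSpace (EuclideanSpace ℝ (Fin (n + 1))) X] [IsManifold (𝓡 (n + 1)) ∞ X]
      [MeasurableSpace X] [BorelSpace X]
      (μ : Measure X) (_ : IsSmoothDensity (n + 1) μ) (C : CylindricalEnd n ν μ)
      (Q : X → EndFib N) (_ : IsHermitianBundle (n + 1) N Q)
      (_ : ∀ t < C.width, ∀ y, Q (C.incl (t, y)) = P y),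
      (∀ k : X → X → EndFib N, C.IsSmoothingKernel P Q k →
        IsInvariantKernel n P (C.indicialKernel k) ∧
        Tendsto (C.regularizedIntegral k) atTop (𝓝 (C.regularizedTrace k))) ∧
      (∀ k k' : X → X → EndFib N, C.IsSmoothingKernel P Q k → C.IsSmoothingKernel P Q k' →
        C.indicialKernel (comp μ k k') = conv ν (C.indicialKernel k) (C.indicialKernel k') ∧
        Tendsto (C.regularizedIntegral (comp μ k k')) atTop
          (𝓝 (C.regularizedTrace (comp μ k k'))) ∧
        C.regularizedTrace (comp μ k k') - C.regularizedTrace (comp μ k' k)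
          = roeCocycle ν (C.indicialKernel k) (C.indicialKernel k'))) := by
  have : SecondCountableTopology Y :=
    ChartedSpace.secondCountable_of_sigmaCompact (EuclideanSpace ℝ (Fin n)) Y
  have := hν.isLocallyFiniteMeasure
  have : IsFiniteMeasure ν := CompactSpace.isFiniteMeasure
  refine ⟨fun ℓ ℓ' h h' => ?_, fun ℓ ℓ' h h' => ?_, fun ℓ₀ ℓ₁ ℓ₂ h₀ h₁ h₂ => ?_, ?_⟩
  · have d := h.isDecayKernel
    have d' := h'.isDecayKernel
    refine ⟨d.isIntegralOperator_cylOperator, (isTraceClass_roeOperator d d').1,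
      d.isIntegralOperator_indicialFamily, fun μ => (d.hasDerivAt_indicialFamily μ).differentiableAt,
      isTraceClass_melroseOperator d d', (integrable_opTrace_melroseOperator d d').1, ?_⟩
    -- Both cocycles are the moment pairing, and so are compared through it.
    rw [roeCocycle_eq_momentPairing d d', melroseCocycle_eq_momentPairing d d']
  · have d := h.isDecayKernel
    have d' := h'.isDecayKernel
    rw [roeCocycle_eq_momentPairing d d', roeCocycle_eq_momentPairing d' d,
      momentPairing_antisymm d d']
  · have d₀ := h₀.isDecayKernel
    have d₁ := h₁.isDecayKernel
    have d₂ := h₂.isDecayKernel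
    rw [roeCocycle_eq_momentPairing (d₀.conv d₁) d₂, roeCocycle_eq_momentPairing d₀ (d₁.conv d₂),
      roeCocycle_eq_momentPairing (d₂.conv d₀) d₁]
    exact momentPairing_cocycle d₀ d₁ d₂
  · intro X _ _ _ _ _ _ _ μ hμ C Q _ _
    have := hμ.isLocallyFiniteMeasure
    refine ⟨fun k hk => ?_, fun k k' hk hk' => ?_⟩
    · obtain ⟨ℓ, hℓ, h⟩ := hk.exists_isEndKernel
      rw [h.indicialKernel_eq]
      exact ⟨hℓ, h.tendsto_regularizedTrace⟩
    · obtain ⟨ℓ, hℓ, h⟩ := hk.exists_isEndKernel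
      obtain ⟨ℓ', hℓ', h'⟩ := hk'.exists_isEndKernel
      rw [h.indicialKernel_eq, h'.indicialKernel_eq,
        roeCocycle_eq_momentPairing h.isDecayKernel h'.isDecayKernel]
      exact ⟨h.indicialKernel_comp h', h.tendsto_regularizedTrace_comp h',
        h.regularizedTrace_sub h'⟩
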